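/- Let $\mu>0$, $\beta>0$, $\gamma>1$, $\bar\rho>0$ be constants with $\gamma\le 2\beta$, put $\lambda(\rho)=\rho^\beta$, $P(\rho)=\rho^\gamma$ and $$\Psi(\rho,\bar\rho)=\frac{1}{\gamma-1}\bigl[\rho^\gamma-\bar\rho^\gamma-\gamma\bar\rho^{\gamma-1}(\rho-\bar\rho)\bigr],$$ and let $\alpha>0$ satisfy $$\alpha^2<\frac{4\bigl(\sqrt{2+\lambda(\bar\rho)/\mu}-1\bigr)}{1+\lambda(\bar\rho)/\mu}.$$ Consider on $[0,T]\times\mathbb{R}^2$ the compressible Navier–Stokes system $$\partial_t\rho+\operatorname{div}(\rho u)=0,\qquad \partial_t(\rho u)+\operatorname{div}(\rho u\otimes u)+\nabla P(\rho)=\mu\Delta u+\nabla\bigl((\mu+\lambda(\rho))\operatorname{div}u\bigr).$$ By a smooth solution on $[0,T]$ we mean a pair $(\rho,u)$ with $\rho\ge 0$ bounded, $\rho,u$ continuous on $[0,T]\times\mathbb{R}^2$ and $C^1$ on $(0,T)\times\mathbb{R}^2$, $u$ twice differentiable in $x$ with second derivatives continuous on $(0,T)\times\mathbb{R}^2$,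 $(\mu+\lambda(\rho))\operatorname{div}u$ of class $C^1$ in $x$ for each $t\in(0,T)$ (automatic if $\rho>0$ or $\beta\ge1$), $\sup_{0<t<T}\|u(t)\|_{H^1}<\infty$, $\sup_{0\le t\le T}\|\Psi(\rho,\bar\rho)(t)\|_1<\infty$, which satisfies the system pointwise on $(0,T)\times\mathbb{R}^2$. Write $(\rho_0,u_0)=(\rho,u)(0,\cdot)$; $\|\cdot\|_p$ is the norm of $L^p(\mathbb{R}^2)$. Then there is $m_0>1$ such that for every $T>0$ and every $E_0<\infty$ there is a constant $C_\alpha>0$, depending only on $\alpha,\mu,\beta,\gamma,\bar\rho,T,E_0$ (in particular not on $m$), such that every smooth solution on $[0,T]$ with $$\int_{\mathbb{R}^2}\bigl[\rho_0|u_0|^2+\Psi(\rho_0,\bar\rho)\bigr]dx\le E_0,\qquad \int_{\mathbb{R}^2}|x|^\alpha\bigl[\rho_0|u_0|^2+\Psi(\rho_0,\bar\rho)\bigr]dx\le E_0$$ satisfies, for all real $m\ge m_0$ and all $t\in[0,T]$, $$\int_{\mathbb{R}^2}|x|^\alpha\bigl[\rho|u|^2+\Psi(\rho,\bar\rho)\bigr](t,x)\,dx+\int_0^t\Bigl[\bigl\||x|^{\alpha/2}\nabla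 u\bigr\|_2^2+\bigl\||x|^{\alpha/2}\operatorname{div}u\bigr\|_2^2+\bigl\||x|^{\alpha/2}\sqrt{\lambda(\rho)}\operatorname{div}u\bigr\|_2^2\Bigr](s)\,ds$$ $$\le C_\alpha\Bigl[1+\int_0^t\bigl(\|\rho-\bar\rho\|_{2m\beta+1}^{\beta}(s)+1\bigr)\bigl(\|\nabla u\|_2^2(s)+1\bigr)\,ds\Bigr].$$ -/

import Mathlib

open MeasureTheory Set
open scoped ENNReal NNReal Gradient Laplacian

noncomputable section

/-- The Euclidean plane. -/
abbrev Plane : Type := EuclideanSpace ℝ (Fin 2)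

/-- The `j`-th partial derivative of `f` at `x`. -/
def pderiv {F : Type*} [NormedAddCommGroup F] [NormedSpace ℝ F]
    (j : Fin 2) (f : Plane → F) (x : Plane) : F :=
  fderiv ℝ f x (EuclideanSpace.single j 1)

/-- The divergence of a vector field on the plane. -/
def divergence (v : Plane → Plane) (x : Plane) : ℝ :=
  ∑ i, pderiv i v x i

/-- The squared (Frobenius) length of the velocity gradient, `∑ i j, (∂_j v_i)²`. -/
def gradSq (v : Plane → Plane) (x : Plane) : ℝ :=
  ∑ i, ∑ j, (pderiv j v x i) ^ 2

/-- The bulk viscosity `λ(ρ) = ρ ^ β`. -/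
def bulkViscosity (β r : ℝ) : ℝ := r ^ β

/-- The pressure `P(ρ) = ρ ^ γ`. -/
def pressure (γ r : ℝ) : ℝ := r ^ γ

/-- The potential energy `Ψ(ρ, ρbar)` relative to the far-field density `ρbar`. -/
def potentialEnergy (γ ρbar r : ℝ) : ℝ :=
  1 / (γ - 1) * (r ^ γ - ρbar ^ γ - γ * ρbar ^ (γ - 1) * (r - ρbar))

/-- `(ρ, u)` is a smooth solution on `[0, T] × ℝ²` of the compressible Navier-Stokes system
`∂ₜρ + div(ρu) = 0`,
`∂ₜ(ρu) + div(ρu ⊗ u) + ∇P(ρ) = μ Δu + ∇((μ + λ(ρ)) div u)`,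
with nonnegative bounded density, far-field state `(ρbar, 0)` in the sense of finite energy,
and `u` bounded in `H¹`. No size of any of these bounds is prescribed. -/
structure IsSmoothSolution (μ β γ ρbar T : ℝ) (ρ : ℝ → Plane → ℝ) (u : ℝ → Plane → Plane) :
    Prop where
  density_nonneg : ∀ t ∈ Icc 0 T, ∀ x, 0 ≤ ρ t x
  density_bounded : ∃ R : ℝ, ∀ t ∈ Icc 0 T, ∀ x, ρ t x ≤ R
  density_continuous : ContinuousOn (fun p : ℝ × Plane => ρ p.1 p.2) (Icc 0 T ×ˢ univ)
  velocity_continuous : ContinuousOn (fun p : ℝ × Plane => u p.1 p.2) (Icc 0 T ×ˢ univ)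
  density_contDiff : ContDiffOn ℝ 1 (fun p : ℝ × Plane => ρ p.1 p.2) (Ioo 0 T ×ˢ univ)
  velocity_contDiff : ContDiffOn ℝ 1 (fun p : ℝ × Plane => u p.1 p.2) (Ioo 0 T ×ˢ univ)
  velocity_contDiff_two : ∀ t ∈ Ioo 0 T, ContDiff ℝ 2 (u t)
  velocity_continuous_two :
    ContinuousOn (fun p : ℝ × Plane => iteratedFDeriv ℝ 2 (u p.1) p.2) (Ioo 0 T ×ˢ univ)
  /-- Automatic where `ρ > 0`, and everywhere if `β ≥ 1`. -/
  viscousFlux_contDiff : ∀ t ∈ Ioo 0 T,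
    ContDiff ℝ 1 (fun x => (μ + bulkViscosity β (ρ t x)) * divergence (u t) x)
  velocity_bounded : ∃ K : ℝ≥0, ∀ t ∈ Ioo 0 T,
    ∫⁻ x, ENNReal.ofReal (‖u t x‖ ^ 2 + gradSq (u t) x) ≤ K
  potential_bounded : ∃ K : ℝ≥0, ∀ t ∈ Icc 0 T,
    ∫⁻ x, ENNReal.ofReal (potentialEnergy γ ρbar (ρ t x)) ≤ K
  continuity_eq : ∀ t ∈ Ioo 0 T, ∀ x,
    deriv (fun s => ρ s x) t + divergence (fun y => ρ t y • u t y) x = 0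
  momentum_eq : ∀ t ∈ Ioo 0 T, ∀ x,
    deriv (fun s => ρ s x • u s x) t
        + ∑ j, pderiv j (fun y => (ρ t y * u t y j) • u t y) x
        + gradient (fun y => pressure γ (ρ t y)) x
      = μ • (Δ (u t)) x
        + gradient (fun y => (μ + bulkViscosity β (ρ t y)) * divergence (u t) y) x

/-- The weighted energy `∫ |x|^α (ρ |u|² + Ψ(ρ, ρbar)) dx` of a state `(r, v)`. -/
def weightedEnergy (α γ ρbar : ℝ) (r : Plane → ℝ) (v : Plane → Plane) : ℝ≥0∞ :=
  ∫⁻ x, ENNReal.ofReal (‖x‖ ^ α * (r x * ‖v x‖ ^ 2 + potentialEnergy γ ρbar (r x)))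

/-- The energy `∫ (ρ |u|² + Ψ(ρ, ρbar)) dx` of a state `(r, v)`. -/
def plainEnergy (γ ρbar : ℝ) (r : Plane → ℝ) (v : Plane → Plane) : ℝ≥0∞ :=
  ∫⁻ x, ENNReal.ofReal (r x * ‖v x‖ ^ 2 + potentialEnergy γ ρbar (r x))

/-- `‖ |x|^{α/2} ∇v ‖₂² + ‖ |x|^{α/2} div v ‖₂² + ‖ |x|^{α/2} √λ(r) div v ‖₂²`. -/
def weightedDissipation (α β : ℝ) (r : Plane → ℝ) (v : Plane → Plane) : ℝ≥0∞ :=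
  (∫⁻ x, ENNReal.ofReal (‖x‖ ^ α * gradSq v x))
    + (∫⁻ x, ENNReal.ofReal (‖x‖ ^ α * divergence v x ^ 2))
    + ∫⁻ x, ENNReal.ofReal (‖x‖ ^ α * (bulkViscosity β (r x) * divergence v x ^ 2))

end

/-! Testing the momentum equation with η²u and the continuity equation with η²(Ψ' - |u|²/2), for a
compactly supported weight η, gives d/dt ∫ η²(½ρ|u|² + Ψ) + ∫ η²(μ|∇u|² + (μ+λ)(div u)²) = ∫ ∇(η²) ·
flux (`hasDerivAt_weighted_energy`). Nothing is divided by ρ, so vacuum is harmless. The weight is a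
truncation of (1+|x|²)^{α/4}. The bound on α serves only to give α < 2, which makes |∇η| bounded
uniformly in the truncation (`exists_truncated_weight`).

Since ∇(η²) = 2η∇η, every error term has one factor η, which Young's inequality spends on the
weighted dissipation or the weighted energy, and one bounded factor ∇η. What remains are the
unweighted integrals of |u|², λ(ρ)|u|² and Ψ|u|², and the convective integral of ηρ|u|³. All are
controlled by n = (1 + ‖ρ-ρbar‖_p^β)(1 + ‖∇u‖₂²), p = 2mβ+1, the last one up to small multiples of
the weighted dissipation and constant multiples of the weighted energy
(`exists_integral_convection_le`). Three facts carry this. Finite energy controls ‖u‖₂ by √ρ u and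
∇u (`exists_integral_norm_sq_le`), so planar Sobolev inequalities bound all even moments of u by
powers of 1 + ‖∇u‖₂². A Hölder inequality that tests the second factor only in L¹ and L², whatever p
is, makes the constants independent of m (`integral_rpow_mul_le`). Finally γ ≤ 2β lets a square root
turn growth ρ^γ into ρ^β (`exists_integral_potential_mul_le`).

The estimates presuppose the basic energy bound at each time. It comes from the same identity with
cutoffs whose gradients tend to zero: the qualitative bounds of a smooth solution then make the
error vanish (`integral_energyDensity_le`). In the weighted inequality the energy is multiplied by a
constant and n enters only as a forcing term, so Grönwall's inequality gives a bound linear in ∫ n.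
Fatou's lemma removes the truncation. -/

namespace WeightedEnergy

open Filter Topology

/-! ### Cauchy-Schwarz, exhaustion, cutoffs and Sobolev inequalities in the plane -/

/-- Cauchy-Schwarz for square integrable real functions. -/
theorem integral_mul_sq_le {X : Type*} [MeasurableSpace X] {ν : Measure X} {f g : X → ℝ}
    (hf : AEStronglyMeasurable f ν) (hg : AEStronglyMeasurable g ν)
    (hf2 : Integrable (fun x => f x ^ 2) ν) (hg2 : Integrable (fun x => g x ^ 2) ν) :
    Integrable (fun x => f x * g x) ν ∧
      (∫ x, f x * g x ∂ν) ^ 2 ≤ (∫ x, f x ^ 2 ∂ν) * ∫ x, g x ^ 2 ∂ν := by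
  have hfg : Integrable (fun x => f x * g x) ν :=
    ((memLp_two_iff_integrable_sq hf).2 hf2).integrable_mul ((memLp_two_iff_integrable_sq hg).2 hg2)
  refine ⟨hfg, ?_⟩
  have key : ∀ s : ℝ, 0 ≤ (∫ x, f x ^ 2 ∂ν) * (s * s) + (2 * ∫ x, f x * g x ∂ν) * s
      + ∫ x, g x ^ 2 ∂ν := by
    intro s
    have h0 : 0 ≤ ∫ x, (s * f x + g x) ^ 2 ∂ν := integral_nonneg fun x => sq_nonneg _
    have h1 : ∫ x, (s * f x + g x) ^ 2 ∂ν
        = ∫ x, ((s * s) * f x ^ 2 + (2 * s) * (f x * g x) + g x ^ 2) ∂ν := by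
      congr 1; ext x; ring
    have i1 : Integrable (fun x => (s * s) * f x ^ 2) ν := hf2.const_mul _
    have i2 : Integrable (fun x => (2 * s) * (f x * g x)) ν := hfg.const_mul _
    have i3 : Integrable (fun x => (s * s) * f x ^ 2 + (2 * s) * (f x * g x)) ν := i1.add i2
    rw [h1, integral_add i3 hg2, integral_add i1 i2, integral_const_mul, integral_const_mul] at h0
    linarith
  have := discrim_le_zero key
  unfold discrim at this
  nlinarith

/-- An integral bound passes to the limit of an exhausting sequence. -/
theorem lintegral_le_of_exhaustion {X : Type*} [MeasurableSpace X] {ν : Measure X}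
    {g : ℕ → X → ℝ≥0∞} {G : X → ℝ≥0∞} (hg : ∀ n, AEMeasurable (g n) ν)
    (hlim : ∀ᵐ x ∂ν, ∀ᶠ n in atTop, G x ≤ g n x) {b : ℕ → ℝ≥0∞} {B : ℝ≥0∞}
    (hb : ∀ n, ∫⁻ x, g n x ∂ν ≤ b n) (hB : Tendsto b atTop (𝓝 B)) :
    ∫⁻ x, G x ∂ν ≤ B := by
  calc ∫⁻ x, G x ∂ν ≤ ∫⁻ x, liminf (fun n => g n x) atTop ∂ν := by
        refine lintegral_mono_ae ?_
        filter_upwards [hlim] with x hx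
        exact le_liminf_of_le (by isBoundedDefault) hx
    _ ≤ liminf (fun n => ∫⁻ x, g n x ∂ν) atTop := lintegral_liminf_le' hg
    _ ≤ liminf b atTop := liminf_le_liminf (Eventually.of_forall hb)
    _ = B := hB.liminf_eq

theorem integrable_of_exhaustion {X : Type*} [MeasurableSpace X] {ν : Measure X}
    {g : ℕ → X → ℝ} {G : X → ℝ} (hg : ∀ n, Integrable (g n) ν) (hG : AEStronglyMeasurable G ν)
    (hg0 : ∀ n x, 0 ≤ g n x) (hG0 : ∀ x, 0 ≤ G x)
    (hlim : ∀ x, ∀ᶠ n in atTop, G x ≤ g n x) {b : ℕ → ℝ} {B : ℝ}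
    (hb : ∀ n, ∫ x, g n x ∂ν ≤ b n) (hB : Tendsto b atTop (𝓝 B)) :
    Integrable G ν ∧ ∫ x, G x ∂ν ≤ B := by
  have h : ∫⁻ x, ENNReal.ofReal (G x) ∂ν ≤ ENNReal.ofReal B := by
    refine lintegral_le_of_exhaustion (g := fun n x => ENNReal.ofReal (g n x))
      (b := fun n => ENNReal.ofReal (b n))
      (fun n => (hg n).aestronglyMeasurable.aemeasurable.ennreal_ofReal)
      (Eventually.of_forall fun x => ?_) (fun n => ?_) (ENNReal.tendsto_ofReal hB)
    · filter_upwards [hlim x] with n hn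
      exact ENNReal.ofReal_le_ofReal hn
    · rw [← ofReal_integral_eq_lintegral_ofReal (hg n) (Eventually.of_forall (hg0 n))]
      exact ENNReal.ofReal_le_ofReal (hb n)
  have hB0 : 0 ≤ B := ge_of_tendsto' hB fun n => (integral_nonneg (hg0 n)).trans (hb n)
  have hi : Integrable G ν := by
    refine ⟨hG, ?_⟩
    rw [hasFiniteIntegral_iff_ofReal (Eventually.of_forall hG0)]
    exact h.trans_lt ENNReal.ofReal_lt_top
  refine ⟨hi, ?_⟩
  rw [← ofReal_integral_eq_lintegral_ofReal hi (Eventually.of_forall hG0)] at h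
  exact (ENNReal.ofReal_le_ofReal_iff hB0).1 h

theorem tendsto_const_div_succ (M : ℝ) :
    Tendsto (fun n : ℕ => M / ((n : ℝ) + 1)) atTop (𝓝 0) := by
  simpa [div_eq_mul_inv] using (tendsto_one_div_add_atTop_nhds_zero_nat (𝕜 := ℝ)).const_mul M

/-- A sequence of cutoff functions with gradients of order `1 / (n + 1)`. -/
theorem exists_cutoff : ∃ M : ℝ, 0 < M ∧ ∃ χ : ℕ → Plane → ℝ, ∀ n,
    ContDiff ℝ 1 (χ n) ∧ HasCompactSupport (χ n) ∧ (∀ x, 0 ≤ χ n x) ∧ (∀ x, χ n x ≤ 1) ∧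
    (∀ x, ‖x‖ ≤ n + 1 → χ n x = 1) ∧ (∀ x, 2 * ((n : ℝ) + 1) < ‖x‖ → χ n x = 0) ∧
    (∀ x, ‖fderiv ℝ (χ n) x‖ ≤ M / (n + 1)) ∧
    (∀ x, 2 * ((n : ℝ) + 1) < ‖x‖ → fderiv ℝ (χ n) x = 0) := by
  let b : ContDiffBump (0 : Plane) := ⟨1, 2, one_pos, one_lt_two⟩
  have hb : ContDiff ℝ 1 b := b.contDiff
  obtain ⟨M, hM⟩ := (hb.continuous_fderiv one_ne_zero).bounded_above_of_compact_support
    (b.hasCompactSupport.fderiv (𝕜 := ℝ))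
  refine ⟨max M 1, by positivity, fun n x => b (((n : ℝ) + 1)⁻¹ • x), fun n => ?_⟩
  have hn : (0 : ℝ) < (n : ℝ) + 1 := by positivity
  have hzero : ∀ x : Plane, 2 * ((n : ℝ) + 1) < ‖x‖ → b (((n : ℝ) + 1)⁻¹ • x) = 0 := by
    intro x hx
    apply b.zero_of_le_dist
    rw [dist_zero_right, norm_smul, Real.norm_of_nonneg (by positivity)]
    change (2 : ℝ) ≤ _
    rw [inv_mul_eq_div, le_div_iff₀ hn]
    exact hx.le
  refine ⟨hb.comp (contDiff_const_smul _), ?_, fun x => b.nonneg, fun x => b.le_one, ?_, hzero,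
    ?_, ?_⟩
  · refine HasCompactSupport.intro (isCompact_closedBall 0 (2 * ((n : ℝ) + 1))) fun x hx => ?_
    apply hzero
    simpa using hx
  · intro x hx
    apply b.one_of_mem_closedBall
    rw [mem_closedBall_zero_iff, norm_smul, Real.norm_of_nonneg (by positivity)]
    change _ ≤ (1 : ℝ)
    rw [inv_mul_eq_div, div_le_one hn]
    exact hx
  · intro x
    have hd : HasFDerivAt (fun x : Plane => b (((n : ℝ) + 1)⁻¹ • x))
        (((n : ℝ) + 1)⁻¹ • fderiv ℝ b (((n : ℝ) + 1)⁻¹ • x)) x := by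
      have h1 := (hb.differentiable one_ne_zero (((n : ℝ) + 1)⁻¹ • x)).hasFDerivAt.comp x
        ((hasFDerivAt_id x).const_smul (((n : ℝ) + 1)⁻¹))
      refine h1.congr_fderiv ?_
      ext v; simp
    rw [hd.fderiv, norm_smul, Real.norm_of_nonneg (by positivity), inv_mul_eq_div]
    gcongr
    exact (hM _).trans (le_max_left _ _)
  · intro x hx
    have : (fun x : Plane => b (((n : ℝ) + 1)⁻¹ • x)) =ᶠ[𝓝 x] fun _ => 0 := by
      filter_upwards [(isOpen_lt continuous_const continuous_norm).mem_nhds hx] with y hy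
      exact hzero y hy
    rw [this.fderiv_eq]; simp

theorem integrable_pow_of_hasCompactSupport {f : Plane → ℝ} (hf : Continuous f)
    (hs : HasCompactSupport f) {j : ℕ} (hj : j ≠ 0) : Integrable (fun x => f x ^ j) := by
  have h1 : Continuous fun x => f x ^ j := by fun_prop
  have h2 : HasCompactSupport fun x => f x ^ j :=
    hs.comp_left (g := fun y : ℝ => y ^ j) (by simp [hj])
  exact h1.integrable_of_hasCompactSupport h2

theorem integrable_fderiv_sq_of_hasCompactSupport {f : Plane → ℝ} (hf : ContDiff ℝ 1 f)
    (hs : HasCompactSupport f) : Integrable (fun x => ‖fderiv ℝ f x‖ ^ 2) :=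
  integrable_pow_of_hasCompactSupport (hf.continuous_fderiv one_ne_zero).norm
    (hs.fderiv (𝕜 := ℝ)).norm two_ne_zero

/-- The Gagliardo-Nirenberg-Sobolev inequality `‖g‖₂ ≤ C ‖∇g‖₁` in the plane. -/
theorem exists_integral_sq_le_fderiv : ∃ C : ℝ, 0 < C ∧ ∀ g : Plane → ℝ, ContDiff ℝ 1 g →
    HasCompactSupport g → ∫ x, g x ^ 2 ≤ C * (∫ x, ‖fderiv ℝ g x‖) ^ 2 := by
  have hp : Real.HolderConjugate (Module.finrank ℝ Plane) 2 := by
    simp only [finrank_euclideanSpace, Fintype.card_fin]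
    exact_mod_cast Real.HolderConjugate.two_two
  obtain ⟨K, hK⟩ : ∃ K : ℝ≥0, ∀ g : Plane → ℝ, ContDiff ℝ 1 g → HasCompactSupport g →
      ∫⁻ x, ‖g x‖ₑ ^ (2 : ℝ) ≤ K * (∫⁻ x, ‖fderiv ℝ g x‖ₑ) ^ (2 : ℝ) :=
    ⟨_, fun g hg hs => lintegral_pow_le_pow_lintegral_fderiv (volume : Measure Plane) hg hs hp⟩
  refine ⟨(K : ℝ) + 1, by positivity, fun g hg hs => ?_⟩
  have h := hK g hg hs
  have hi1 := integrable_pow_of_hasCompactSupport hg.continuous hs two_ne_zero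
  have hi2 : Integrable (fun x => ‖fderiv ℝ g x‖) :=
    (hg.continuous_fderiv one_ne_zero).norm.integrable_of_hasCompactSupport
      (hs.fderiv (𝕜 := ℝ)).norm
  have e1 : ∫⁻ x, ‖g x‖ₑ ^ (2 : ℝ) = ENNReal.ofReal (∫ x, g x ^ 2) := by
    rw [ofReal_integral_eq_lintegral_ofReal hi1 (Eventually.of_forall fun x => sq_nonneg _)]
    congr 1; ext x
    rw [← ofReal_norm, ENNReal.rpow_two, ← ENNReal.ofReal_pow (norm_nonneg _)]
    simp
  have e2 : ∫⁻ x, ‖fderiv ℝ g x‖ₑ = ENNReal.ofReal (∫ x, ‖fderiv ℝ g x‖) := by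
    rw [ofReal_integral_eq_lintegral_ofReal hi2 (Eventually.of_forall fun x => norm_nonneg _)]
    congr 1; ext x
    rw [ofReal_norm]
  have h0 : 0 ≤ ∫ x, ‖fderiv ℝ g x‖ := integral_nonneg fun x => norm_nonneg _
  rw [e1, e2, ENNReal.rpow_two, ← ENNReal.ofReal_pow h0, ← ENNReal.ofReal_coe_nnreal,
    ← ENNReal.ofReal_mul (by positivity), ENNReal.ofReal_le_ofReal_iff (by positivity)] at h
  refine h.trans ?_
  gcongr
  linarith

/-- Induction on k: the inequality ‖g‖₂ ≤ C‖∇g‖₁ is applied to g = f^{k+2}. Its gradient is (k+2)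
f^{k+1} ∇f, and Cauchy-Schwarz splits the L¹ norm into the previous moment and one more factor
‖∇f‖₂². -/
theorem integral_pow_le_of_hasCompactSupport (k : ℕ) : ∃ C : ℝ, 0 < C ∧ ∀ f : Plane → ℝ,
    ContDiff ℝ 1 f → HasCompactSupport f →
    ∫ x, f x ^ (2 * k + 2) ≤ C * (∫ x, f x ^ 2) * (∫ x, ‖fderiv ℝ f x‖ ^ 2) ^ k := by
  obtain ⟨C, hC, hgns⟩ := exists_integral_sq_le_fderiv
  induction k with
  | zero => exact ⟨1, one_pos, fun f _ _ => by simp⟩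
  | succ k ih =>
    obtain ⟨Ck, hCk, hk⟩ := ih
    refine ⟨C * (k + 2) ^ 2 * Ck, by positivity, fun f hf hs => ?_⟩
    have hd := hf.continuous_fderiv one_ne_zero
    have hpow : ∀ j, j ≠ 0 → HasCompactSupport fun x => f x ^ j := fun j hj =>
      hs.comp_left (g := fun y : ℝ => y ^ j) (by simp [hj])
    have h1 := hgns (fun x => f x ^ (k + 2)) (hf.pow _) (hpow _ (by simp))
    have hfd : ∀ x, ‖fderiv ℝ (fun x => f x ^ (k + 2)) x‖
        = (k + 2) * (|f x| ^ (k + 1) * ‖fderiv ℝ f x‖) := by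
      intro x
      have := ((hf.differentiable one_ne_zero x).hasFDerivAt.pow (k + 2)).fderiv
      rw [this, norm_smul]
      simp only [Nat.add_succ_sub_one, nsmul_eq_mul, Nat.cast_add, Nat.cast_ofNat,
        norm_mul, Real.norm_eq_abs, abs_pow]
      rw [abs_of_nonneg (by positivity : (0 : ℝ) ≤ (k : ℝ) + 2)]
      ring
    simp only [hfd] at h1
    rw [integral_const_mul, mul_pow] at h1
    have h2 := (integral_mul_sq_le (ν := (volume : Measure Plane))
      (f := fun x => |f x| ^ (k + 1)) (g := fun x => ‖fderiv ℝ f x‖)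
      (hf.continuous.abs.pow _).aestronglyMeasurable hd.norm.aestronglyMeasurable
      (by
        have : Integrable fun x => f x ^ (2 * k + 2) :=
          integrable_pow_of_hasCompactSupport hf.continuous hs (by simp)
        refine this.congr (Eventually.of_forall fun x => ?_)
        change _ = (|f x| ^ (k + 1)) ^ 2
        rw [← pow_mul, mul_comm (k + 1) 2, pow_mul |f x|, sq_abs, ← pow_mul]; ring)
      (integrable_fderiv_sq_of_hasCompactSupport hf hs)).2
    have e : ∀ x, (|f x| ^ (k + 1)) ^ 2 = f x ^ (2 * k + 2) := fun x => by
      rw [← pow_mul, mul_comm (k + 1) 2, pow_mul |f x|, sq_abs, ← pow_mul]; ring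
    simp only [e] at h2
    have h3 := hk f hf hs
    have hD : 0 ≤ ∫ x, ‖fderiv ℝ f x‖ ^ 2 := integral_nonneg fun x => sq_nonneg _
    calc ∫ x, f x ^ (2 * (k + 1) + 2) = ∫ x, (f x ^ (k + 2)) ^ 2 := by
          congr 1; ext x; ring
      _ ≤ _ := h1
      _ ≤ C * ((k + 2) ^ 2 * ((Ck * (∫ x, f x ^ 2) * (∫ x, ‖fderiv ℝ f x‖ ^ 2) ^ k)
            * ∫ x, ‖fderiv ℝ f x‖ ^ 2)) := by
          gcongr
          refine h2.trans ?_
          gcongr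
      _ = _ := by ring

/-- Sobolev-Ladyzhenskaya inequalities in the plane: `‖f‖_{2k+2}^{2k+2} ≤ C ‖f‖₂² ‖∇f‖₂^{2k}`. -/
theorem integral_pow_le (k : ℕ) : ∃ C : ℝ, 0 < C ∧ ∀ f : Plane → ℝ, ContDiff ℝ 1 f →
    Integrable (fun x => f x ^ 2) → Integrable (fun x => ‖fderiv ℝ f x‖ ^ 2) →
    Integrable (fun x => f x ^ (2 * k + 2)) ∧
    ∫ x, f x ^ (2 * k + 2) ≤ C * (∫ x, f x ^ 2) * (∫ x, ‖fderiv ℝ f x‖ ^ 2) ^ k := by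
  obtain ⟨C, hC, hk⟩ := integral_pow_le_of_hasCompactSupport k
  obtain ⟨M, hM, χ, hχ⟩ := exists_cutoff
  -- The factor 2^k comes from |∇(χf)|² ≤ 2|∇f|² + 2|∇χ|²f², raised to the power k. The second term
  -- is of order (n+1)⁻² and disappears in the limit.
  refine ⟨C * 2 ^ k, by positivity, fun f hf hf2 hd2 => ?_⟩
  have hA : 0 ≤ ∫ x, f x ^ 2 := integral_nonneg fun x => sq_nonneg _
  have hcont : Continuous fun x => f x ^ (2 * k + 2) := hf.continuous.pow _
  have hevn : Even (2 * k + 2) := ⟨k + 1, by ring⟩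
  have hcs : ∀ n, HasCompactSupport fun x => χ n x * f x := fun n => (hχ n).2.1.mul_right
  have hcd : ∀ n, ContDiff ℝ 1 fun x => χ n x * f x := fun n => (hχ n).1.mul hf
  refine integrable_of_exhaustion (g := fun n x => (χ n x * f x) ^ (2 * k + 2))
    (b := fun n => C * (∫ x, f x ^ 2) *
      (2 * (∫ x, ‖fderiv ℝ f x‖ ^ 2) + 2 * (M / ((n : ℝ) + 1)) ^ 2 * ∫ x, f x ^ 2) ^ k)
    (fun n => integrable_pow_of_hasCompactSupport (hcd n).continuous (hcs n) (by simp))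
    hcont.aestronglyMeasurable (fun n x => hevn.pow_nonneg _)
    (fun x => hevn.pow_nonneg _) (fun x => ?_) (fun n => (hk _ (hcd n) (hcs n)).trans ?_) ?_
  · obtain ⟨N, hN⟩ := exists_nat_ge ‖x‖
    filter_upwards [eventually_ge_atTop N] with n hn
    have : (N : ℝ) ≤ n := by exact_mod_cast hn
    rw [(hχ n).2.2.2.2.1 x (by linarith), one_mul]
  · have hI1 : ∫ x, (χ n x * f x) ^ 2 ≤ ∫ x, f x ^ 2 := by
      refine integral_mono (integrable_pow_of_hasCompactSupport (hcd n).continuous (hcs n)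
        two_ne_zero) hf2 fun x => ?_
      have h0 := (hχ n).2.2.1 x
      have h1 := (hχ n).2.2.2.1 x
      change (χ n x * f x) ^ 2 ≤ f x ^ 2
      rw [mul_pow]
      exact mul_le_of_le_one_left (sq_nonneg _) (pow_le_one₀ h0 h1)
    have hI2 : ∫ x, ‖fderiv ℝ (fun x => χ n x * f x) x‖ ^ 2 ≤
        2 * (∫ x, ‖fderiv ℝ f x‖ ^ 2) + 2 * (M / ((n : ℝ) + 1)) ^ 2 * ∫ x, f x ^ 2 := by
      have i1 : Integrable fun x => 2 * ‖fderiv ℝ f x‖ ^ 2 := hd2.const_mul _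
      have i2 : Integrable fun x => 2 * (M / ((n : ℝ) + 1)) ^ 2 * f x ^ 2 := hf2.const_mul _
      rw [← integral_const_mul, ← integral_const_mul, ← integral_add i1 i2]
      refine integral_mono (integrable_fderiv_sq_of_hasCompactSupport (hcd n) (hcs n))
        (i1.add i2) fun x => ?_
      have e : fderiv ℝ (fun x => χ n x * f x) x
          = χ n x • fderiv ℝ f x + f x • fderiv ℝ (χ n) x :=
        fderiv_fun_mul ((hχ n).1.differentiable one_ne_zero x) (hf.differentiable one_ne_zero x)
      have h0 := (hχ n).2.2.1 x
      have h1 := (hχ n).2.2.2.1 x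
      have h2 := (hχ n).2.2.2.2.2.2.1 x
      have h3 : ‖χ n x • fderiv ℝ f x + f x • fderiv ℝ (χ n) x‖
          ≤ ‖fderiv ℝ f x‖ + |f x| * (M / (n + 1)) := by
        refine (norm_add_le _ _).trans ?_
        rw [norm_smul, norm_smul, Real.norm_of_nonneg h0, Real.norm_eq_abs]
        exact add_le_add (mul_le_of_le_one_left (norm_nonneg _) h1)
          (mul_le_mul_of_nonneg_left h2 (abs_nonneg _))
      change ‖fderiv ℝ (fun x => χ n x * f x) x‖ ^ 2
        ≤ 2 * ‖fderiv ℝ f x‖ ^ 2 + 2 * (M / ((n : ℝ) + 1)) ^ 2 * f x ^ 2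
      rw [e]
      calc _ ≤ (‖fderiv ℝ f x‖ + |f x| * (M / (n + 1))) ^ 2 :=
            pow_le_pow_left₀ (norm_nonneg _) h3 2
        _ ≤ 2 * ‖fderiv ℝ f x‖ ^ 2 + 2 * (|f x| * (M / (n + 1))) ^ 2 := by
            nlinarith [sq_nonneg (‖fderiv ℝ f x‖ - |f x| * (M / (n + 1)))]
        _ = _ := by rw [mul_pow, sq_abs]; ring
    have hI3 : 0 ≤ ∫ x, ‖fderiv ℝ (fun x => χ n x * f x) x‖ ^ 2 :=
      integral_nonneg fun x => sq_nonneg _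
    exact mul_le_mul (mul_le_mul_of_nonneg_left hI1 hC.le) (pow_le_pow_left₀ hI3 hI2 k)
      (pow_nonneg hI3 k) (mul_nonneg hC.le hA)
  · have h1 : Tendsto (fun n : ℕ => M / ((n : ℝ) + 1)) atTop (𝓝 0) :=
      tendsto_const_div_succ M
    have h2 := ((((h1.pow 2).const_mul 2).mul_const (∫ x, f x ^ 2)).const_add
      (2 * (∫ x, ‖fderiv ℝ f x‖ ^ 2))).pow k |>.const_mul (C * (∫ x, f x ^ 2))
    convert h2 using 2
    simp only [ne_eq, OfNat.ofNat_ne_zero, not_false_eq_true, zero_pow, mul_zero, zero_mul,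
      add_zero, mul_pow]
    ring

/-! ### Convexity and growth of the potential energy -/

/-- Quantitative Bernoulli inequality. -/
theorem exists_sq_le_bernoulli_gap {γ : ℝ} (hγ : 1 < γ) : ∃ c : ℝ, 0 < c ∧ ∀ t : ℝ, -1 ≤ t →
    0 ≤ (1 + t) ^ γ - 1 - γ * t ∧ c * t ^ 2 ≤ ((1 + t) ^ γ - 1 - γ * t) * (1 + |t|) := by
  have hgap : ∀ t : ℝ, -1 ≤ t → 0 ≤ (1 + t) ^ γ - 1 - γ * t := fun t ht => by
    have := one_add_mul_self_le_rpow_one_add ht hγ.le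
    linarith
  rcases le_total γ 2 with h2 | h2
  · refine ⟨(γ - 1) ^ 2, by have : 0 < γ - 1 := by linarith
                            positivity, fun t ht => ⟨hgap t ht, ?_⟩⟩
    have hB : (1 + t) ^ (2 - γ) ≤ 1 + (2 - γ) * t :=
      rpow_one_add_le_one_add_mul_self ht (by linarith) (by linarith)
    have hA : 0 ≤ (1 + t) ^ γ := Real.rpow_nonneg (by linarith) _
    have hAB : (1 + t) ^ γ * (1 + t) ^ (2 - γ) = (1 + t) ^ 2 := by
      rw [← Real.rpow_add_of_nonneg (by linarith) (by linarith) (by linarith)]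
      rw [add_sub_cancel, Real.rpow_two]
    have h1 : (1 + t) ^ 2 ≤ (1 + t) ^ γ * (1 + (2 - γ) * t) :=
      hAB ▸ mul_le_mul_of_nonneg_left hB hA
    have h3 : (2 - γ) * t ≤ |t| := by
      rcases abs_cases t with ⟨h, h'⟩ | ⟨h, h'⟩ <;> rw [h] <;> nlinarith
    have h4 := mul_le_mul_of_nonneg_left h3 (hgap t ht)
    nlinarith
  · refine ⟨1, one_pos, fun t ht => ⟨hgap t ht, ?_⟩⟩
    -- With w = (1+t)^{γ/2}, this gives 1 + γt ≤ 2w - 1, so the gap w² - 1 - γt is at least (w-1)².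
    -- Since γ/2 ≥ 1, w is at least as far from 1 as 1+t is.
    have hu : 1 + γ / 2 * t ≤ (1 + t) ^ (γ / 2) :=
      one_add_mul_self_le_rpow_one_add ht (by linarith)
    have hsq : ((1 + t) ^ (γ / 2)) ^ 2 = (1 + t) ^ γ := by
      rw [← Real.rpow_natCast, ← Real.rpow_mul (by linarith)]
      congr 1; push_cast; ring
    have h1 : ((1 + t) ^ (γ / 2) - 1) ^ 2 ≤ (1 + t) ^ γ - 1 - γ * t := by
      rw [← hsq]; nlinarith
    have h3 : t ^ 2 ≤ ((1 + t) ^ (γ / 2) - 1) ^ 2 := by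
      rcases le_total 0 t with h | h
      · have : t ≤ γ / 2 * t := le_mul_of_one_le_left h (by linarith)
        exact pow_le_pow_left₀ h (by linarith) 2
      · have : (1 + t) ^ (γ / 2) ≤ (1 + t) ^ (1 : ℝ) :=
          Real.rpow_le_rpow_of_exponent_ge' (by linarith) (by linarith) zero_le_one (by linarith)
        rw [Real.rpow_one] at this
        nlinarith
    have := abs_nonneg t
    nlinarith [hgap t ht]

section Potential

variable {γ ρbar : ℝ}

theorem potentialEnergy_eq (hρ : 0 < ρbar) {r : ℝ} (hr : 0 ≤ r) :
    potentialEnergy γ ρbar r = ρbar ^ γ / (γ - 1) *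
      ((1 + (r / ρbar - 1)) ^ γ - 1 - γ * (r / ρbar - 1)) := by
  have h1 : ρbar ^ (γ - 1) = ρbar ^ γ / ρbar := by rw [Real.rpow_sub_one hρ.ne']
  have h2 : (1 + (r / ρbar - 1)) ^ γ = r ^ γ / ρbar ^ γ := by
    rw [add_sub_cancel, Real.div_rpow hr hρ.le]
  have h3 : 0 < ρbar ^ γ := Real.rpow_pos_of_pos hρ _
  rw [potentialEnergy, h1, h2]
  field_simp

theorem potentialEnergy_nonneg (hγ : 1 < γ) (hρ : 0 < ρbar) {r : ℝ} (hr : 0 ≤ r) :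
    0 ≤ potentialEnergy γ ρbar r := by
  obtain ⟨c, hc, h⟩ := exists_sq_le_bernoulli_gap hγ
  rw [potentialEnergy_eq hρ hr]
  have h1 : (0 : ℝ) ≤ r / ρbar := by positivity
  have h2 : 0 < γ - 1 := by linarith
  have := (h (r / ρbar - 1) (by linarith)).1
  positivity

theorem continuous_potentialEnergy (hγ : 1 < γ) : Continuous (potentialEnergy γ ρbar) := by
  have : Continuous fun r : ℝ => r ^ γ := Real.continuous_rpow_const (by linarith)
  unfold potentialEnergy
  fun_prop

/-- Ψ is quadratic near ρbar and grows at least linearly far away. The factor 1 + |r - ρbar| covers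
both regimes at once, for every γ > 1; the proof rescales the Bernoulli gap by t = r/ρbar - 1. -/
theorem exists_sq_sub_le (hγ : 1 < γ) (hρ : 0 < ρbar) : ∃ C : ℝ, 0 < C ∧ ∀ r : ℝ, 0 ≤ r →
    (r - ρbar) ^ 2 ≤ C * potentialEnergy γ ρbar r * (1 + |r - ρbar|) := by
  obtain ⟨c, hc, h⟩ := exists_sq_le_bernoulli_gap hγ
  have h3 : 0 < ρbar ^ γ := Real.rpow_pos_of_pos hρ _
  have h2 : 0 < γ - 1 := by linarith
  refine ⟨(γ - 1) / ρbar ^ γ * ρbar ^ 2 / c * (1 + 1 / ρbar), by positivity, fun r hr => ?_⟩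
  have h1 : (0 : ℝ) ≤ r / ρbar := by positivity
  obtain ⟨h5, h4⟩ := h (r / ρbar - 1) (by linarith)
  rw [potentialEnergy_eq hρ hr]
  set ψ := (1 + (r / ρbar - 1)) ^ γ - 1 - γ * (r / ρbar - 1)
  have e : r / ρbar - 1 = (r - ρbar) / ρbar := by field_simp
  rw [e, abs_div, abs_of_pos hρ] at h4
  have h6 : 1 + |r - ρbar| / ρbar ≤ (1 + 1 / ρbar) * (1 + |r - ρbar|) := by
    have : 0 ≤ 1 / ρbar := by positivity
    have := abs_nonneg (r - ρbar)
    rw [div_eq_mul_one_div |r - ρbar|]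
    nlinarith
  have h7 := h4.trans (mul_le_mul_of_nonneg_left h6 h5)
  calc (r - ρbar) ^ 2 = ρbar ^ 2 / c * (c * ((r - ρbar) / ρbar) ^ 2) := by field_simp
    _ ≤ ρbar ^ 2 / c * (ψ * ((1 + 1 / ρbar) * (1 + |r - ρbar|))) := by gcongr
    _ = _ := by field_simp

/-- Either the density is at least ρbar/2, or it is so far from ρbar that Ψ exceeds a fixed positive
number. This is how the kinetic energy controls |u|² even where there is vacuum. -/
theorem exists_one_le_add_sqrt (hγ : 1 < γ) (hρ : 0 < ρbar) : ∃ a b : ℝ, 0 < a ∧ 0 < b ∧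
    ∀ r : ℝ, 0 ≤ r → 1 ≤ a * r + b * √(potentialEnergy γ ρbar r) := by
  obtain ⟨C, hC, h⟩ := exists_sq_sub_le hγ hρ
  set d := (ρbar / 2) ^ 2 / (C * (1 + ρbar)) with hd
  have hd0 : 0 < d := by positivity
  refine ⟨2 / ρbar, 1 / √d, by positivity, by positivity, fun r hr => ?_⟩
  rcases le_total (ρbar / 2) r with h1 | h1
  · have : 1 ≤ 2 / ρbar * r := by
      rw [div_mul_eq_mul_div, le_div_iff₀ hρ]; linarith
    have : 0 ≤ 1 / √d * √(potentialEnergy γ ρbar r) := by positivity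
    linarith
  · have h2 := h r hr
    have h3 := potentialEnergy_nonneg hγ hρ hr
    have h4 : |r - ρbar| ≤ ρbar := by rw [abs_le]; constructor <;> linarith
    have h5 : d ≤ potentialEnergy γ ρbar r := by
      rw [hd, div_le_iff₀ (by positivity)]
      have : C * potentialEnergy γ ρbar r * (1 + |r - ρbar|)
        ≤ C * potentialEnergy γ ρbar r * (1 + ρbar) := by gcongr
      nlinarith
    have h6 : 1 ≤ 1 / √d * √(potentialEnergy γ ρbar r) := by
      rw [div_mul_eq_mul_div, le_div_iff₀ (by positivity), one_mul, one_mul]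
      exact Real.sqrt_le_sqrt h5
    have : 0 ≤ 2 / ρbar * r := by positivity
    linarith

/-- By definition of Ψ the pressure difference is (γ-1)Ψ plus a multiple of r - ρbar. The linear
part satisfies (r-ρbar)² ≲ Ψ + Ψ², seen by separating |r-ρbar| ≤ 1 from |r-ρbar| ≥ 1. The factor Ψ
on the right is what lets the pressure error be split against η²Ψ. -/
theorem exists_pressure_sub_sq_le (hγ : 1 < γ) (hρ : 0 < ρbar) : ∃ C : ℝ, 0 < C ∧ ∀ r : ℝ, 0 ≤ r →
    (r ^ γ - ρbar ^ γ) ^ 2 ≤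
      C * (potentialEnergy γ ρbar r * (1 + potentialEnergy γ ρbar r)) := by
  obtain ⟨C, hC, h⟩ := exists_sq_sub_le hγ hρ
  set k := γ * ρbar ^ (γ - 1) with hk
  have hk0 : 0 < k := mul_pos (by linarith) (Real.rpow_pos_of_pos hρ _)
  refine ⟨2 * (γ - 1) ^ 2 + 2 * k ^ 2 * (2 * C + 4 * C ^ 2), by positivity, fun r hr => ?_⟩
  have h1 := h r hr
  have h3 := potentialEnergy_nonneg hγ hρ hr
  have e : r ^ γ - ρbar ^ γ = (γ - 1) * potentialEnergy γ ρbar r + k * (r - ρbar) := by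
    have : γ - 1 ≠ 0 := by linarith
    rw [potentialEnergy, hk]; field_simp; ring
  set Ψ := potentialEnergy γ ρbar r
  have h4 : (r - ρbar) ^ 2 ≤ 2 * C * Ψ + 4 * C ^ 2 * Ψ ^ 2 := by
    rcases le_total |r - ρbar| 1 with h5 | h5
    · have : C * Ψ * (1 + |r - ρbar|) ≤ C * Ψ * 2 := by
        have := mul_nonneg hC.le h3
        nlinarith
      nlinarith [sq_nonneg (C * Ψ)]
    · have h6 : |r - ρbar| ≤ 2 * C * Ψ := by
        have h7 : |r - ρbar| * |r - ρbar| ≤ 2 * C * Ψ * |r - ρbar| := by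
          rw [← sq, sq_abs]
          have := mul_nonneg hC.le h3
          nlinarith
        exact le_of_mul_le_mul_right h7 (by linarith)
      have h8 : (r - ρbar) ^ 2 ≤ (2 * C * Ψ) ^ 2 := by
        rw [← sq_abs]; exact pow_le_pow_left₀ (abs_nonneg _) h6 2
      nlinarith [mul_nonneg hC.le h3]
  rw [e]
  have h9 : ((γ - 1) * Ψ + k * (r - ρbar)) ^ 2
      ≤ 2 * (γ - 1) ^ 2 * Ψ ^ 2 + 2 * k ^ 2 * (r - ρbar) ^ 2 := by
    nlinarith [sq_nonneg ((γ - 1) * Ψ - k * (r - ρbar))]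
  have h10 : 2 * k ^ 2 * (r - ρbar) ^ 2 ≤ 2 * k ^ 2 * (2 * C * Ψ + 4 * C ^ 2 * Ψ ^ 2) := by gcongr
  have h11 : 0 ≤ (γ - 1) ^ 2 * Ψ := by positivity
  have h12 : 0 ≤ k ^ 2 * C * Ψ ^ 2 := by positivity
  have h13 : 0 ≤ k ^ 2 * C ^ 2 * Ψ := by positivity
  nlinarith

theorem exists_rpow_le_one_add {a b : ℝ} (ha : 0 < a) (hb : 0 ≤ b) : ∃ C : ℝ, 0 < C ∧
    ∀ r : ℝ, 0 ≤ r → r ^ a ≤ C * (1 + |r - b| ^ a) := by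
  refine ⟨(2 * b) ^ a + 2 ^ a, by positivity, fun r hr => ?_⟩
  have h1 : r ≤ b + |r - b| := by linarith [le_abs_self (r - b)]
  have h0 : 0 ≤ |r - b| ^ a := by positivity
  have h2 : 0 ≤ (2 * b) ^ a := by positivity
  have h3 : 0 ≤ (2 : ℝ) ^ a := by positivity
  rcases le_total |r - b| b with h | h
  · have : r ^ a ≤ (2 * b) ^ a := Real.rpow_le_rpow hr (by linarith) ha.le
    nlinarith [mul_nonneg h2 h0, mul_nonneg h3 h0]
  · have : r ^ a ≤ (2 * |r - b|) ^ a := Real.rpow_le_rpow hr (by linarith) ha.le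
    rw [Real.mul_rpow zero_le_two (abs_nonneg _)] at this
    nlinarith [mul_nonneg h2 h0, mul_nonneg h3 h0]

theorem exists_potentialEnergy_le (hγ : 1 < γ) (hρ : 0 < ρbar) : ∃ C : ℝ, 0 < C ∧
    ∀ r : ℝ, 0 ≤ r → potentialEnergy γ ρbar r ≤ C * (1 + |r - ρbar| ^ γ) := by
  obtain ⟨C, hC, h⟩ := exists_rpow_le_one_add (a := γ) (by linarith) hρ.le
  have h2 : 0 < γ - 1 := by linarith
  have h3 : 0 < ρbar ^ γ := Real.rpow_pos_of_pos hρ _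
  refine ⟨1 / (γ - 1) * (C + γ * ρbar ^ γ), by positivity, fun r hr => ?_⟩
  have h1 : ρbar ^ (γ - 1) * ρbar = ρbar ^ γ := by
    rw [Real.rpow_sub_one hρ.ne']; field_simp
  have h4 : 0 ≤ ρbar ^ (γ - 1) * r := by positivity
  have h0 : 0 ≤ |r - ρbar| ^ γ := by positivity
  have key : r ^ γ - ρbar ^ γ - γ * ρbar ^ (γ - 1) * (r - ρbar)
      ≤ (C + γ * ρbar ^ γ) * (1 + |r - ρbar| ^ γ) := by
    nlinarith [h r hr, mul_nonneg (mul_nonneg (by linarith : 0 ≤ γ) h3.le) h0,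
      mul_nonneg (by linarith : 0 ≤ γ) h4]
  rw [potentialEnergy, mul_assoc (1 / (γ - 1))]
  exact mul_le_mul_of_nonneg_left key (by positivity)

end Potential

/-! ### Hölder's inequality with constants uniform in the exponent -/

/-- A form of Hölder's inequality in which the exponent of the second factor does not depend
on `p`. -/
theorem integral_rpow_mul_le {X : Type*} [MeasurableSpace X] {ν : Measure X} {f g : X → ℝ}
    {p s : ℝ} (hs : 0 < s) (hsp : 2 * s ≤ p) (hf : AEStronglyMeasurable f ν)
    (hfp : Integrable (fun x => |f x| ^ p) ν) (hg0 : ∀ x, 0 ≤ g x) (hg : Integrable g ν)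
    (hg2 : Integrable (fun x => g x ^ 2) ν) :
    Integrable (fun x => |f x| ^ s * g x) ν ∧
      ∫ x, |f x| ^ s * g x ∂ν ≤
        ((∫ x, |f x| ^ p ∂ν) ^ (1 / p)) ^ s * ((∫ x, g x ∂ν) + √(∫ x, g x ^ 2 ∂ν)) := by
  have hp : 0 < p := by linarith
  have hmeas : ∀ q : ℝ, 0 ≤ q → AEStronglyMeasurable (fun x => |f x| ^ q) ν := fun q hq =>
    (Real.continuous_rpow_const hq).comp_aestronglyMeasurable hf.norm
  have hsq : ∀ y : ℝ, 0 ≤ y → (y ^ (p / 2)) ^ 2 = y ^ p := fun y hy => by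
    rw [← Real.rpow_natCast, ← Real.rpow_mul hy]; congr 1; push_cast; ring
  -- The interpolation that frees the constants from p: y^s lies below 1 when y ≤ 1 and below
  -- y^{p/2} when y ≥ 1. The power p/2 can be paired with g by plain Cauchy-Schwarz.
  have hle : ∀ y : ℝ, 0 ≤ y → y ^ s ≤ 1 + y ^ (p / 2) := fun y hy => by
    have h0 : 0 ≤ y ^ (p / 2) := by positivity
    rcases le_total y 1 with h | h
    · linarith [Real.rpow_le_one hy h hs.le]
    · linarith [Real.rpow_le_rpow_of_exponent_le h (by linarith : s ≤ p / 2)]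
  have hcs := integral_mul_sq_le (hmeas (p / 2) (by linarith)) hg.aestronglyMeasurable
    (by simpa only [hsq _ (abs_nonneg _)] using hfp) hg2
  have hint : Integrable (fun x => |f x| ^ s * g x) ν := by
    refine (hg.add hcs.1).mono' ((hmeas s hs.le).mul hg.aestronglyMeasurable)
      (Eventually.of_forall fun x => ?_)
    rw [Real.norm_of_nonneg (mul_nonneg (by positivity) (hg0 x))]
    change _ ≤ g x + |f x| ^ (p / 2) * g x
    nlinarith [hle _ (abs_nonneg (f x)), hg0 x]
  refine ⟨hint, ?_⟩
  have hI0 : 0 ≤ ∫ x, |f x| ^ p ∂ν := integral_nonneg fun x => by positivity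
  have hgI : 0 ≤ ∫ x, g x ∂ν := integral_nonneg hg0
  rcases hI0.eq_or_lt with hz | hpos
  · have hae := (integral_eq_zero_iff_of_nonneg (fun x => by positivity) hfp).1 hz.symm
    have : ∫ x, |f x| ^ s * g x ∂ν = 0 := by
      rw [← integral_zero X ℝ (μ := ν)]
      refine integral_congr_ae ?_
      filter_upwards [hae] with x hx
      have : |f x| = 0 := (Real.rpow_eq_zero (abs_nonneg _) hp.ne').1 hx
      rw [this, Real.zero_rpow hs.ne', zero_mul]
    rw [this]
    positivity
  · set N := (∫ x, |f x| ^ p ∂ν) ^ (1 / p) with hN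
    have hN0 : 0 < N := by positivity
    have hNp : N ^ p = ∫ x, |f x| ^ p ∂ν := by
      rw [hN, ← Real.rpow_mul hI0, one_div_mul_cancel hp.ne', Real.rpow_one]
    have hNh : (N ^ (p / 2)) ^ 2 = ∫ x, |f x| ^ p ∂ν := by rw [hsq _ hN0.le, hNp]
    have hNh0 : 0 < N ^ (p / 2) := by positivity
    have h1 : ∫ x, |f x| ^ (p / 2) * g x ∂ν ≤ N ^ (p / 2) * √(∫ x, g x ^ 2 ∂ν) := by
      refine le_of_sq_le_sq (a := ∫ x, |f x| ^ (p / 2) * g x ∂ν) ?_ (by positivity)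
      rw [mul_pow, Real.sq_sqrt (integral_nonneg fun x => sq_nonneg _), hNh]
      simpa only [hsq _ (abs_nonneg _)] using hcs.2
    -- Applying the interpolation to |f|/N, with N the L^p norm of f, restores homogeneity: the
    -- result scales as N^s, and the L² norm of (|f|/N)^{p/2} is 1.
    have h2 : ∫ x, |f x| ^ s * g x ∂ν ≤
        ∫ x, N ^ s * (g x + (N ^ (p / 2))⁻¹ * (|f x| ^ (p / 2) * g x)) ∂ν := by
      refine integral_mono hint ((hg.add (hcs.1.const_mul _)).const_mul _) fun x => ?_
      have h3 := hle (|f x| / N) (by positivity)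
      rw [Real.div_rpow (abs_nonneg _) hN0.le, Real.div_rpow (abs_nonneg _) hN0.le,
        div_le_iff₀ (by positivity)] at h3
      change |f x| ^ s * g x ≤ N ^ s * (g x + (N ^ (p / 2))⁻¹ * (|f x| ^ (p / 2) * g x))
      calc |f x| ^ s * g x ≤ (1 + |f x| ^ (p / 2) / N ^ (p / 2)) * N ^ s * g x :=
            mul_le_mul_of_nonneg_right h3 (hg0 x)
        _ = _ := by rw [div_eq_inv_mul]; ring
    refine h2.trans ?_
    have i2 : Integrable (fun x => (N ^ (p / 2))⁻¹ * (|f x| ^ (p / 2) * g x)) ν :=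
      hcs.1.const_mul _
    rw [integral_const_mul, integral_add hg i2, integral_const_mul]
    gcongr
    rwa [inv_mul_le_iff₀ hNh0]

/-! ### Sobolev inequalities for vector fields -/

section Components

theorem norm_sq_eq (v : Plane) : ‖v‖ ^ 2 = v 0 ^ 2 + v 1 ^ 2 := by
  rw [EuclideanSpace.norm_sq_eq]; simp [Fin.sum_univ_two]

theorem clm_apply_eq (l : Plane →L[ℝ] ℝ) (v : Plane) :
    l v = v 0 * l (EuclideanSpace.single 0 1) + v 1 * l (EuclideanSpace.single 1 1) := by
  have : v = v 0 • EuclideanSpace.single 0 1 + v 1 • EuclideanSpace.single 1 1 := by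
    ext i; fin_cases i <;> simp
  conv_lhs => rw [this]
  simp

/-- The scalar Sobolev inequalities involve the operator norm of the differential, the dissipation
involves squares of partial derivatives. For a functional on the Euclidean plane the two agree
exactly, by testing with the vector that represents it. -/
theorem norm_sq_clm_eq (l : Plane →L[ℝ] ℝ) :
    ‖l‖ ^ 2 = l (EuclideanSpace.single 0 1) ^ 2 + l (EuclideanSpace.single 1 1) ^ 2 := by
  set a := l (EuclideanSpace.single 0 1) with ha
  set b := l (EuclideanSpace.single 1 1) with hb
  refine le_antisymm ?_ ?_
  · have : ‖l‖ ≤ √(a ^ 2 + b ^ 2) := by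
      refine l.opNorm_le_bound (Real.sqrt_nonneg _) fun v => ?_
      refine le_of_sq_le_sq ?_ (by positivity)
      rw [mul_pow, Real.sq_sqrt (by positivity), norm_sq_eq, Real.norm_eq_abs, sq_abs,
        clm_apply_eq, ← ha, ← hb]
      nlinarith [sq_nonneg (v 0 * b - v 1 * a)]
    calc ‖l‖ ^ 2 ≤ √(a ^ 2 + b ^ 2) ^ 2 := by gcongr
      _ = _ := Real.sq_sqrt (by positivity)
  · set w : Plane := !₂[a, b]
    have h0 : w 0 = a := rfl
    have h1 : w 1 = b := rfl
    have hw : ‖w‖ ^ 2 = a ^ 2 + b ^ 2 := by rw [norm_sq_eq, h0, h1]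
    have h2 : l w = a ^ 2 + b ^ 2 := by rw [clm_apply_eq, h0, h1, ← ha, ← hb]; ring
    have h3 := l.le_opNorm w
    rw [h2, Real.norm_of_nonneg (by positivity), ← hw] at h3
    rw [← hw]
    rcases (norm_nonneg w).eq_or_lt with h | h
    · rw [← h, zero_pow two_ne_zero]; positivity
    · have : ‖w‖ ≤ ‖l‖ := by nlinarith
      gcongr

theorem differentiable_apply {V : Plane → Plane} (hV : ContDiff ℝ 1 V) (i : Fin 2) :
    ContDiff ℝ 1 fun x => V x i :=
  contDiff_piLp_apply (p := 2) |>.comp hV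

theorem pderiv_apply {V : Plane → Plane} {x : Plane} (hV : DifferentiableAt ℝ V x) (i j : Fin 2) :
    pderiv j V x i = pderiv j (fun y => V y i) x := by
  have h := ((EuclideanSpace.proj i : Plane →L[ℝ] ℝ).hasFDerivAt.comp x hV.hasFDerivAt).fderiv
  unfold pderiv
  change _ = fderiv ℝ ((EuclideanSpace.proj i : Plane →L[ℝ] ℝ) ∘ V) x _
  rw [h]; rfl

theorem gradSq_eq {V : Plane → Plane} {x : Plane} (hV : DifferentiableAt ℝ V x) :
    gradSq V x = ‖fderiv ℝ (fun y => V y 0) x‖ ^ 2 + ‖fderiv ℝ (fun y => V y 1) x‖ ^ 2 := by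
  rw [norm_sq_clm_eq, norm_sq_clm_eq, gradSq]
  simp only [Fin.sum_univ_two, pderiv_apply hV]
  rfl

theorem gradSq_nonneg (V : Plane → Plane) (x : Plane) : 0 ≤ gradSq V x :=
  Finset.sum_nonneg fun _ _ => Finset.sum_nonneg fun _ _ => sq_nonneg _

theorem continuous_pderiv {F : Type*} [NormedAddCommGroup F] [NormedSpace ℝ F] {V : Plane → F}
    (hV : ContDiff ℝ 1 V) (j : Fin 2) : Continuous (pderiv j V) :=
  (hV.continuous_fderiv one_ne_zero).clm_apply continuous_const

theorem continuous_apply {V : Plane → Plane} (hV : Continuous V) (i : Fin 2) :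
    Continuous fun x => V x i :=
  (EuclideanSpace.proj i : Plane →L[ℝ] ℝ).continuous.comp hV

theorem continuous_gradSq {V : Plane → Plane} (hV : ContDiff ℝ 1 V) : Continuous (gradSq V) :=
  continuous_finsetSum _ fun i _ => continuous_finsetSum _ fun j _ =>
    (continuous_apply (continuous_pderiv hV j) i).pow 2

theorem continuous_divergence {V : Plane → Plane} (hV : ContDiff ℝ 1 V) :
    Continuous (divergence V) :=
  continuous_finsetSum _ fun i _ => continuous_apply (continuous_pderiv hV i) i

/-- Sobolev inequalities for vector fields. -/
theorem integral_norm_pow_le (k : ℕ) : ∃ C : ℝ, 0 < C ∧ ∀ V : Plane → Plane, ContDiff ℝ 1 V →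
    Integrable (fun x => ‖V x‖ ^ 2) → Integrable (gradSq V) →
    Integrable (fun x => ‖V x‖ ^ (2 * k + 2)) ∧
    ∫ x, ‖V x‖ ^ (2 * k + 2) ≤ C * (∫ x, ‖V x‖ ^ 2) * (∫ x, gradSq V x) ^ k := by
  obtain ⟨C, hC, h⟩ := integral_pow_le k
  -- From (a+b)^{k+1} ≤ 2^k (a^{k+1} + b^{k+1}) with a and b the squared components, each of which
  -- contributes one C.
  refine ⟨2 ^ k * (C + C), by positivity, fun V hV hV2 hG => ?_⟩
  have hd := hV.differentiable one_ne_zero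
  have hi : ∀ i x, V x i ^ 2 ≤ ‖V x‖ ^ 2 := fun i x => by
    rw [norm_sq_eq]; fin_cases i
    · exact le_add_of_nonneg_right (sq_nonneg _)
    · exact le_add_of_nonneg_left (sq_nonneg _)
  have hg : ∀ i x, ‖fderiv ℝ (fun y => V y i) x‖ ^ 2 ≤ gradSq V x := fun i x => by
    rw [gradSq_eq (hd x)]; fin_cases i
    · exact le_add_of_nonneg_right (sq_nonneg _)
    · exact le_add_of_nonneg_left (sq_nonneg _)
  have hc : ∀ i, ContDiff ℝ 1 fun x => V x i := differentiable_apply hV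
  have int1 : ∀ i, Integrable fun x => V x i ^ 2 := fun i =>
    hV2.mono' ((hc i).continuous.pow 2).aestronglyMeasurable (Eventually.of_forall fun x => by
      rw [Real.norm_of_nonneg (sq_nonneg _)]; exact hi i x)
  have int2 : ∀ i, Integrable fun x => ‖fderiv ℝ (fun y => V y i) x‖ ^ 2 := fun i =>
    hG.mono' (((hc i).continuous_fderiv one_ne_zero).norm.pow 2).aestronglyMeasurable
      (Eventually.of_forall fun x => by rw [Real.norm_of_nonneg (sq_nonneg _)]; exact hg i x)
  have hk : ∀ i, ∫ x, V x i ^ (2 * k + 2) ≤ C * (∫ x, ‖V x‖ ^ 2) * (∫ x, gradSq V x) ^ k := by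
    intro i
    refine (h _ (hc i) (int1 i) (int2 i)).2.trans ?_
    have h1 := integral_mono (int1 i) hV2 (hi i)
    have h2 := integral_mono (int2 i) hG (hg i)
    have h3 : 0 ≤ ∫ x, ‖V x‖ ^ 2 := integral_nonneg fun x => sq_nonneg _
    have h4 : 0 ≤ ∫ x, ‖fderiv ℝ (fun y => V y i) x‖ ^ 2 := integral_nonneg fun x => sq_nonneg _
    exact mul_le_mul (mul_le_mul_of_nonneg_left h1 hC.le) (pow_le_pow_left₀ h4 h2 k)
      (pow_nonneg h4 k) (mul_nonneg hC.le h3)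
  have hint := fun i => (h _ (hc i) (int1 i) (int2 i)).1
  have hsum : Integrable fun x => 2 ^ k * (V x 0 ^ (2 * k + 2) + V x 1 ^ (2 * k + 2)) :=
    ((hint 0).add (hint 1)).const_mul _
  have hpt : ∀ x, ‖V x‖ ^ (2 * k + 2) ≤ 2 ^ k * (V x 0 ^ (2 * k + 2) + V x 1 ^ (2 * k + 2)) := by
    intro x
    have e : ∀ y : ℝ, y ^ (2 * k + 2) = (y ^ 2) ^ (k + 1) := fun y => by rw [← pow_mul]; ring
    rw [e, e, e, norm_sq_eq]
    simpa using add_pow_le (sq_nonneg (V x 0)) (sq_nonneg (V x 1)) (k + 1)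
  have hI : Integrable fun x => ‖V x‖ ^ (2 * k + 2) := by
    have hcont : Continuous fun x => ‖V x‖ ^ (2 * k + 2) := hV.continuous.norm.pow _
    exact hsum.mono' hcont.aestronglyMeasurable (Eventually.of_forall fun x => by
      rw [Real.norm_of_nonneg (by positivity)]; exact hpt x)
  refine ⟨hI, (integral_mono hI hsum hpt).trans ?_⟩
  rw [integral_const_mul, integral_add (hint 0) (hint 1)]
  calc _ ≤ 2 ^ k * (C * (∫ x, ‖V x‖ ^ 2) * (∫ x, gradSq V x) ^ k
        + C * (∫ x, ‖V x‖ ^ 2) * (∫ x, gradSq V x) ^ k) := by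
        gcongr
        · exact hk 0
        · exact hk 1
    _ = _ := by ring

theorem integral_norm_pow_le_pow (k : ℕ) : ∃ C : ℝ, 0 < C ∧ ∀ V : Plane → Plane,
    ContDiff ℝ 1 V → Integrable (fun x => ‖V x‖ ^ 2) → Integrable (gradSq V) →
    Integrable (fun x => ‖V x‖ ^ (2 * k + 2)) ∧
    ∫ x, ‖V x‖ ^ (2 * k + 2) ≤ C * ((∫ x, ‖V x‖ ^ 2) + ∫ x, gradSq V x) ^ (k + 1) := by
  obtain ⟨C, hC, h⟩ := integral_norm_pow_le k
  refine ⟨C, hC, fun V hV hV2 hG => ⟨(h V hV hV2 hG).1, (h V hV hV2 hG).2.trans ?_⟩⟩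
  have h3 : 0 ≤ ∫ x, ‖V x‖ ^ 2 := integral_nonneg fun x => sq_nonneg _
  have h4 : 0 ≤ ∫ x, gradSq V x := integral_nonneg (gradSq_nonneg V)
  rw [pow_succ', ← mul_assoc]
  gcongr <;> linarith

end Components

/-! ### States at a fixed time -/

/-- A density-velocity pair of finite energy with bounded density and velocity in `H¹`. -/
structure FiniteEnergyState (γ ρbar : ℝ) (r : Plane → ℝ) (U : Plane → Plane) : Prop where
  continuous : Continuous r
  nonneg : ∀ x, 0 ≤ r x
  bounded : ∃ R : ℝ, ∀ x, r x ≤ R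
  contDiff : ContDiff ℝ 1 U
  integrable_sq : Integrable fun x => ‖U x‖ ^ 2
  integrable_gradSq : Integrable (gradSq U)
  integrable_potential : Integrable fun x => potentialEnergy γ ρbar (r x)

/-- The real-valued `L^p` distance of a density to the far-field density. -/
noncomputable def lpDist (ρbar p : ℝ) (r : Plane → ℝ) : ℝ := (∫ x, |r x - ρbar| ^ p) ^ (1 / p)

theorem lpDist_nonneg (ρbar p : ℝ) (r : Plane → ℝ) : 0 ≤ lpDist ρbar p r :=
  Real.rpow_nonneg (integral_nonneg fun x => by positivity) _

namespace FiniteEnergyState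

variable {γ ρbar : ℝ} {r : Plane → ℝ} {U : Plane → Plane}

theorem integrable_density_mul (h : FiniteEnergyState γ ρbar r U) {g : Plane → ℝ}
    (hg : Integrable g) : Integrable fun x => r x * g x := by
  obtain ⟨R, hR⟩ := h.bounded
  exact hg.bdd_mul h.continuous.aestronglyMeasurable (c := R) (Eventually.of_forall fun x => by
    rw [Real.norm_of_nonneg (h.nonneg x)]; exact hR x)

/-- The excess p - 2 of powers is absorbed by the bound on the density. That bound is qualitative:
it gives finiteness of the norm and enters no later constant through this lemma. -/
theorem integrable_rpow (h : FiniteEnergyState γ ρbar r U) (hγ : 1 < γ) (hρ : 0 < ρbar) {p : ℝ}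
    (hp : 2 ≤ p) : Integrable fun x => |r x - ρbar| ^ p := by
  obtain ⟨R, hR⟩ := h.bounded
  obtain ⟨C, hC, hsq⟩ := exists_sq_sub_le hγ hρ
  set F := |R| + ρbar
  have hF : ∀ x, |r x - ρbar| ≤ F := fun x => by
    have := h.nonneg x; have := hR x; have := le_abs_self R; have := abs_nonneg R
    rw [abs_le]; constructor <;> simp only [F] <;> linarith
  have hcont : Continuous fun x => |r x - ρbar| ^ p :=
    (Real.continuous_rpow_const (by linarith)).comp (h.continuous.sub continuous_const).abs
  refine (h.integrable_potential.const_mul (F ^ (p - 2) * (C * (1 + F)))).mono'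
    hcont.aestronglyMeasurable (Eventually.of_forall fun x => ?_)
  rw [Real.norm_of_nonneg (by positivity)]
  have e : |r x - ρbar| ^ p = |r x - ρbar| ^ (p - 2) * (r x - ρbar) ^ 2 := by
    rw [← sq_abs, ← Real.rpow_natCast |r x - ρbar| 2,
      ← Real.rpow_add_of_nonneg (abs_nonneg _) (by linarith) (by norm_num)]
    norm_num
  have hP := potentialEnergy_nonneg hγ hρ (h.nonneg x)
  rw [e]
  calc |r x - ρbar| ^ (p - 2) * (r x - ρbar) ^ 2
      ≤ F ^ (p - 2) * (C * potentialEnergy γ ρbar (r x) * (1 + F)) := by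
        refine mul_le_mul (Real.rpow_le_rpow (abs_nonneg _) (hF x) (by linarith))
          ((hsq _ (h.nonneg x)).trans ?_) (sq_nonneg _)
          (Real.rpow_nonneg ((abs_nonneg _).trans (hF x)) _)
        gcongr
        exact hF x
    _ = _ := by ring

theorem holder (h : FiniteEnergyState γ ρbar r U) (hγ : 1 < γ) (hρ : 0 < ρbar) {p s : ℝ}
    (hp : 2 ≤ p) (hs : 0 < s) (hsp : 2 * s ≤ p) {g : Plane → ℝ} (hg0 : ∀ x, 0 ≤ g x)
    (hg : Integrable g) (hg2 : Integrable fun x => g x ^ 2) :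
    Integrable (fun x => |r x - ρbar| ^ s * g x) ∧
      ∫ x, |r x - ρbar| ^ s * g x ≤
        lpDist ρbar p r ^ s * ((∫ x, g x) + √(∫ x, g x ^ 2)) :=
  integral_rpow_mul_le hs hsp (h.continuous.sub continuous_const).aestronglyMeasurable
    (h.integrable_rpow hγ hρ hp) hg0 hg hg2

/-- A bound on `φ(ρ) g` for a function `φ` of growth `s`. -/
theorem integral_comp_mul_le (h : FiniteEnergyState γ ρbar r U) (hγ : 1 < γ) (hρ : 0 < ρbar)
    {p s : ℝ} (hp : 2 ≤ p) (hs : 0 < s) (hsp : 2 * s ≤ p) {φ : ℝ → ℝ} (hφc : Continuous φ)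
    {C : ℝ} (hC : 0 < C) (hφ0 : ∀ y, 0 ≤ y → 0 ≤ φ y)
    (hφ : ∀ y, 0 ≤ y → φ y ≤ C * (1 + |y - ρbar| ^ s)) {g : Plane → ℝ} (hg0 : ∀ x, 0 ≤ g x)
    (hg : Integrable g) (hg2 : Integrable fun x => g x ^ 2) :
    Integrable (fun x => φ (r x) * g x) ∧
      ∫ x, φ (r x) * g x ≤
        C * (1 + lpDist ρbar p r ^ s) * ((∫ x, g x) + √(∫ x, g x ^ 2)) := by
  obtain ⟨h1, h2⟩ := h.holder hγ hρ hp hs hsp hg0 hg hg2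
  have h3 : Integrable fun x => C * (g x + |r x - ρbar| ^ s * g x) := (hg.add h1).const_mul C
  have hpt : ∀ x, φ (r x) * g x ≤ C * (g x + |r x - ρbar| ^ s * g x) := fun x => by
    have := mul_le_mul_of_nonneg_right (hφ _ (h.nonneg x)) (hg0 x)
    linarith
  have hI : Integrable (fun x => φ (r x) * g x) :=
    h3.mono' ((hφc.comp h.continuous).aestronglyMeasurable.mul hg.aestronglyMeasurable)
      (Eventually.of_forall fun x => by
        rw [Real.norm_of_nonneg (mul_nonneg (hφ0 _ (h.nonneg x)) (hg0 x))]; exact hpt x)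
  refine ⟨hI, (integral_mono hI h3 hpt).trans ?_⟩
  rw [integral_const_mul, integral_add hg h1, mul_assoc]
  gcongr
  have := Real.sqrt_nonneg (∫ x, g x ^ 2)
  linarith

end FiniteEnergyState

/-! ### Moments of the velocity and error integrals at a fixed time -/

/-- Control of the `L²` norm of a velocity field by its kinetic energy and its gradient. -/
theorem exists_integral_norm_sq_le {γ ρbar : ℝ} (hγ : 1 < γ) (hρ : 0 < ρbar) {E : ℝ} (hE : 0 ≤ E) :
    ∃ C : ℝ, 0 < C ∧ ∀ r U, FiniteEnergyState γ ρbar r U →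
      ∫ x, potentialEnergy γ ρbar (r x) ≤ E →
      ∫ x, ‖U x‖ ^ 2 ≤ C * ((∫ x, r x * ‖U x‖ ^ 2) + ∫ x, gradSq U x) := by
  obtain ⟨a, b, ha, hb, hab⟩ := exists_one_le_add_sqrt hγ hρ
  obtain ⟨S, hS, hsob⟩ := integral_norm_pow_le 1
  refine ⟨2 * a + b ^ 2 * E * S, by positivity, fun r U h hpot => ?_⟩
  obtain ⟨i4, h4⟩ := hsob U h.contDiff h.integrable_sq h.integrable_gradSq
  simp only [mul_one, Nat.reduceAdd, pow_one] at i4 h4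
  set A := ∫ x, ‖U x‖ ^ 2 with hA
  have hA0 : 0 ≤ A := integral_nonneg fun x => sq_nonneg _
  set D := ∫ x, gradSq U x
  have hD0 : 0 ≤ D := integral_nonneg (gradSq_nonneg U)
  have iR := h.integrable_density_mul h.integrable_sq
  set B := ∫ x, r x * ‖U x‖ ^ 2
  have hB0 : 0 ≤ B := integral_nonneg fun x => mul_nonneg (h.nonneg x) (sq_nonneg _)
  have hP0 : ∀ x, 0 ≤ potentialEnergy γ ρbar (r x) := fun x =>
    potentialEnergy_nonneg hγ hρ (h.nonneg x)
  have hc : Continuous fun x => √(potentialEnergy γ ρbar (r x)) :=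
    ((continuous_potentialEnergy hγ).comp h.continuous).sqrt
  have hc2 : Continuous fun x => ‖U x‖ ^ 2 := h.contDiff.continuous.norm.pow 2
  obtain ⟨iS, hcs⟩ := integral_mul_sq_le (ν := (volume : Measure Plane))
    (f := fun x => √(potentialEnergy γ ρbar (r x))) (g := fun x => ‖U x‖ ^ 2)
    hc.aestronglyMeasurable hc2.aestronglyMeasurable
    (by simpa only [Real.sq_sqrt (hP0 _)] using h.integrable_potential)
    (by simpa only [← pow_mul] using i4)
  simp only [Real.sq_sqrt (hP0 _), ← pow_mul, Nat.reduceMul] at hcs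
  set Q := ∫ x, √(potentialEnergy γ ρbar (r x)) * ‖U x‖ ^ 2
  -- Integrate 1 ≤ aρ + b√Ψ against |U|². The second part is handled by Cauchy-Schwarz, the bound on
  -- ∫Ψ, and Ladyzhenskaya's inequality for ∫|U|⁴.
  have h1 : A ≤ a * B + b * Q := by
    rw [← integral_const_mul, ← integral_const_mul,
      ← integral_add (iR.const_mul a) (iS.const_mul b)]
    refine integral_mono h.integrable_sq ((iR.const_mul a).add (iS.const_mul b)) fun x => ?_
    have := mul_le_mul_of_nonneg_right (hab (r x) (h.nonneg x)) (sq_nonneg ‖U x‖)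
    change ‖U x‖ ^ 2 ≤ a * (r x * ‖U x‖ ^ 2)
      + b * (√(potentialEnergy γ ρbar (r x)) * ‖U x‖ ^ 2)
    linarith
  have h2 : Q ^ 2 ≤ E * (S * A * D) :=
    hcs.trans (mul_le_mul hpot h4 (integral_nonneg fun x => by positivity) hE)
  -- Half of A = ‖U‖₂² can be absorbed on the left because A is known to be finite for a finite
  -- energy state.
  have h3 : b * Q ≤ A / 2 + b ^ 2 * E * S * D / 2 := by
    refine le_of_sq_le_sq ?_ (by positivity)
    rw [mul_pow]
    have := mul_le_mul_of_nonneg_left h2 (sq_nonneg b)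
    nlinarith [sq_nonneg (A - b ^ 2 * E * S * D)]
  have h5 : 0 ≤ b ^ 2 * E * S * B := by positivity
  have h6 : 0 ≤ a * D := by positivity
  nlinarith

/-- The weighted geometric mean y^{1/4} V^{1/4} n^{1/2} is dominated by a sum: each of εV, cy, cn is
at most the right-hand side S, and c = 1 + K/ε is chosen so that K ≤ εc³, whence X⁴ ≤ (εV)(cy)(cn)²
≤ S⁴. The outcome is linear in y with a constant coefficient, as Grönwall's inequality will require.
-/
theorem le_of_pow_four_le {K ε : ℝ} (hK : 0 ≤ K) (hε : 0 < ε) {X V y n : ℝ} (hV : 0 ≤ V)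
    (hy : 0 ≤ y) (hn : 0 ≤ n) (h : X ^ 4 ≤ K * y * V * n ^ 2) :
    X ≤ ε * V + (1 + K / ε) * (y + n) := by
  set c := 1 + K / ε with hc
  have hKε : 0 ≤ K / ε := by positivity
  have hc1 : 1 ≤ c := by linarith
  have hcε : K ≤ ε * c := by rw [hc, mul_add, mul_div_cancel₀ _ hε.ne']; linarith
  have h0 : 0 ≤ ε * V + c * (y + n) := by positivity
  have hc3 : c ≤ c ^ 3 := by nlinarith [sq_nonneg c]
  set S := ε * V + c * (y + n) with hS
  have a1 : ε * V ≤ S := by have : 0 ≤ c * (y + n) := by positivity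
                            linarith
  have a2 : c * y ≤ S := by have : 0 ≤ c * n := by positivity
                            have : 0 ≤ ε * V := by positivity
                            linarith
  have a3 : c * n ≤ S := by have : 0 ≤ c * y := by positivity
                            have : 0 ≤ ε * V := by positivity
                            linarith
  have h1 : X ^ 4 ≤ S ^ 4 := by
    calc X ^ 4 ≤ K * y * V * n ^ 2 := h
      _ ≤ (ε * c ^ 3) * y * V * n ^ 2 := by
          gcongr
          exact hcε.trans (mul_le_mul_of_nonneg_left hc3 hε.le)
      _ = (ε * V) * (c * y) * ((c * n) * (c * n)) := by ring
      _ ≤ S * S * (S * S) := by gcongr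
      _ = S ^ 4 := by ring
  by_contra! hlt
  have := pow_lt_pow_left₀ hlt h0 (n := 4) (by norm_num)
  linarith

theorem rpow_le_one_add_rpow {a b N : ℝ} (hN : 0 ≤ N) (ha : 0 ≤ a) (hab : a ≤ b) :
    N ^ a ≤ 1 + N ^ b := by
  have h0 : 0 ≤ N ^ b := by positivity
  rcases le_total N 1 with h | h
  · linarith [Real.rpow_le_one hN h ha]
  · linarith [Real.rpow_le_rpow_of_exponent_le h hab]

/-- Any growth up to exponent 2β fits under the square of 1 + N^β. It is used with exponents γ and
1, before roots are taken. -/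
theorem rpow_le_one_add_sq {a β N : ℝ} (hN : 0 ≤ N) (ha : 0 ≤ a) (hab : a ≤ 2 * β) :
    1 + N ^ a ≤ 2 * (1 + N ^ β) ^ 2 := by
  have h1 := rpow_le_one_add_rpow hN ha hab
  have h2 : N ^ (2 * β) = (N ^ β) ^ 2 := by
    rw [mul_comm, Real.rpow_mul hN, Real.rpow_two]
  have h0 : 0 ≤ N ^ β := by positivity
  nlinarith

/-- Bookkeeping for the convective term: V is the squared H¹ norm of the weighted velocity, D the
weighted dissipation, y the weighted kinetic energy, and n the quantity that dominates G = 1 +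
‖∇u‖₂². -/
theorem absorb_le {X V D y n G ε B c t : ℝ} (hε : 0 ≤ ε) (hB : 0 ≤ B + 1) (ht : 0 ≤ t)
    (hy : 0 ≤ y) (hn : 0 ≤ n) (hX : X ≤ ε * V + c * (y + n)) (hV : V ≤ (B + 1) * (y + (2 * D + t * G)))
    (hG : G ≤ n) : X ≤ ε * (B + 1) * 2 * D + (ε * (B + 1) * (t + 1) + c) * (y + n) := by
  have h1 := mul_le_mul_of_nonneg_left hV hε
  have h2 := mul_le_mul_of_nonneg_left hG (mul_nonneg (mul_nonneg hε hB) ht)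
  have h3 := mul_nonneg (mul_nonneg (mul_nonneg hε hB) ht) hy
  have h4 := mul_nonneg (mul_nonneg hε hB) hn
  linarith

section Slice

variable {γ ρbar : ℝ}

/-- All even moments of the velocity are controlled by the dissipation. -/
theorem exists_moment_le (hγ : 1 < γ) (hρ : 0 < ρbar) {E : ℝ} (hE : 0 ≤ E) (k : ℕ) :
    ∃ C : ℝ, 0 < C ∧ ∀ r U, FiniteEnergyState γ ρbar r U →
      ∫ x, r x * ‖U x‖ ^ 2 ≤ E → ∫ x, potentialEnergy γ ρbar (r x) ≤ E →
      Integrable (fun x => ‖U x‖ ^ (2 * k + 2)) ∧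
      ∫ x, ‖U x‖ ^ (2 * k + 2) ≤ C * (1 + ∫ x, gradSq U x) ^ (k + 1) := by
  obtain ⟨S, hS, hsob⟩ := integral_norm_pow_le k
  obtain ⟨A, hA, hL2⟩ := exists_integral_norm_sq_le hγ hρ hE
  refine ⟨S * (A * (E + 1)), by positivity, fun r U h hkin hpot => ?_⟩
  obtain ⟨i, hb⟩ := hsob U h.contDiff h.integrable_sq h.integrable_gradSq
  refine ⟨i, hb.trans ?_⟩
  have hD : 0 ≤ ∫ x, gradSq U x := integral_nonneg (gradSq_nonneg U)
  set D := ∫ x, gradSq U x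
  have h1 : ∫ x, ‖U x‖ ^ 2 ≤ A * (E + 1) * (1 + D) := by
    refine (hL2 r U h hpot).trans ?_
    rw [mul_assoc]
    gcongr
    nlinarith
  have h2 : D ^ k ≤ (1 + D) ^ k := pow_le_pow_left₀ hD (by linarith) k
  calc S * (∫ x, ‖U x‖ ^ 2) * D ^ k ≤ S * (A * (E + 1) * (1 + D)) * (1 + D) ^ k := by gcongr
    _ = _ := by ring

theorem integrable_potential_mul_norm_sq (hγ : 1 < γ) (hρ : 0 < ρbar) {r : Plane → ℝ}
    {U : Plane → Plane} (h : FiniteEnergyState γ ρbar r U) :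
    Integrable fun x => potentialEnergy γ ρbar (r x) * ‖U x‖ ^ 2 := by
  obtain ⟨S, hS, hsob⟩ := integral_norm_pow_le 1
  have i4 := (hsob U h.contDiff h.integrable_sq h.integrable_gradSq).1
  obtain ⟨C, hC, hle⟩ := exists_potentialEnergy_le hγ hρ
  exact (h.integral_comp_mul_le hγ hρ (p := 2 * γ) (by linarith) (by linarith) le_rfl
    (continuous_potentialEnergy hγ) hC (fun y => potentialEnergy_nonneg hγ hρ) hle
    (fun x => sq_nonneg ‖U x‖) h.integrable_sq (by simpa only [← pow_mul] using i4)).1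

/-- Estimating Ψ ≲ 1 + |ρ-ρbar|^γ directly would produce the power γ of the norm. Instead one factor
√Ψ is kept in L², where the energy bounds it, so that only the square root of ∫ Ψ|U|⁴ is needed.
This halves the exponent to γ/2 ≤ β, the place where γ ≤ 2β is indispensable to the argument. -/
theorem exists_integral_potential_mul_le (hγ : 1 < γ) (hρ : 0 < ρbar) {β : ℝ} (hγβ : γ ≤ 2 * β)
    {E : ℝ} (hE : 0 ≤ E) :
    ∃ C : ℝ, 0 < C ∧ ∀ r U, FiniteEnergyState γ ρbar r U →
      ∫ x, r x * ‖U x‖ ^ 2 ≤ E → ∫ x, potentialEnergy γ ρbar (r x) ≤ E → ∀ p, 4 * β + 1 ≤ p →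
      ∫ x, potentialEnergy γ ρbar (r x) * ‖U x‖ ^ 2
        ≤ C * ((1 + lpDist ρbar p r ^ β) * (1 + ∫ x, gradSq U x)) := by
  obtain ⟨C, hC, hle⟩ := exists_potentialEnergy_le hγ hρ
  obtain ⟨A, hA, hm4⟩ := exists_moment_le hγ hρ hE 1
  obtain ⟨B, hB, hm8⟩ := exists_moment_le hγ hρ hE 3
  refine ⟨√(E * (C * 2 * (A + √B))) + 1, by positivity, fun r U h hkin hpot p hp => ?_⟩
  obtain ⟨i4, h4⟩ := hm4 r U h hkin hpot
  obtain ⟨i8, h8⟩ := hm8 r U h hkin hpot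
  simp only [Nat.reduceMul, Nat.reduceAdd] at i4 h4 i8 h8
  have hD : 0 ≤ ∫ x, gradSq U x := integral_nonneg (gradSq_nonneg U)
  set G := 1 + ∫ x, gradSq U x
  have hG : 1 ≤ G := by simp only [G]; linarith
  have hN := lpDist_nonneg ρbar p r
  set N := lpDist ρbar p r with hNdef
  have hP0 : ∀ x, 0 ≤ potentialEnergy γ ρbar (r x) := fun x =>
    potentialEnergy_nonneg hγ hρ (h.nonneg x)
  obtain ⟨iZ, hZ⟩ := h.integral_comp_mul_le hγ hρ (p := p) (by linarith) (by linarith)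
    (by linarith) (continuous_potentialEnergy hγ) hC (fun y => potentialEnergy_nonneg hγ hρ) hle
    (g := fun x => ‖U x‖ ^ 4) (fun x => by positivity) i4
    (by simpa only [← pow_mul] using i8)
  simp only [← pow_mul, Nat.reduceMul, ← hNdef] at hZ
  have hcP : Continuous fun x => √(potentialEnergy γ ρbar (r x)) :=
    ((continuous_potentialEnergy hγ).comp h.continuous).sqrt
  have hcg : Continuous fun x => √(potentialEnergy γ ρbar (r x)) * ‖U x‖ ^ 2 :=
    hcP.mul (h.contDiff.continuous.norm.pow 2)
  have e1 : ∀ x, (√(potentialEnergy γ ρbar (r x)) * ‖U x‖ ^ 2) ^ 2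
      = potentialEnergy γ ρbar (r x) * ‖U x‖ ^ 4 := fun x => by
    rw [mul_pow, Real.sq_sqrt (hP0 x), ← pow_mul]
  have e2 : ∀ x, √(potentialEnergy γ ρbar (r x)) * (√(potentialEnergy γ ρbar (r x)) * ‖U x‖ ^ 2)
      = potentialEnergy γ ρbar (r x) * ‖U x‖ ^ 2 := fun x => by
    rw [← mul_assoc, Real.mul_self_sqrt (hP0 x)]
  have hcs := (integral_mul_sq_le (ν := (volume : Measure Plane)) hcP.aestronglyMeasurable
    hcg.aestronglyMeasurable (by simpa only [Real.sq_sqrt (hP0 _)] using h.integrable_potential)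
    (by simpa only [e1] using iZ)).2
  simp only [e1, e2, Real.sq_sqrt (hP0 _)] at hcs
  have h5 : √(∫ x, ‖U x‖ ^ 8) ≤ √B * G ^ 2 := by
    rw [← Real.sqrt_sq (by positivity : 0 ≤ G ^ 2), ← Real.sqrt_mul hB.le]
    exact Real.sqrt_le_sqrt (h8.trans_eq (by ring))
  have h6 := rpow_le_one_add_sq (a := γ) hN (by linarith) hγβ
  have h7 : ∫ x, potentialEnergy γ ρbar (r x) * ‖U x‖ ^ 4
      ≤ C * (2 * (1 + N ^ β) ^ 2) * (A * G ^ 2 + √B * G ^ 2) := by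
    exact hZ.trans (by gcongr)
  have h8' : (∫ x, potentialEnergy γ ρbar (r x) * ‖U x‖ ^ 2) ^ 2
      ≤ (E * (C * 2 * (A + √B))) * ((1 + N ^ β) * G) ^ 2 := by
    refine hcs.trans ((mul_le_mul hpot h7 (integral_nonneg fun x =>
      mul_nonneg (hP0 x) (by positivity)) hE).trans_eq (by ring))
  have h9 : 0 ≤ (1 + N ^ β) * G := by positivity
  refine le_of_sq_le_sq ?_ (by positivity)
  refine h8'.trans ?_
  rw [mul_pow _ ((1 + N ^ β) * G)]
  gcongr
  calc E * (C * 2 * (A + √B)) = √(E * (C * 2 * (A + √B))) ^ 2 :=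
        (Real.sq_sqrt (by positivity)).symm
    _ ≤ _ := by
        have := Real.sqrt_nonneg (E * (C * 2 * (A + √B)))
        gcongr
        linarith

/-- Here λ(ρ) already has growth β, so Hölder's inequality with the second and fourth moments of U
suffices. -/
theorem exists_integral_viscosity_mul_le (hγ : 1 < γ) (hρ : 0 < ρbar) {β : ℝ} (hβ : 1 / 2 < β)
    {E : ℝ} (hE : 0 ≤ E) :
    ∃ C : ℝ, 0 < C ∧ ∀ r U, FiniteEnergyState γ ρbar r U →
      ∫ x, r x * ‖U x‖ ^ 2 ≤ E → ∫ x, potentialEnergy γ ρbar (r x) ≤ E → ∀ p, 4 * β + 1 ≤ p →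
      Integrable (fun x => bulkViscosity β (r x) * ‖U x‖ ^ 2) ∧
      ∫ x, bulkViscosity β (r x) * ‖U x‖ ^ 2
        ≤ C * ((1 + lpDist ρbar p r ^ β) * (1 + ∫ x, gradSq U x)) := by
  obtain ⟨C, hC, hle⟩ := exists_rpow_le_one_add (a := β) (by linarith) hρ.le
  obtain ⟨A, hA, hm2⟩ := exists_moment_le hγ hρ hE 0
  obtain ⟨B, hB, hm4⟩ := exists_moment_le hγ hρ hE 1
  refine ⟨C * (A + √B), by positivity, fun r U h hkin hpot p hp => ?_⟩
  obtain ⟨i2, h2⟩ := hm2 r U h hkin hpot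
  obtain ⟨i4, h4⟩ := hm4 r U h hkin hpot
  simp only [Nat.reduceMul, Nat.reduceAdd, mul_zero, zero_add, pow_one] at i2 h2 i4 h4
  have hD : 0 ≤ ∫ x, gradSq U x := integral_nonneg (gradSq_nonneg U)
  set G := 1 + ∫ x, gradSq U x
  have hG : 1 ≤ G := by simp only [G]; linarith
  have hN := lpDist_nonneg ρbar p r
  obtain ⟨iZ, hZ⟩ := h.integral_comp_mul_le hγ hρ (p := p) (φ := bulkViscosity β) (by linarith)
    (by linarith) (by linarith) (Real.continuous_rpow_const (by linarith)) hC
    (fun y hy => Real.rpow_nonneg hy _) hle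
    (g := fun x => ‖U x‖ ^ 2) (fun x => by positivity) i2
    (by simpa only [← pow_mul] using i4)
  simp only [← pow_mul, Nat.reduceMul] at hZ
  refine ⟨iZ, hZ.trans ?_⟩
  have h5 : √(∫ x, ‖U x‖ ^ 4) ≤ √B * G := by
    rw [← Real.sqrt_sq (by positivity : 0 ≤ G), ← Real.sqrt_mul hB.le]
    exact Real.sqrt_le_sqrt h4
  calc _ ≤ C * (1 + lpDist ρbar p r ^ β) * (A * G + √B * G) := by gcongr
    _ = _ := by ring

theorem gradSq_smul_le {η : Plane → ℝ} {U : Plane → Plane} {x : Plane}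
    (hη : DifferentiableAt ℝ η x) (hU : DifferentiableAt ℝ U x) {L : ℝ}
    (hL : ‖fderiv ℝ η x‖ ≤ L) :
    gradSq (fun y => η y • U y) x ≤ 2 * (η x ^ 2 * gradSq U x) + 2 * L ^ 2 * ‖U x‖ ^ 2 := by
  have e : ∀ i j, pderiv j (fun y => η y • U y) x i
      = η x * pderiv j U x i + pderiv j η x * U x i := fun i j => by
    unfold pderiv
    rw [fderiv_fun_smul hη hU]
    simp
  have h1 := norm_sq_clm_eq (fderiv ℝ η x)
  have h2 : pderiv 0 η x ^ 2 + pderiv 1 η x ^ 2 ≤ L ^ 2 := by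
    change fderiv ℝ η x _ ^ 2 + fderiv ℝ η x _ ^ 2 ≤ L ^ 2
    rw [← h1]; gcongr
  have h3 := mul_le_mul_of_nonneg_right h2 (sq_nonneg ‖U x‖)
  rw [norm_sq_eq] at h3 ⊢
  simp only [gradSq, Fin.sum_univ_two, e]
  have key : ∀ a b c d : ℝ, (a * b + c * d) ^ 2 ≤ 2 * (a ^ 2 * b ^ 2) + 2 * (c ^ 2 * d ^ 2) :=
    fun a b c d => by nlinarith [sq_nonneg (a * b - c * d)]
  have k00 := key (η x) (pderiv 0 U x 0) (pderiv 0 η x) (U x 0)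
  have k10 := key (η x) (pderiv 1 U x 0) (pderiv 1 η x) (U x 0)
  have k01 := key (η x) (pderiv 0 U x 1) (pderiv 0 η x) (U x 1)
  have k11 := key (η x) (pderiv 1 U x 1) (pderiv 1 η x) (U x 1)
  linarith

/-- The convective term is controlled by the dissipation and the weighted energy. -/
theorem exists_integral_convection_le (hγ : 1 < γ) (hρ : 0 < ρbar) {β : ℝ} (hβ : 1 / 2 < β)
    {E : ℝ} (hE : 0 ≤ E) {L : ℝ} {ε : ℝ} (hε : 0 < ε) :
    ∃ C : ℝ, 0 < C ∧ ∀ r U, FiniteEnergyState γ ρbar r U →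
      ∫ x, r x * ‖U x‖ ^ 2 ≤ E → ∫ x, potentialEnergy γ ρbar (r x) ≤ E → ∀ p, 4 * β + 1 ≤ p →
      ∀ η : Plane → ℝ, ContDiff ℝ 1 η → HasCompactSupport η → (∀ x, 0 ≤ η x) →
      (∀ x, ‖fderiv ℝ η x‖ ≤ L) →
      ∫ x, η x * (r x * ‖U x‖ ^ 3) ≤ ε * (∫ x, η x ^ 2 * gradSq U x)
        + C * ((∫ x, η x ^ 2 * (r x * ‖U x‖ ^ 2))
          + (1 + lpDist ρbar p r ^ β) * (1 + ∫ x, gradSq U x)) := by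
  obtain ⟨A2, hA2, hm2⟩ := exists_moment_le hγ hρ hE 0
  obtain ⟨A8, hA8, hm8⟩ := exists_moment_le hγ hρ hE 3
  obtain ⟨A16, hA16, hm16⟩ := exists_moment_le hγ hρ hE 7
  obtain ⟨B, hB, hL2⟩ := exists_integral_norm_sq_le hγ hρ hE
  obtain ⟨S4, hS4, hs4⟩ := integral_norm_pow_le_pow 1
  obtain ⟨S8, hS8, hs8⟩ := integral_norm_pow_le_pow 3
  obtain ⟨C, hC, hle⟩ := exists_rpow_le_one_add (a := 1) one_pos hρ.le
  set K := E ^ 2 * (2 * C * (√(A8 * S4) + √(√(A16 * S8)))) with hK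
  have hK0 : 0 ≤ K := by positivity
  -- Chosen so that ε'V contributes exactly ε times the weighted dissipation: V costs a factor B+1
  -- for the L² part, and the gradient of ηU a factor 2.
  set ε' := ε / (2 * (B + 1)) with hε'
  have hε'0 : 0 < ε' := by positivity
  refine ⟨ε' * (B + 1) * (2 * L ^ 2 * A2 + 1) + (1 + K / ε'), by positivity,
    fun r U h hkin hpot p hp η hη hηs hη0 hηL => ?_⟩
  obtain ⟨i2, h2⟩ := hm2 r U h hkin hpot
  obtain ⟨i8, h8⟩ := hm8 r U h hkin hpot
  obtain ⟨i16, h16⟩ := hm16 r U h hkin hpot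
  simp only [Nat.reduceMul, Nat.reduceAdd, mul_zero, zero_add, pow_one] at i2 h2 i8 h8 i16 h16
  have hD : 0 ≤ ∫ x, gradSq U x := integral_nonneg (gradSq_nonneg U)
  set G := 1 + ∫ x, gradSq U x
  have hG : 1 ≤ G := by simp only [G]; linarith
  have hN := lpDist_nonneg ρbar p r
  set N := lpDist ρbar p r with hNdef
  have hr0 := h.nonneg
  have hrc := h.continuous
  have hUc := h.contDiff.continuous
  have hηc := hη.continuous
  have hUn : Continuous fun x => ‖U x‖ := hUc.norm
  -- integrability of continuous functions carrying a factor `η`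
  have hint : ∀ g : Plane → ℝ, Continuous g → Integrable fun x => η x * g x := fun g hg =>
    (hηc.mul hg).integrable_of_hasCompactSupport hηs.mul_right
  -- The weighted velocity with the same density is again a finite energy state, so its L² norm is
  -- controlled by its own kinetic energy y and gradient.
  set v : Plane → Plane := fun x => η x • U x with hv
  have hvd : ContDiff ℝ 1 v := hη.smul h.contDiff
  have hvs : HasCompactSupport v := hηs.smul_right
  have hvn : ∀ x, ‖v x‖ = η x * ‖U x‖ := fun x => by
    rw [hv]; simp only [norm_smul, Real.norm_of_nonneg (hη0 x)]
  have iv2 : Integrable fun x => ‖v x‖ ^ 2 :=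
    integrable_pow_of_hasCompactSupport hvd.continuous.norm hvs.norm two_ne_zero
  have ig : Integrable fun x => η x ^ 2 * gradSq U x := by
    simp only [sq, mul_assoc]
    exact hint _ (hηc.mul (continuous_gradSq h.contDiff))
  have hgv : ∀ x, gradSq v x ≤ 2 * (η x ^ 2 * gradSq U x) + 2 * L ^ 2 * ‖U x‖ ^ 2 := fun x =>
    gradSq_smul_le (hη.differentiable one_ne_zero x) (h.contDiff.differentiable one_ne_zero x)
      (hηL x)
  have igb : Integrable fun x => 2 * (η x ^ 2 * gradSq U x) + 2 * L ^ 2 * ‖U x‖ ^ 2 :=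
    (ig.const_mul _).add (h.integrable_sq.const_mul _)
  have igv : Integrable (gradSq v) := igb.mono' (continuous_gradSq hvd).aestronglyMeasurable
    (Eventually.of_forall fun x => by rw [Real.norm_of_nonneg (gradSq_nonneg _ _)]; exact hgv x)
  have hstate : FiniteEnergyState γ ρbar r v :=
    ⟨hrc, hr0, h.bounded, hvd, iv2, igv, h.integrable_potential⟩
  have hv2 : ∀ x, r x * ‖v x‖ ^ 2 = η x ^ 2 * (r x * ‖U x‖ ^ 2) := fun x => by rw [hvn]; ring
  set y := ∫ x, η x ^ 2 * (r x * ‖U x‖ ^ 2) with hy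
  have hy0 : 0 ≤ y := integral_nonneg fun x =>
    mul_nonneg (sq_nonneg _) (mul_nonneg (hr0 x) (sq_nonneg _))
  set Dη := ∫ x, η x ^ 2 * gradSq U x
  have hDη : 0 ≤ Dη := integral_nonneg fun x => mul_nonneg (sq_nonneg _) (gradSq_nonneg _ _)
  have hgvI : ∫ x, gradSq v x ≤ 2 * Dη + 2 * L ^ 2 * (A2 * G) := by
    refine (integral_mono igv igb hgv).trans ?_
    rw [integral_add (ig.const_mul _) (h.integrable_sq.const_mul _), integral_const_mul,
      integral_const_mul]
    gcongr
  have hgv0 : 0 ≤ ∫ x, gradSq v x := integral_nonneg (gradSq_nonneg v)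
  have hv20 : 0 ≤ ∫ x, ‖v x‖ ^ 2 := integral_nonneg fun x => sq_nonneg _
  have hvL2 := hL2 r v hstate hpot
  simp only [hv2, ← hy] at hvL2
  set V := (∫ x, ‖v x‖ ^ 2) + ∫ x, gradSq v x with hVdef
  have hV0 : 0 ≤ V := by positivity
  have hV : V ≤ (B + 1) * (y + (2 * Dη + 2 * L ^ 2 * (A2 * G))) := by
    rw [hVdef]
    nlinarith
  -- the sixth order moment
  obtain ⟨j4, k4⟩ := hs4 v hvd iv2 igv
  obtain ⟨j8, k8⟩ := hs8 v hvd iv2 igv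
  simp only [Nat.reduceMul, Nat.reduceAdd] at j4 k4 j8 k8
  have hvnc : Continuous fun x => ‖v x‖ := hvd.continuous.norm
  have hc1 : Continuous fun x => ‖U x‖ ^ 4 := hUn.pow 4
  have hc2 : Continuous fun x => ‖v x‖ ^ 2 := hvnc.pow 2
  have hc3 : Continuous fun x => ‖U x‖ ^ 8 := hUn.pow 8
  have hc4 : Continuous fun x => ‖v x‖ ^ 4 := hvnc.pow 4
  obtain ⟨l1, l2⟩ := integral_mul_sq_le (ν := (volume : Measure Plane)) hc1.aestronglyMeasurable
    hc2.aestronglyMeasurable (by simpa only [← pow_mul] using i8)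
    (by simpa only [← pow_mul] using j4)
  obtain ⟨l3, l4⟩ := integral_mul_sq_le (ν := (volume : Measure Plane)) hc3.aestronglyMeasurable
    hc4.aestronglyMeasurable (by simpa only [← pow_mul] using i16)
    (by simpa only [← pow_mul] using j8)
  simp only [← pow_mul, Nat.reduceMul] at l2 l4
  set J1 := ∫ x, ‖U x‖ ^ 4 * ‖v x‖ ^ 2
  set J2 := ∫ x, ‖U x‖ ^ 8 * ‖v x‖ ^ 4
  -- Both moments scale like G²V: the powers of U are paid by the unweighted moments (powers of G),
  -- the powers of v by Sobolev inequalities in terms of V.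
  have hJ1 : J1 ≤ √(A8 * S4) * (G ^ 2 * V) := by
    refine le_of_sq_le_sq ?_ (by positivity)
    rw [mul_pow, Real.sq_sqrt (by positivity)]
    refine l2.trans ((mul_le_mul h8 k4 (integral_nonneg fun x => by positivity)
      (by positivity)).trans_eq (by ring))
  have hJ2 : √J2 ≤ √(√(A16 * S8)) * (G ^ 2 * V) := by
    rw [← Real.sqrt_sq (by positivity : 0 ≤ G ^ 2 * V), ← Real.sqrt_mul (by positivity)]
    refine Real.sqrt_le_sqrt (le_of_sq_le_sq ?_ (by positivity))
    rw [mul_pow, Real.sq_sqrt (by positivity)]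
    refine l4.trans ((mul_le_mul h16 k8 (integral_nonneg fun x => by positivity)
      (by positivity)).trans_eq (by ring))
  obtain ⟨iZ, hZ⟩ := h.integral_comp_mul_le hγ hρ (p := p) (φ := fun y => y ^ (1 : ℝ))
    (by linarith) one_pos (by linarith) (Real.continuous_rpow_const zero_le_one) hC
    (fun y hy => Real.rpow_nonneg hy _) hle (g := fun x => ‖U x‖ ^ 4 * ‖v x‖ ^ 2)
    (fun x => by positivity) l1 (by simpa only [mul_pow, ← pow_mul] using l3)
  simp only [mul_pow, ← pow_mul, Nat.reduceMul, ← hNdef] at hZ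
  -- The density enters to the first power, and 1 < 2β allows 1 + N to be traded for (1+N^β)².
  -- Combined with G² this is n².
  have h1N := rpow_le_one_add_sq (a := 1) (β := β) hN zero_le_one (by linarith)
  set n := (1 + N ^ β) * G with hn
  have hn0 : 0 ≤ n := by positivity
  have hZ' : ∫ x, r x ^ (1 : ℝ) * (‖U x‖ ^ 4 * ‖v x‖ ^ 2)
      ≤ (2 * C * (√(A8 * S4) + √(√(A16 * S8)))) * (n ^ 2 * V) := by
    refine hZ.trans ?_
    calc _ ≤ C * (2 * (1 + N ^ β) ^ 2)
          * (√(A8 * S4) * (G ^ 2 * V) + √(√(A16 * S8)) * (G ^ 2 * V)) := by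
          gcongr
      _ = _ := by rw [hn]; ring
  -- two applications of Cauchy-Schwarz
  have hsr : Continuous fun x => √(r x) := hrc.sqrt
  have c1 : Continuous fun x => √(r x) * ‖U x‖ := hsr.mul hUn
  have c2 : Continuous fun x => √(r x) * (η x * ‖U x‖ ^ 2) := hsr.mul (hηc.mul (hUn.pow 2))
  have c3 : Continuous fun x => √(r x) * (η x * ‖U x‖) := hsr.mul (hηc.mul hUn)
  have c4 : Continuous fun x => √(r x) * (η x * ‖U x‖ ^ 3) := hsr.mul (hηc.mul (hUn.pow 3))
  have s1 : ∀ x, (√(r x) * ‖U x‖) ^ 2 = r x * ‖U x‖ ^ 2 := fun x => by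
    rw [mul_pow, Real.sq_sqrt (hr0 x)]
  have s2 : ∀ x, (√(r x) * (η x * ‖U x‖ ^ 2)) ^ 2
      = (√(r x) * (η x * ‖U x‖)) * (√(r x) * (η x * ‖U x‖ ^ 3)) := fun x => by ring
  have s3 : ∀ x, (√(r x) * (η x * ‖U x‖)) ^ 2 = η x ^ 2 * (r x * ‖U x‖ ^ 2) := fun x => by
    rw [mul_pow, Real.sq_sqrt (hr0 x)]; ring
  have s4 : ∀ x, (√(r x) * (η x * ‖U x‖ ^ 3)) ^ 2
      = r x ^ (1 : ℝ) * (‖U x‖ ^ 4 * ‖v x‖ ^ 2) := fun x => by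
    rw [mul_pow, Real.sq_sqrt (hr0 x), Real.rpow_one, hvn]; ring
  have s5 : ∀ x, (√(r x) * ‖U x‖) * (√(r x) * (η x * ‖U x‖ ^ 2))
      = η x * (r x * ‖U x‖ ^ 3) := fun x => by
    have := Real.mul_self_sqrt (hr0 x)
    linear_combination (η x * ‖U x‖ ^ 3) * this
  have hsup : ∀ k, Continuous k → ∀ g : Plane → ℝ, Continuous g →
      Integrable fun x => (k x * (η x * g x)) ^ 2 := fun k hk g hg => by
    have : (fun x => (k x * (η x * g x)) ^ 2) = fun x => η x * (k x ^ 2 * (η x * g x ^ 2)) := by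
      ext x; ring
    rw [this]
    exact hint _ ((hk.pow 2).mul (hηc.mul (hg.pow 2)))
  have q1 := (integral_mul_sq_le (ν := (volume : Measure Plane)) c1.aestronglyMeasurable
    c2.aestronglyMeasurable
    (by simpa only [s1] using h.integrable_density_mul h.integrable_sq)
    (hsup _ hsr _ (hUn.pow 2))).2
  have q2 := (integral_mul_sq_le (ν := (volume : Measure Plane)) c3.aestronglyMeasurable
    c4.aestronglyMeasurable (hsup _ hsr _ hUn) (hsup _ hsr _ (hUn.pow 3))).2
  simp only [s5, s1] at q1
  simp only [← s2] at q2
  simp only [s3, s4, ← hy] at q2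
  set X := ∫ x, η x * (r x * ‖U x‖ ^ 3)
  set Q := ∫ x, (√(r x) * (η x * ‖U x‖ ^ 2)) ^ 2
  have hQ0 : 0 ≤ Q := integral_nonneg fun x => sq_nonneg _
  -- The chain is X² ≤ E·∫η²ρ|U|⁴, followed by (∫η²ρ|U|⁴)² ≤ y·∫η²ρ|U|⁶, and the sixth order
  -- integral is at most a constant times n²V.
  have hX4 : X ^ 4 ≤ K * y * V * n ^ 2 := by
    calc X ^ 4 = (X ^ 2) ^ 2 := by ring
      _ ≤ (E * Q) ^ 2 := by
          refine pow_le_pow_left₀ (sq_nonneg _) (q1.trans ?_) 2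
          gcongr
      _ = E ^ 2 * Q ^ 2 := by ring
      _ ≤ E ^ 2 * (y * ((2 * C * (√(A8 * S4) + √(√(A16 * S8)))) * (n ^ 2 * V))) := by
          gcongr
          exact q2.trans (by gcongr)
      _ = _ := by rw [hK]; ring
  have hX := le_of_pow_four_le hK0 hε'0 hV0 hy0 hn0 hX4
  have e3 : ε' * (B + 1) * 2 = ε := by rw [hε']; field_simp
  have hGn : G ≤ n := by
    rw [hn]; exact le_mul_of_one_le_left (by linarith) (by linarith [Real.rpow_nonneg hN β])
  rw [← e3]
  exact absorb_le (t := 2 * L ^ 2 * A2) (by positivity) (by positivity) (by positivity)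
    hy0 hn0 hX (by rw [← mul_assoc] at hV; exact hV) hGn

end Slice

/-! ### The error caused by the weight -/

/-- The integrand produced by the derivatives of the weight `η²` in the energy identity. -/
noncomputable def weightError (μ β γ ρbar : ℝ) (η : Plane → ℝ) (r : Plane → ℝ) (U : Plane → Plane)
    (x : Plane) : ℝ :=
  2 * η x * ((1 / 2 * (r x * ‖U x‖ ^ 2) + potentialEnergy γ ρbar (r x) + (r x ^ γ - ρbar ^ γ))
      * fderiv ℝ η x (U x)
    - μ * (∑ j, pderiv j η x * ∑ i, U x i * pderiv j U x i)
    - (μ + bulkViscosity β (r x)) * divergence U x * fderiv ℝ η x (U x))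

/-- The factor 1/2 is the one for which the energy identity holds. The integrand of the statement
lies between this density and its double, which is the origin of the factors 2 in the sequel. -/
noncomputable def energyDensity (γ ρbar : ℝ) (r : Plane → ℝ) (U : Plane → Plane) (x : Plane) : ℝ :=
  1 / 2 * (r x * ‖U x‖ ^ 2) + potentialEnergy γ ρbar (r x)

noncomputable def dissipationDensity (μ β : ℝ) (r : Plane → ℝ) (U : Plane → Plane) (x : Plane) :
    ℝ :=
  μ * gradSq U x + (μ + bulkViscosity β (r x)) * divergence U x ^ 2

theorem abs_fderiv_apply_le {η : Plane → ℝ} {x : Plane} {L : ℝ} (hL : ‖fderiv ℝ η x‖ ≤ L)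
    (v : Plane) : |fderiv ℝ η x v| ≤ L * ‖v‖ := by
  rw [← Real.norm_eq_abs]
  exact (ContinuousLinearMap.le_opNorm _ _).trans (by gcongr)

theorem sum_pderiv_mul_sq_le {η : Plane → ℝ} {U : Plane → Plane} {x : Plane} {L : ℝ}
    (hL : ‖fderiv ℝ η x‖ ≤ L) :
    (∑ j, pderiv j η x * ∑ i, U x i * pderiv j U x i) ^ 2
      ≤ L ^ 2 * ‖U x‖ ^ 2 * gradSq U x := by
  set z : Plane := !₂[∑ i, U x i * pderiv 0 U x i, ∑ i, U x i * pderiv 1 U x i]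
  have h0 : z 0 = ∑ i, U x i * pderiv 0 U x i := rfl
  have h1 : z 1 = ∑ i, U x i * pderiv 1 U x i := rfl
  have e : ∑ j, pderiv j η x * ∑ i, U x i * pderiv j U x i = fderiv ℝ η x z := by
    rw [clm_apply_eq, h0, h1, Fin.sum_univ_two, mul_comm (pderiv 0 η x), mul_comm (pderiv 1 η x)]
    rfl
  have hz : ‖z‖ ^ 2 ≤ ‖U x‖ ^ 2 * gradSq U x := by
    rw [norm_sq_eq, norm_sq_eq, h0, h1, gradSq]
    simp only [Fin.sum_univ_two]
    nlinarith [sq_nonneg (U x 0 * pderiv 0 U x 1 - U x 1 * pderiv 0 U x 0),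
      sq_nonneg (U x 0 * pderiv 1 U x 1 - U x 1 * pderiv 1 U x 0)]
  have h2 := abs_fderiv_apply_le hL z
  rw [e, ← sq_abs]
  calc |fderiv ℝ η x z| ^ 2 ≤ (L * ‖z‖) ^ 2 := by gcongr
    _ = L ^ 2 * ‖z‖ ^ 2 := by ring
    _ ≤ L ^ 2 * (‖U x‖ ^ 2 * gradSq U x) := by gcongr
    _ = _ := by ring

theorem divergence_sq_le (U : Plane → Plane) (x : Plane) :
    divergence U x ^ 2 ≤ 2 * gradSq U x := by
  simp only [divergence, gradSq, Fin.sum_univ_two]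
  nlinarith [sq_nonneg (pderiv 0 U x 0 - pderiv 1 U x 1), sq_nonneg (pderiv 1 U x 0),
    sq_nonneg (pderiv 0 U x 1)]

/-- Young's inequality term by term. Both viscous terms give up a quarter of the dissipation, the Ψ
and pressure terms each give one η²Ψ, and the squares of ∇η·U leave the unweighted integrands. The
convective term is passed on unchanged, since a pointwise Young inequality would not give an
admissible bound for it. -/
theorem weightError_le {μ β γ ρbar : ℝ} (hμ : 0 < μ) {η r : Plane → ℝ} {U : Plane → Plane}
    {x : Plane} (hη : 0 ≤ η x) (hr : 0 ≤ r x) (hP : 0 ≤ potentialEnergy γ ρbar (r x)) {L C : ℝ}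
    (hC : 0 ≤ C) (hL : ‖fderiv ℝ η x‖ ≤ L)
    (hq : (r x ^ γ - ρbar ^ γ) ^ 2
      ≤ C * (potentialEnergy γ ρbar (r x) * (1 + potentialEnergy γ ρbar (r x)))) :
    weightError μ β γ ρbar η r U x ≤
      1 / 4 * (η x ^ 2 * dissipationDensity μ β r U x)
        + 2 * (η x ^ 2 * potentialEnergy γ ρbar (r x))
        + L ^ 2 * (5 + C + 8 * μ) * (‖U x‖ ^ 2 + potentialEnergy γ ρbar (r x) * ‖U x‖ ^ 2
            + bulkViscosity β (r x) * ‖U x‖ ^ 2)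
        + L * (η x * (r x * ‖U x‖ ^ 3)) := by
  have hs := abs_fderiv_apply_le hL (U x)
  have hw := sum_pderiv_mul_sq_le (U := U) hL
  have hlam : 0 ≤ bulkViscosity β (r x) := Real.rpow_nonneg hr _
  have hg := gradSq_nonneg U x
  have hn := norm_nonneg (U x)
  unfold weightError dissipationDensity
  generalize fderiv ℝ η x (U x) = s at *
  generalize (∑ j, pderiv j η x * ∑ i, U x i * pderiv j U x i) = w at *
  generalize bulkViscosity β (r x) = l at *
  generalize potentialEnergy γ ρbar (r x) = Ψ at *
  generalize r x ^ γ - ρbar ^ γ = q at *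
  generalize divergence U x = d at *
  generalize gradSq U x = g at *
  generalize ‖U x‖ = n at *
  generalize η x = e at *
  generalize r x = ρ at *
  have hs2 : s ^ 2 ≤ L ^ 2 * n ^ 2 := by
    rw [← sq_abs, ← mul_pow]; exact pow_le_pow_left₀ (abs_nonneg _) hs 2
  have t1 : 2 * e * (1 / 2 * (ρ * n ^ 2) * s) ≤ L * (e * (ρ * n ^ 3)) := by
    have h1 := mul_le_mul_of_nonneg_left ((le_abs_self s).trans hs)
      (by positivity : 0 ≤ e * (ρ * n ^ 2))
    nlinarith
  have t2 : 2 * e * (Ψ * s) ≤ e ^ 2 * Ψ + L ^ 2 * (Ψ * n ^ 2) := by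
    have h1 := mul_nonneg hP (sq_nonneg (e - s))
    have h2 := mul_le_mul_of_nonneg_left hs2 hP
    nlinarith
  -- The square of the left side is compared with that of a sum: q² ≤ CΨ(1+Ψ) makes it at most
  -- 4·(e²Ψ)·(C(1+Ψ)s²).
  have t3 : 2 * e * (q * s) ≤ e ^ 2 * Ψ + C * (1 + Ψ) * (L ^ 2 * n ^ 2) := by
    have h3 : 2 * e * (q * s) ≤ e ^ 2 * Ψ + C * (1 + Ψ) * s ^ 2 := by
      refine le_of_sq_le_sq ?_ (by positivity)
      have h1 := mul_le_mul_of_nonneg_left hq (by positivity : 0 ≤ 4 * e ^ 2 * s ^ 2)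
      nlinarith [sq_nonneg (e ^ 2 * Ψ - C * (1 + Ψ) * s ^ 2)]
    have h2 := mul_le_mul_of_nonneg_left hs2 (by positivity : 0 ≤ C * (1 + Ψ))
    linarith
  have t4 : -(2 * e * (μ * w)) ≤ μ * (1 / 4 * (e ^ 2 * g) + 4 * (L ^ 2 * n ^ 2)) := by
    have h3 : -(2 * e * w) ≤ 1 / 4 * (e ^ 2 * g) + 4 * (L ^ 2 * n ^ 2) := by
      refine le_of_sq_le_sq ?_ (by positivity)
      have h1 := mul_le_mul_of_nonneg_left hw (by positivity : 0 ≤ 4 * e ^ 2)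
      nlinarith [sq_nonneg (1 / 4 * (e ^ 2 * g) - 4 * (L ^ 2 * n ^ 2))]
    have := mul_le_mul_of_nonneg_left h3 hμ.le
    linarith
  have t5 : -(2 * e * ((μ + l) * d * s)) ≤
      (μ + l) * (1 / 4 * (e ^ 2 * d ^ 2) + 4 * (L ^ 2 * n ^ 2)) := by
    have h1 : -(2 * e * (d * s)) ≤ 1 / 4 * (e ^ 2 * d ^ 2) + 4 * (L ^ 2 * n ^ 2) := by
      nlinarith [sq_nonneg (1 / 2 * (e * d) + 2 * s)]
    have := mul_le_mul_of_nonneg_left h1 (by positivity : 0 ≤ μ + l)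
    linarith
  have p1 : 0 ≤ L ^ 2 * n ^ 2 := by positivity
  have p2 : 0 ≤ L ^ 2 * n ^ 2 * Ψ := by positivity
  have p3 : 0 ≤ L ^ 2 * n ^ 2 * l := by positivity
  have p4 := mul_nonneg p2 hμ.le
  have p5 := mul_nonneg p3 hμ.le
  have p6 := mul_nonneg p3 hC
  linarith

/-- A crude bound, linear in the gradient of the weight, with coefficients that may depend on the
maximal density. It serves only to show that the error vanishes for cutoffs with small gradients. -/
theorem abs_weightError_le {μ β γ ρbar : ℝ} (hμ : 0 < μ) {η r : Plane → ℝ} {U : Plane → Plane}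
    {x : Plane} (hη : 0 ≤ η x) (hη1 : η x ≤ 1) (hr : 0 ≤ r x)
    (hP : 0 ≤ potentialEnergy γ ρbar (r x)) {L C R Λ M : ℝ}
    (hC : 0 ≤ C) (hL : ‖fderiv ℝ η x‖ ≤ L) (hR : r x ≤ R) (hΛ : bulkViscosity β (r x) ≤ Λ)
    (hM : potentialEnergy γ ρbar (r x) ≤ M)
    (hq : (r x ^ γ - ρbar ^ γ) ^ 2
      ≤ C * (potentialEnergy γ ρbar (r x) * (1 + potentialEnergy γ ρbar (r x)))) :
    |weightError μ β γ ρbar η r U x| ≤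
      L * ((R + 2 * M + 2 + 2 * μ + 2 * (μ + Λ)) * ‖U x‖ ^ 2 + R * ‖U x‖ ^ 4
        + (2 + 2 * C * (1 + M)) * potentialEnergy γ ρbar (r x)
        + (2 * μ + 4 * (μ + Λ)) * gradSq U x) := by
  have hs := abs_fderiv_apply_le hL (U x)
  have hw := sum_pderiv_mul_sq_le (U := U) hL
  have hd := divergence_sq_le U x
  have hlam : 0 ≤ bulkViscosity β (r x) := Real.rpow_nonneg hr _
  have hg := gradSq_nonneg U x
  have hn := norm_nonneg (U x)
  have hL0 : 0 ≤ L := (norm_nonneg _).trans hL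
  unfold weightError
  generalize fderiv ℝ η x (U x) = s at *
  generalize (∑ j, pderiv j η x * ∑ i, U x i * pderiv j U x i) = w at *
  generalize bulkViscosity β (r x) = l at *
  generalize potentialEnergy γ ρbar (r x) = Ψ at *
  generalize r x ^ γ - ρbar ^ γ = q at *
  generalize divergence U x = d at *
  generalize gradSq U x = g at *
  generalize ‖U x‖ = n at *
  generalize η x = e at *
  generalize r x = ρ at *
  have hw' : |w| ≤ L * (1 / 2 * (n ^ 2 + g)) := by
    refine le_of_sq_le_sq ?_ (by positivity)
    rw [sq_abs]
    nlinarith [mul_nonneg (sq_nonneg L) (sq_nonneg (n ^ 2 - g))]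
  have hn3 : n ^ 2 * n ≤ n ^ 2 + n ^ 4 := by
    nlinarith [sq_nonneg n, sq_nonneg (n ^ 2 - n), mul_nonneg hn hn]
  have hqn : |q| * n ≤ C * (1 + M) * Ψ + n ^ 2 := by
    have : q ^ 2 ≤ C * (1 + M) * Ψ := hq.trans (by
      have := mul_le_mul_of_nonneg_left hM (mul_nonneg hC hP)
      nlinarith)
    nlinarith [sq_nonneg (|q| - n), sq_abs q, sq_nonneg q, sq_nonneg n]
  have hdn : |d| * n ≤ 2 * g + n ^ 2 := by
    nlinarith [sq_nonneg (|d| - n), sq_abs d, sq_nonneg d, sq_nonneg n]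
  have hPn : Ψ * n ≤ Ψ + M * n ^ 2 := by
    have h1 : n ≤ 1 + n ^ 2 := by nlinarith [sq_nonneg (n - 1)]
    have := mul_le_mul_of_nonneg_left h1 hP
    have := mul_le_mul_of_nonneg_right hM (sq_nonneg n)
    nlinarith
  have b1 : |(1 / 2 * (ρ * n ^ 2) + Ψ + q) * s| ≤ (1 / 2 * (ρ * n ^ 2) + Ψ + |q|) * (L * n) := by
    rw [abs_mul]
    gcongr
    refine (abs_add_le _ _).trans ?_
    rw [abs_of_nonneg (by positivity)]
  have b2 : |μ * w| ≤ μ * (L * (1 / 2 * (n ^ 2 + g))) := by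
    rw [abs_mul, abs_of_pos hμ]; gcongr
  have hΛ0 : 0 ≤ μ + Λ := by linarith
  have b3 : |(μ + l) * d * s| ≤ (μ + Λ) * |d| * (L * n) := by
    rw [abs_mul, abs_mul, abs_of_nonneg (by positivity : 0 ≤ μ + l)]
    gcongr
  have b4 : |(1 / 2 * (ρ * n ^ 2) + Ψ + q) * s - μ * w - (μ + l) * d * s|
      ≤ (1 / 2 * (ρ * n ^ 2) + Ψ + |q|) * (L * n) + μ * (L * (1 / 2 * (n ^ 2 + g)))
        + (μ + Λ) * |d| * (L * n) := by
    refine (abs_sub _ _).trans (add_le_add ((abs_sub _ _).trans (add_le_add b1 b2)) b3)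
  have hR0 : 0 ≤ R := hr.trans hR
  have b5 : ρ * (n ^ 2 * n) ≤ R * (n ^ 2 + n ^ 4) := by gcongr
  rw [abs_mul, abs_of_nonneg (by positivity : 0 ≤ 2 * e)]
  refine (mul_le_mul (by linarith : 2 * e ≤ 2) b4 (abs_nonneg _) zero_le_two).trans ?_
  have c5 := mul_le_mul_of_nonneg_left b5 hL0
  have c1 := mul_le_mul_of_nonneg_left hPn hL0
  have c2 := mul_le_mul_of_nonneg_left hqn hL0
  have c3 := mul_le_mul_of_nonneg_left hdn (mul_nonneg hΛ0 hL0)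
  have c4 : 0 ≤ L * μ * n ^ 2 := by positivity
  have c6 : 0 ≤ L * μ * g := by positivity
  have c7 : 0 ≤ L * (μ + Λ) * g := by positivity
  have c8 : 0 ≤ L * M * n ^ 2 := by have := hP.trans hM; positivity
  linarith

theorem integral_add_four {X : Type*} [MeasurableSpace X] {ν : Measure X} {f g h k : X → ℝ}
    (hf : Integrable f ν) (hg : Integrable g ν) (hh : Integrable h ν) (hk : Integrable k ν) :
    ∫ x, (f x + g x + h x + k x) ∂ν
      = (∫ x, f x ∂ν) + (∫ x, g x ∂ν) + (∫ x, h x ∂ν) + ∫ x, k x ∂ν := by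
  have i1 : Integrable (fun x => f x + g x) ν := hf.add hg
  have i2 : Integrable (fun x => f x + g x + h x) ν := i1.add hh
  rw [integral_add i2 hk, integral_add i1 hh, integral_add hf hg]

section Integrated

variable {μ β γ ρbar : ℝ}

theorem continuous_energyDensity (hγ : 1 < γ) {r : Plane → ℝ} {U : Plane → Plane}
    (hr : Continuous r) (hU : Continuous U) : Continuous (energyDensity γ ρbar r U) :=
  (continuous_const.mul (hr.mul (hU.norm.pow 2))).add ((continuous_potentialEnergy hγ).comp hr)

theorem continuous_dissipationDensity (hβ : 0 < β) {r : Plane → ℝ} {U : Plane → Plane}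
    (hr : Continuous r) (hU : ContDiff ℝ 1 U) : Continuous (dissipationDensity μ β r U) := by
  have h1 : Continuous fun x => bulkViscosity β (r x) := (Real.continuous_rpow_const hβ.le).comp hr
  exact (continuous_const.mul (continuous_gradSq hU)).add
    ((continuous_const.add h1).mul ((continuous_divergence hU).pow 2))

theorem continuous_weightError (hβ : 0 < β) (hγ : 1 < γ) {η r : Plane → ℝ} {U : Plane → Plane}
    (hη : ContDiff ℝ 1 η) (hr : Continuous r) (hU : ContDiff ℝ 1 U) :
    Continuous (weightError μ β γ ρbar η r U) := by
  have h1 : Continuous fun x => bulkViscosity β (r x) := (Real.continuous_rpow_const hβ.le).comp hr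
  have h2 : Continuous fun x => r x ^ γ := (Real.continuous_rpow_const (by linarith)).comp hr
  have h3 : Continuous fun x => fderiv ℝ η x (U x) :=
    (hη.continuous_fderiv one_ne_zero).clm_apply hU.continuous
  have h4 : Continuous fun x => potentialEnergy γ ρbar (r x) :=
    (continuous_potentialEnergy hγ).comp hr
  have h5 : ∀ j, Continuous (pderiv j η) := continuous_pderiv hη
  have h6 : ∀ i j, Continuous fun x => pderiv j U x i := fun i j =>
    continuous_apply (continuous_pderiv hU j) i
  have h7 : ∀ i, Continuous fun x => U x i := continuous_apply hU.continuous
  have h8 : Continuous fun x => ∑ j, pderiv j η x * ∑ i, U x i * pderiv j U x i :=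
    continuous_finsetSum _ fun j _ => (h5 j).mul (continuous_finsetSum _ fun i _ =>
      (h7 i).mul (h6 i j))
  have h9 := continuous_divergence hU
  have h10 := hη.continuous
  have h11 := hU.continuous.norm
  unfold weightError
  exact (continuous_const.mul h10).mul ((((((continuous_const.mul (hr.mul (h11.pow 2))).add h4).add
    (h2.sub continuous_const)).mul h3).sub (continuous_const.mul h8)).sub
    (((continuous_const.add h1).mul h9).mul h3))

theorem dissipationDensity_nonneg (hμ : 0 < μ) {r : Plane → ℝ} (U : Plane → Plane) {x : Plane}
    (hr : 0 ≤ r x) : 0 ≤ dissipationDensity μ β r U x := by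
  have hlam : 0 ≤ bulkViscosity β (r x) := Real.rpow_nonneg hr _
  have hg := gradSq_nonneg U x
  unfold dissipationDensity
  positivity

theorem energyDensity_nonneg (hγ : 1 < γ) (hρ : 0 < ρbar) {r : Plane → ℝ} (U : Plane → Plane)
    {x : Plane} (hr : 0 ≤ r x) : 0 ≤ energyDensity γ ρbar r U x := by
  have := potentialEnergy_nonneg hγ hρ hr
  unfold energyDensity
  positivity

/-- At a fixed time, the error produced by a weight with bounded gradient is absorbed. -/
theorem exists_integral_weightError_le (hμ : 0 < μ) (hγ : 1 < γ) (hρ : 0 < ρbar)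
    (hγβ : γ ≤ 2 * β) {E : ℝ} (hE : 0 ≤ E) {L : ℝ} (hL : 0 < L) :
    ∃ K : ℝ, 0 < K ∧ ∀ r U, FiniteEnergyState γ ρbar r U →
      ∫ x, r x * ‖U x‖ ^ 2 ≤ E → ∫ x, potentialEnergy γ ρbar (r x) ≤ E → ∀ p, 4 * β + 1 ≤ p →
      ∀ η : Plane → ℝ, ContDiff ℝ 1 η → HasCompactSupport η → (∀ x, 0 ≤ η x) →
      (∀ x, ‖fderiv ℝ η x‖ ≤ L) →
      ∫ x, weightError μ β γ ρbar η r U x ≤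
        1 / 2 * (∫ x, η x ^ 2 * dissipationDensity μ β r U x)
        + K * ((∫ x, η x ^ 2 * energyDensity γ ρbar r U x)
          + (1 + lpDist ρbar p r ^ β) * (1 + ∫ x, gradSq U x)) := by
  have hβ : 1 / 2 < β := by linarith
  obtain ⟨Cq, hCq, hq⟩ := exists_pressure_sub_sq_le hγ hρ
  obtain ⟨A, hA, hm⟩ := exists_moment_le hγ hρ hE 0
  obtain ⟨B, hB, hpot'⟩ := exists_integral_potential_mul_le hγ hρ hγβ hE
  obtain ⟨D, hD, hvis⟩ := exists_integral_viscosity_mul_le hγ hρ hβ hE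
  -- The convective term carries a factor L, so this ε costs μ/4 of the weighted gradient, hence at
  -- most a quarter of the dissipation. With the quarter from the pointwise bound, half is spent.
  obtain ⟨F, hF, hconv⟩ := exists_integral_convection_le hγ hρ hβ hE (L := L)
    (ε := μ / (4 * L)) (by positivity)
  set c := L ^ 2 * (5 + Cq + 8 * μ) with hc
  have hc0 : 0 < c := by positivity
  refine ⟨2 + c * (A + B + D) + 2 * L * F, by positivity,
    fun r U h hkin hpot p hp η hη hηs hη0 hηL => ?_⟩
  have hr0 := h.nonneg
  have hP0 : ∀ x, 0 ≤ potentialEnergy γ ρbar (r x) := fun x => potentialEnergy_nonneg hγ hρ (hr0 x)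
  have hm' := (hm r U h hkin hpot).2
  simp only [mul_zero, zero_add, pow_one] at hm'
  have hp1 := hpot' r U h hkin hpot p hp
  obtain ⟨iv, hv1⟩ := hvis r U h hkin hpot p hp
  have hX := hconv r U h hkin hpot p hp η hη hηs hη0 hηL
  have ip := integrable_potential_mul_norm_sq hγ hρ h
  have hint : ∀ g : Plane → ℝ, Continuous g → Integrable fun x => η x * g x := fun g hg =>
    (hη.continuous.mul hg).integrable_of_hasCompactSupport hηs.mul_right
  have hint2 : ∀ g : Plane → ℝ, Continuous g → Integrable fun x => η x ^ 2 * g x := fun g hg => by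
    simp only [sq, mul_assoc]; exact hint _ (hη.continuous.mul hg)
  have hU := h.contDiff
  have hUn := hU.continuous.norm
  have hcP : Continuous fun x => potentialEnergy γ ρbar (r x) :=
    (continuous_potentialEnergy hγ).comp h.continuous
  have hDc := continuous_dissipationDensity (μ := μ) (by linarith : 0 < β) h.continuous hU
  have iD := hint2 _ hDc
  have iP := hint2 _ hcP
  have iG := hint2 _ (continuous_gradSq hU)
  have iE := hint2 _ (continuous_energyDensity (ρbar := ρbar) hγ h.continuous hU.continuous)
  have iK : Integrable fun x => η x ^ 2 * (r x * ‖U x‖ ^ 2) := hint2 _ (h.continuous.mul (hUn.pow 2))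
  have iX : Integrable fun x => η x * (r x * ‖U x‖ ^ 3) := hint _ (h.continuous.mul (hUn.pow 3))
  have iW : Integrable (weightError μ β γ ρbar η r U) := by
    refine (continuous_weightError (by linarith) hγ hη h.continuous hU).integrable_of_hasCompactSupport ?_
    refine hηs.mono fun x hx => ?_
    contrapose! hx
    simp only [Function.mem_support, not_not] at hx ⊢
    simp [weightError, hx]
  have i4 : Integrable fun x => ‖U x‖ ^ 2 + potentialEnergy γ ρbar (r x) * ‖U x‖ ^ 2
      + bulkViscosity β (r x) * ‖U x‖ ^ 2 := (h.integrable_sq.add ip).add iv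
  have i5 : Integrable fun x => ‖U x‖ ^ 2 + potentialEnergy γ ρbar (r x) * ‖U x‖ ^ 2 :=
    h.integrable_sq.add ip
  have iD' : Integrable fun x => 1 / 4 * (η x ^ 2 * dissipationDensity μ β r U x) :=
    iD.const_mul _
  have iP' : Integrable fun x => 2 * (η x ^ 2 * potentialEnergy γ ρbar (r x)) := iP.const_mul _
  have i4' : Integrable fun x => c * (‖U x‖ ^ 2 + potentialEnergy γ ρbar (r x) * ‖U x‖ ^ 2
      + bulkViscosity β (r x) * ‖U x‖ ^ 2) := i4.const_mul _
  have iX' : Integrable fun x => L * (η x * (r x * ‖U x‖ ^ 3)) := iX.const_mul _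
  have hW := integral_mono iW (((iD'.add iP').add i4').add iX') fun x =>
    weightError_le (β := β) (U := U) hμ (hη0 x) (hr0 x) (hP0 x) hCq.le (hηL x) (hq _ (hr0 x))
  simp only [Pi.add_apply] at hW
  rw [integral_add_four iD' iP' i4' iX', integral_const_mul, integral_const_mul, integral_const_mul,
    integral_const_mul, integral_add i5 iv, integral_add h.integrable_sq ip] at hW
  set n := (1 + lpDist ρbar p r ^ β) * (1 + ∫ x, gradSq U x) with hn
  have hgs : 0 ≤ ∫ x, gradSq U x := integral_nonneg (gradSq_nonneg U)
  have hN := Real.rpow_nonneg (lpDist_nonneg ρbar p r) β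
  have hGn : 1 + ∫ x, gradSq U x ≤ n := le_mul_of_one_le_left (by linarith) (by linarith)
  have hn0 : 0 ≤ n := by positivity
  have e1 : ∫ x, η x ^ 2 * potentialEnergy γ ρbar (r x)
      ≤ ∫ x, η x ^ 2 * energyDensity γ ρbar r U x := by
    refine integral_mono iP iE fun x => mul_le_mul_of_nonneg_left ?_ (sq_nonneg _)
    have := mul_nonneg (hr0 x) (sq_nonneg ‖U x‖)
    unfold energyDensity; linarith
  have e2 : ∫ x, η x ^ 2 * (r x * ‖U x‖ ^ 2)
      ≤ 2 * ∫ x, η x ^ 2 * energyDensity γ ρbar r U x := by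
    rw [← integral_const_mul]
    refine integral_mono iK (iE.const_mul 2) fun x => ?_
    have := mul_nonneg (sq_nonneg (η x)) (hP0 x)
    change η x ^ 2 * (r x * ‖U x‖ ^ 2) ≤ 2 * (η x ^ 2 * energyDensity γ ρbar r U x)
    unfold energyDensity; linarith
  have e3 : μ * ∫ x, η x ^ 2 * gradSq U x ≤ ∫ x, η x ^ 2 * dissipationDensity μ β r U x := by
    rw [← integral_const_mul]
    refine integral_mono (iG.const_mul μ) iD fun x => ?_
    have hlam : 0 ≤ bulkViscosity β (r x) := Real.rpow_nonneg (hr0 x) _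
    have : 0 ≤ η x ^ 2 * ((μ + bulkViscosity β (r x)) * divergence U x ^ 2) := by positivity
    change μ * (η x ^ 2 * gradSq U x) ≤ η x ^ 2 * dissipationDensity μ β r U x
    unfold dissipationDensity; linarith
  have hE0 : 0 ≤ ∫ x, η x ^ 2 * energyDensity γ ρbar r U x := integral_nonneg fun x =>
    mul_nonneg (sq_nonneg _) (energyDensity_nonneg hγ hρ U (hr0 x))
  set Y := ∫ x, η x ^ 2 * energyDensity γ ρbar r U x
  set X := ∫ x, η x * (r x * ‖U x‖ ^ 3)
  have hX2 : L * X ≤ 1 / 4 * (∫ x, η x ^ 2 * dissipationDensity μ β r U x)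
      + L * F * (2 * Y + n) := by
    have h1 := mul_le_mul_of_nonneg_left hX hL.le
    have h2 : L * (μ / (4 * L) * ∫ x, η x ^ 2 * gradSq U x)
        = 1 / 4 * (μ * ∫ x, η x ^ 2 * gradSq U x) := by field_simp
    have h3 := mul_le_mul_of_nonneg_left e2 (mul_nonneg hL.le hF.le)
    linarith
  have hA' : ∫ x, ‖U x‖ ^ 2 ≤ A * n := hm'.trans (by gcongr)
  have h6 := mul_le_mul_of_nonneg_left (add_le_add (add_le_add hA' hp1) hv1) hc0.le
  have h7 : 0 ≤ c * (A + B + D) * Y := by positivity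
  have h8 : 0 ≤ L * F * n := by positivity
  linarith

/-- Quantitative smallness of the error for weights with small gradient, with a constant that may
depend on all bounds of the state. -/
theorem exists_integral_weightError_le_qualitative (hμ : 0 < μ) (hβ : 0 < β) (hγ : 1 < γ)
    (hρ : 0 < ρbar) (R K₁ K₂ : ℝ) (hR : 0 ≤ R) :
    ∃ K : ℝ, ∀ r U, FiniteEnergyState γ ρbar r U → (∀ x, r x ≤ R) →
      (∫ x, ‖U x‖ ^ 2) + ∫ x, gradSq U x ≤ K₁ → ∫ x, potentialEnergy γ ρbar (r x) ≤ K₂ →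
      ∀ η : Plane → ℝ, ContDiff ℝ 1 η → HasCompactSupport η → (∀ x, 0 ≤ η x) → (∀ x, η x ≤ 1) →
      ∀ L, (∀ x, ‖fderiv ℝ η x‖ ≤ L) → ∫ x, weightError μ β γ ρbar η r U x ≤ L * K := by
  obtain ⟨Cq, hCq, hq⟩ := exists_pressure_sub_sq_le hγ hρ
  obtain ⟨S, hS, hsob⟩ := integral_norm_pow_le_pow 1
  obtain ⟨M, hM⟩ : ∃ M, ∀ y ∈ Icc 0 R, potentialEnergy γ ρbar y ≤ M := by
    obtain ⟨M, hM⟩ := (isCompact_Icc (a := (0 : ℝ)) (b := R)).bddAbove_image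
      (continuous_potentialEnergy (ρbar := ρbar) hγ).continuousOn
    exact ⟨M, fun y hy => hM ⟨y, hy, rfl⟩⟩
  have hM0 : 0 ≤ M := (potentialEnergy_nonneg hγ hρ le_rfl).trans (hM 0 ⟨le_rfl, hR⟩)
  set Λ := R ^ β
  have hΛ0 : 0 ≤ Λ := by positivity
  set a := R + 2 * M + 2 + 2 * μ + 2 * (μ + Λ)
  have ha : 0 ≤ a := by positivity
  set b := 2 + 2 * Cq * (1 + M)
  have hb : 0 ≤ b := by positivity
  set d := 2 * μ + 4 * (μ + Λ)
  have hd : 0 ≤ d := by positivity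
  refine ⟨a * K₁ + R * (S * K₁ ^ 2) + b * K₂ + d * K₁,
    fun r U h hrR hK1 hK2 η hη hηs hη0 hη1 L hL => ?_⟩
  have hL0 : 0 ≤ L := (norm_nonneg _).trans (hL 0)
  have hU := h.contDiff
  have hr0 := h.nonneg
  have hP0 : ∀ x, 0 ≤ potentialEnergy γ ρbar (r x) := fun x => potentialEnergy_nonneg hγ hρ (hr0 x)
  obtain ⟨i4, h4⟩ := hsob U hU h.integrable_sq h.integrable_gradSq
  simp only [mul_one, Nat.reduceAdd] at i4 h4
  have iW : Integrable (weightError μ β γ ρbar η r U) := by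
    refine (continuous_weightError hβ hγ hη h.continuous hU).integrable_of_hasCompactSupport ?_
    refine hηs.mono fun x hx => ?_
    contrapose! hx
    simp only [Function.mem_support, not_not] at hx ⊢
    simp [weightError, hx]
  have j1 : Integrable fun x => a * ‖U x‖ ^ 2 := h.integrable_sq.const_mul _
  have j2 : Integrable fun x => R * ‖U x‖ ^ 4 := i4.const_mul _
  have j3 : Integrable fun x => b * potentialEnergy γ ρbar (r x) :=
    h.integrable_potential.const_mul _
  have j4 : Integrable fun x => d * gradSq U x := h.integrable_gradSq.const_mul _
  have hW := integral_mono iW ((((j1.add j2).add j3).add j4).const_mul L) fun x =>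
    (le_abs_self _).trans (abs_weightError_le (β := β) (U := U) (Λ := Λ) (M := M) (R := R) hμ
      (hη0 x) (hη1 x) (hr0 x) (hP0 x)
      hCq.le (hL x) (hrR x) (Real.rpow_le_rpow (hr0 x) (hrR x) hβ.le) (hM _ ⟨hr0 x, hrR x⟩)
      (hq _ (hr0 x)))
  simp only [Pi.add_apply] at hW
  rw [integral_const_mul, integral_add_four j1 j2 j3 j4, integral_const_mul, integral_const_mul, integral_const_mul,
    integral_const_mul] at hW
  refine hW.trans ?_
  have hU0 : 0 ≤ ∫ x, ‖U x‖ ^ 2 := integral_nonneg fun x => sq_nonneg _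
  have hgs : 0 ≤ ∫ x, gradSq U x := integral_nonneg (gradSq_nonneg U)
  have h5 : S * ((∫ x, ‖U x‖ ^ 2) + ∫ x, gradSq U x) ^ 2 ≤ S * K₁ ^ 2 := by gcongr
  gcongr
  · linarith
  · exact h4.trans h5
  · linarith

end Integrated

/-! ### The local energy identity -/

/-- The derivative of the potential energy. -/
noncomputable def potentialDeriv (γ ρbar r : ℝ) : ℝ :=
  1 / (γ - 1) * (γ * r ^ (γ - 1) - γ * ρbar ^ (γ - 1))

theorem hasDerivAt_potentialEnergy {γ : ℝ} (hγ : 1 < γ) (ρbar r : ℝ) :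
    HasDerivAt (potentialEnergy γ ρbar) (potentialDeriv γ ρbar r) r := by
  have h1 := Real.hasDerivAt_rpow_const (x := r) (p := γ) (Or.inr hγ.le)
  have h2 := (((h1.sub_const (ρbar ^ γ)).sub
    (((hasDerivAt_id r).sub_const ρbar).const_mul (γ * ρbar ^ (γ - 1)))).const_mul (1 / (γ - 1)))
  exact h2.congr_deriv (by simp [potentialDeriv])

theorem continuous_potentialDeriv {γ : ℝ} (hγ : 1 < γ) (ρbar : ℝ) :
    Continuous (potentialDeriv γ ρbar) := by
  have : Continuous fun r : ℝ => r ^ (γ - 1) := Real.continuous_rpow_const (by linarith)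
  unfold potentialDeriv
  fun_prop

theorem contDiff_potentialEnergy {γ : ℝ} (hγ : 1 < γ) (ρbar : ℝ) :
    ContDiff ℝ 1 (potentialEnergy γ ρbar) := by
  rw [contDiff_one_iff_deriv]
  refine ⟨fun r => (hasDerivAt_potentialEnergy hγ ρbar r).differentiableAt, ?_⟩
  have : deriv (potentialEnergy γ ρbar) = potentialDeriv γ ρbar :=
    funext fun r => (hasDerivAt_potentialEnergy hγ ρbar r).deriv
  rw [this]
  exact continuous_potentialDeriv hγ ρbar

/-- This relation explains why the flux contains P(ρ) - P(ρbar): subtracting the constant does not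
change the pressure gradient, and the difference is controlled by Ψ. -/
theorem mul_potentialDeriv {γ ρbar : ℝ} (hγ : 1 < γ) (hρ : 0 < ρbar) {r : ℝ} (hr : 0 ≤ r) :
    r * potentialDeriv γ ρbar r = potentialEnergy γ ρbar r + (r ^ γ - ρbar ^ γ) := by
  have h1 : ρbar ^ (γ - 1) * ρbar = ρbar ^ γ := by
    rw [Real.rpow_sub_one hρ.ne']; field_simp
  have h2 : r * r ^ (γ - 1) = r ^ γ := by
    rw [mul_comm, ← Real.rpow_add_one' hr (by linarith), sub_add_cancel]
  have h3 : γ - 1 ≠ 0 := by linarith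
  unfold potentialDeriv potentialEnergy
  rw [← h1, ← h2]
  field_simp
  ring

/-- The components of the energy flux. -/
noncomputable def energyFlux (μ γ ρbar : ℝ) (r : Plane → ℝ) (U : Plane → Plane) (F : Plane → ℝ)
    (j : Fin 2) (x : Plane) : ℝ :=
  (1 / 2 * (r x * (U x 0 * U x 0 + U x 1 * U x 1)) + potentialEnergy γ ρbar (r x)
      + (r x ^ γ - ρbar ^ γ)) * U x j
    - μ * (U x 0 * pderiv j U x 0 + U x 1 * pderiv j U x 1) - F x * U x j

theorem contDiff_pderiv_apply {U : Plane → Plane} (hU : ContDiff ℝ 2 U) (i j : Fin 2) :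
    ContDiff ℝ 1 fun x => pderiv j U x i := by
  have h : ContDiff ℝ 1 (fderiv ℝ U) := hU.fderiv_right (by norm_num)
  exact differentiable_apply (h.clm_apply contDiff_const) i

theorem contDiff_energyFlux {μ γ ρbar : ℝ} (hγ : 1 < γ) {r : Plane → ℝ} {U : Plane → Plane}
    {F : Plane → ℝ} (hr : ContDiff ℝ 1 r) (hU : ContDiff ℝ 2 U) (hF : ContDiff ℝ 1 F)
    (j : Fin 2) : ContDiff ℝ 1 (energyFlux μ γ ρbar r U F j) := by
  have hU1 : ∀ i, ContDiff ℝ 1 fun x => U x i := differentiable_apply (hU.of_le (by norm_num))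
  have hd := fun i => contDiff_pderiv_apply hU i j
  have hP : ContDiff ℝ 1 fun x => potentialEnergy γ ρbar (r x) :=
    (contDiff_potentialEnergy hγ ρbar).comp hr
  have hp : ContDiff ℝ 1 fun x => r x ^ γ :=
    (Real.contDiff_rpow_const_of_le (n := 1) (by exact_mod_cast hγ.le)).comp hr
  unfold energyFlux
  exact (((((contDiff_const.mul (hr.mul (((hU1 0).mul (hU1 0)).add ((hU1 1).mul (hU1 1))))).add
    hP).add (hp.sub contDiff_const)).mul (hU1 j)).sub
    (contDiff_const.mul (((hU1 0).mul (hd 0)).add ((hU1 1).mul (hd 1))))).sub (hF.mul (hU1 j))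

theorem pderiv_energyFlux {μ γ ρbar : ℝ} (hγ : 1 < γ) {r : Plane → ℝ} {U : Plane → Plane}
    {F : Plane → ℝ} {x : Plane} (hr : DifferentiableAt ℝ r x) (hU : ContDiff ℝ 2 U)
    (hF : DifferentiableAt ℝ F x) (j : Fin 2) :
    pderiv j (energyFlux μ γ ρbar r U F j) x =
      (1 / 2 * (pderiv j r x * (U x 0 * U x 0 + U x 1 * U x 1)
          + r x * (2 * (U x 0 * pderiv j U x 0 + U x 1 * pderiv j U x 1)))
        + potentialDeriv γ ρbar (r x) * pderiv j r x + γ * r x ^ (γ - 1) * pderiv j r x) * U x j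
      + (1 / 2 * (r x * (U x 0 * U x 0 + U x 1 * U x 1)) + potentialEnergy γ ρbar (r x)
          + (r x ^ γ - ρbar ^ γ)) * pderiv j U x j
      - μ * (pderiv j U x 0 * pderiv j U x 0 + U x 0 * pderiv j (fun y => pderiv j U y 0) x
          + pderiv j U x 1 * pderiv j U x 1 + U x 1 * pderiv j (fun y => pderiv j U y 1) x)
      - (pderiv j F x * U x j + F x * pderiv j U x j) := by
  have hU1 := hU.of_le (show (1 : WithTop ℕ∞) ≤ 2 by norm_num)
  have hUd := hU1.differentiable one_ne_zero x
  have hr' := hr.hasFDerivAt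
  have hF' := hF.hasFDerivAt
  have hUi : ∀ i, HasFDerivAt (fun y => U y i) (fderiv ℝ (fun y => U y i) x) x := fun i =>
    ((differentiable_apply hU1 i).differentiable one_ne_zero x).hasFDerivAt
  have hd : ∀ i, HasFDerivAt (fun y => pderiv j U y i) (fderiv ℝ (fun y => pderiv j U y i) x) x :=
    fun i => ((contDiff_pderiv_apply hU i j).differentiable one_ne_zero x).hasFDerivAt
  have hP := (hasDerivAt_potentialEnergy hγ ρbar (r x)).comp_hasFDerivAt x hr'
  have hp := (Real.hasDerivAt_rpow_const (x := r x) (p := γ) (Or.inr hγ.le)).comp_hasFDerivAt x hr'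
  have hmain := ((((((hr'.fun_mul (((hUi 0).fun_mul (hUi 0)).fun_add
    ((hUi 1).fun_mul (hUi 1)))).const_mul (1 / 2)).fun_add hP).fun_add
    (hp.sub_const (ρbar ^ γ))).fun_mul (hUi j)).fun_sub
    ((((hUi 0).fun_mul (hd 0)).fun_add ((hUi 1).fun_mul (hd 1))).const_mul μ)).fun_sub
    (hF'.fun_mul (hUi j))
  have e : ∀ i, fderiv ℝ (fun y => U y i) x (EuclideanSpace.single j 1) = pderiv j U x i :=
    fun i => (pderiv_apply hUd i j).symm
  have h1 : pderiv j (energyFlux μ γ ρbar r U F j) x = _ :=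
    congrArg (fun l : Plane →L[ℝ] ℝ => l (EuclideanSpace.single j 1)) hmain.fderiv
  rw [h1]
  simp only [add_apply, sub_apply, smul_apply, smul_eq_mul, e, Function.comp_apply]
  unfold pderiv
  ring

theorem gradient_apply {f : Plane → ℝ} {x : Plane} (i : Fin 2) :
    gradient f x i = pderiv i f x := by
  have h : inner ℝ (gradient f x) (EuclideanSpace.single i (1 : ℝ)) = pderiv i f x := by
    unfold gradient pderiv
    rw [InnerProductSpace.toDual_symm_apply]
  rw [← h, EuclideanSpace.inner_single_right]
  simp

theorem laplacian_apply {U : Plane → Plane} (hU : ContDiff ℝ 2 U) (x : Plane) (i : Fin 2) :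
    (Δ U) x i = ∑ j, pderiv j (fun y => pderiv j U y i) x := by
  rw [InnerProductSpace.laplacian_eq_iteratedFDeriv_orthonormalBasis U
    (EuclideanSpace.basisFun (Fin 2) ℝ)]
  have hd : DifferentiableAt ℝ (fderiv ℝ U) x :=
    (hU.fderiv_right (m := 1) (by norm_num)).differentiable one_ne_zero x
  simp only [iteratedFDeriv_two_apply, Matrix.cons_val_zero, Matrix.cons_val_one,
    EuclideanSpace.basisFun_apply, Fin.sum_univ_two]
  have key : ∀ j, (fderiv ℝ (fderiv ℝ U) x (EuclideanSpace.single j 1)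
      (EuclideanSpace.single j 1)) i = pderiv j (fun y => pderiv j U y i) x := by
    intro j
    have h1 : HasFDerivAt (fun y => pderiv j U y i) _ x :=
      (EuclideanSpace.proj i : Plane →L[ℝ] ℝ).hasFDerivAt.comp x
        (hd.hasFDerivAt.clm_apply (hasFDerivAt_const (EuclideanSpace.single j (1 : ℝ)) x))
    change _ = fderiv ℝ (fun y => pderiv j U y i) x (EuclideanSpace.single j 1)
    rw [h1.fderiv]
    simp
  rw [← key 0, ← key 1]
  simp

section Solution

variable {μ β γ ρbar T : ℝ} {ρ : ℝ → Plane → ℝ} {u : ℝ → Plane → Plane}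

/-- The time derivative of the energy density. -/
noncomputable def energyRate (γ ρbar : ℝ) (ρ : ℝ → Plane → ℝ) (u : ℝ → Plane → Plane) (t : ℝ)
    (x : Plane) : ℝ :=
  1 / 2 * (deriv (fun s => ρ s x) t * (u t x 0 ^ 2 + u t x 1 ^ 2))
    + ρ t x * (u t x 0 * deriv (fun s => u s x) t 0 + u t x 1 * deriv (fun s => u s x) t 1)
    + potentialDeriv γ ρbar (ρ t x) * deriv (fun s => ρ s x) t

/-- The viscous flux F = (μ+λ)div u is differentiated as a single function: for β < 1 the factor
λ(ρ) need not be differentiable at vacuum, whereas F is C¹ by assumption. -/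
theorem energyRate_eq (hγ : 1 < γ) (hρ : 0 < ρbar) {t : ℝ} {x : Plane} (hr0 : 0 ≤ ρ t x)
    (hrt : DifferentiableAt ℝ (fun s => ρ s x) t) (hut : DifferentiableAt ℝ (fun s => u s x) t)
    (hr : DifferentiableAt ℝ (ρ t) x) (hU : ContDiff ℝ 2 (u t))
    (hF : ContDiff ℝ 1 (fun x => (μ + bulkViscosity β (ρ t x)) * divergence (u t) x))
    (hcont : deriv (fun s => ρ s x) t + divergence (fun y => ρ t y • u t y) x = 0)
    (hmom : deriv (fun s => ρ s x • u s x) t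
        + ∑ j, pderiv j (fun y => (ρ t y * u t y j) • u t y) x
        + gradient (fun y => pressure γ (ρ t y)) x
      = μ • (Δ (u t)) x
        + gradient (fun y => (μ + bulkViscosity β (ρ t y)) * divergence (u t) y) x) :
    energyRate γ ρbar ρ u t x =
      -(∑ j, pderiv j (energyFlux μ γ ρbar (ρ t) (u t)
          (fun x => (μ + bulkViscosity β (ρ t x)) * divergence (u t) x) j) x)
        - dissipationDensity μ β (ρ t) (u t) x := by
  set F := fun x => (μ + bulkViscosity β (ρ t x)) * divergence (u t) x with hFdef
  have hU1 := hU.of_le (show (1 : WithTop ℕ∞) ≤ 2 by norm_num)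
  have hUd := hU1.differentiable one_ne_zero x
  have e : ∀ i j, fderiv ℝ (fun y => u t y i) x (EuclideanSpace.single j 1)
    = pderiv j (u t) x i := fun i j => (pderiv_apply hUd i j).symm
  have hUi : ∀ i, DifferentiableAt ℝ (fun y => u t y i) x := fun i =>
    (differentiable_apply hU1 i).differentiable one_ne_zero x
  have hdiv : divergence (fun y => ρ t y • u t y) x
      = ∑ i, (ρ t x * pderiv i (u t) x i + pderiv i (ρ t) x * u t x i) := by
    unfold divergence pderiv
    rw [fderiv_fun_smul hr hUd]
    simp
  have hconv : ∀ i j, pderiv j (fun y => (ρ t y * u t y j) • u t y) x i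
      = ρ t x * u t x j * pderiv j (u t) x i
        + (ρ t x * pderiv j (u t) x j + u t x j * pderiv j (ρ t) x) * u t x i := by
    intro i j
    unfold pderiv
    rw [fderiv_fun_smul (hr.fun_mul (hUi j)) hUd, fderiv_fun_mul hr (hUi j)]
    simp [e]
    exact Or.inl (Or.inl rfl)
  have hpr : ∀ i, pderiv i (fun y => pressure γ (ρ t y)) x
      = γ * ρ t x ^ (γ - 1) * pderiv i (ρ t) x := by
    intro i
    have := ((Real.hasDerivAt_rpow_const (x := ρ t x) (p := γ) (Or.inr hγ.le)).comp_hasFDerivAt x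
      hr.hasFDerivAt).fderiv
    unfold pderiv
    exact (congrArg (fun l : Plane →L[ℝ] ℝ => l (EuclideanSpace.single i 1)) this).trans (by simp)
  have htime : ∀ i, deriv (fun s => ρ s x • u s x) t i
      = ρ t x * deriv (fun s => u s x) t i + deriv (fun s => ρ s x) t * u t x i := by
    intro i
    rw [deriv_fun_smul hrt hut]
    simp
  have hm : ∀ i, deriv (fun s => ρ s x • u s x) t i
        + ∑ j, pderiv j (fun y => (ρ t y * u t y j) • u t y) x i
        + pderiv i (fun y => pressure γ (ρ t y)) x
      = μ * (∑ j, pderiv j (fun y => pderiv j (u t) y i) x) + pderiv i F x := by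
    intro i
    have := congrArg (fun v : Plane => v i) hmom
    simpa only [PiLp.add_apply, PiLp.smul_apply, WithLp.ofLp_sum, Finset.sum_apply,
      gradient_apply, laplacian_apply hU, smul_eq_mul] using this
  have m0 := hm 0
  have m1 := hm 1
  simp only [htime, hconv, hpr, Fin.sum_univ_two] at m0 m1
  rw [hdiv, Fin.sum_univ_two] at hcont
  have hΨ := mul_potentialDeriv hγ hρ hr0
  have hFx : F x = (μ + bulkViscosity β (ρ t x)) * (pderiv 0 (u t) x 0 + pderiv 1 (u t) x 1) := by
    rw [hFdef]; simp only [divergence, Fin.sum_univ_two]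
  have hFd := hF.differentiable one_ne_zero x
  rw [Fin.sum_univ_two, pderiv_energyFlux hγ hr hU hFd, pderiv_energyFlux hγ hr hU hFd]
  unfold energyRate dissipationDensity gradSq divergence
  simp only [Fin.sum_univ_two]
  -- Momentum dotted with u, plus continuity times Ψ'(ρ) - |u|²/2 (the second part turns the
  -- conservative momentum equation into one for the kinetic energy). The last two terms substitute
  -- ρΨ' = Ψ + P - P(ρbar) and the definition of F.
  linear_combination u t x 0 * m0 + u t x 1 * m1
    + (potentialDeriv γ ρbar (ρ t x) - 1 / 2 * (u t x 0 ^ 2 + u t x 1 ^ 2)) * hcont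
    - (pderiv 0 (u t) x 0 + pderiv 1 (u t) x 1) * hΨ
    - (pderiv 0 (u t) x 0 + pderiv 1 (u t) x 1) * hFx

theorem integral_weight_mul_pderiv {η W : Plane → ℝ} (hη : ContDiff ℝ 1 η)
    (hηs : HasCompactSupport η) (hW : ContDiff ℝ 1 W) (j : Fin 2) :
    ∫ x, η x ^ 2 * pderiv j W x = -∫ x, 2 * η x * pderiv j η x * W x := by
  have hη2 : ContDiff ℝ 1 fun x => η x ^ 2 := hη.pow 2
  have hs2 : HasCompactSupport fun x => η x ^ 2 :=
    hηs.comp_left (g := fun y : ℝ => y ^ 2) (by simp)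
  have hd : ∀ x, fderiv ℝ (fun x => η x ^ 2) x (EuclideanSpace.single j 1)
      = 2 * η x * pderiv j η x := fun x => by
    have := ((hη.differentiable one_ne_zero x).hasFDerivAt.pow 2).fderiv
    rw [this]
    simp [pderiv]
  have h := integral_mul_fderiv_eq_neg_fderiv_mul_of_integrable (μ := (volume : Measure Plane))
    (f := fun x => η x ^ 2) (g := W) (v := EuclideanSpace.single j 1)
    (((continuous_pderiv hη2 j).mul hW.continuous).integrable_of_hasCompactSupport
      ((hs2.fderiv_apply (𝕜 := ℝ) _).mul_right))
    ((hη2.continuous.mul (continuous_pderiv hW j)).integrable_of_hasCompactSupport hs2.mul_right)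
    ((hη2.continuous.mul hW.continuous).integrable_of_hasCompactSupport hs2.mul_right)
    (fun x _ => hη2.differentiable one_ne_zero x) (fun x _ => hW.differentiable one_ne_zero x)
  simp only [hd] at h
  exact h

/-- Identifies the error as ∇(η²) paired with the energy flux, which is what integration by parts
leaves. -/
theorem weightError_eq_sum (η : Plane → ℝ) (r : Plane → ℝ) (U : Plane → Plane) (x : Plane) :
    weightError μ β γ ρbar η r U x = ∑ j, 2 * η x * pderiv j η x *
      energyFlux μ γ ρbar r U (fun x => (μ + bulkViscosity β (r x)) * divergence U x) j x := by
  have e : fderiv ℝ η x (U x) = U x 0 * pderiv 0 η x + U x 1 * pderiv 1 η x := clm_apply_eq _ _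
  unfold weightError energyFlux
  rw [e, norm_sq_eq]
  simp only [Fin.sum_univ_two]
  ring

end Solution

/-! ### The weighted energy identity for solutions -/

/-- Differentiation under the integral sign for a compactly supported weight. -/
theorem hasDerivAt_integral_weight_mul {a b t : ℝ} (ht : t ∈ Ioo a b) {w : Plane → ℝ}
    (hw : Continuous w) (hws : HasCompactSupport w) {e e' : ℝ → Plane → ℝ}
    (hd : ∀ s ∈ Ioo a b, ∀ x, HasDerivAt (fun s => e s x) (e' s x) s)
    (hc : ∀ s ∈ Ioo a b, Continuous (e s))
    (hc' : ContinuousOn (fun p : ℝ × Plane => e' p.1 p.2) (Ioo a b ×ˢ univ)) :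
    HasDerivAt (fun s => ∫ x, w x * e s x) (∫ x, w x * e' t x) t := by
  obtain ⟨δ, hδ, hball⟩ := Metric.nhds_basis_closedBall.mem_iff.1 (isOpen_Ioo.mem_nhds ht)
  have hslice : ∀ s ∈ Ioo a b, Continuous (e' s) := fun s hs =>
    (hc'.comp_continuous (f := fun x : Plane => ((s, x) : ℝ × Plane)) (by fun_prop)
      fun x => ⟨hs, mem_univ _⟩)
  -- The rate is continuous on a compact time interval times the support of w, hence bounded there;
  -- |w| times this bound is the dominating function.
  obtain ⟨M, hM⟩ := ((isCompact_closedBall t δ).prod hws.isCompact).exists_bound_of_continuousOn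
    (hc'.mono (prod_mono hball (subset_univ _)))
  have hbound : ∀ x, ∀ s ∈ Metric.closedBall t δ, ‖w x * e' s x‖ ≤ |w x| * M := by
    intro x s hs
    rw [norm_mul, Real.norm_eq_abs]
    by_cases hx : x ∈ tsupport w
    · exact mul_le_mul_of_nonneg_left (hM (s, x) ⟨hs, hx⟩) (abs_nonneg _)
    · simp [image_eq_zero_of_notMem_tsupport hx]
  have habs : Integrable fun x => |w x| * M :=
    (hw.integrable_of_hasCompactSupport hws).abs.mul_const M
  refine (hasDerivAt_integral_of_dominated_loc_of_deriv_le (F := fun s x => w x * e s x)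
    (F' := fun s x => w x * e' s x) (bound := fun x => |w x| * M)
    (Metric.closedBall_mem_nhds t hδ) ?_ ?_ ?_
    (Eventually.of_forall hbound) habs (Eventually.of_forall fun x s hs => ?_)).2
  · filter_upwards [isOpen_Ioo.mem_nhds ht] with s hs
    exact (hw.mul (hc s hs)).aestronglyMeasurable
  · exact (hw.mul (hc t ht)).integrable_of_hasCompactSupport hws.mul_right
  · exact (hw.mul (hslice t ht)).aestronglyMeasurable
  · exact (hd s (hball hs) x).const_mul (w x)

theorem integral_le_of_lintegral_le {X : Type*} [MeasurableSpace X] {ν : Measure X} {f : X → ℝ}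
    (hf : Integrable f ν) (hf0 : ∀ x, 0 ≤ f x) {K : ℝ≥0}
    (h : ∫⁻ x, ENNReal.ofReal (f x) ∂ν ≤ K) : ∫ x, f x ∂ν ≤ K := by
  rw [← ofReal_integral_eq_lintegral_ofReal hf (Eventually.of_forall hf0),
    ← ENNReal.ofReal_coe_nnreal] at h
  exact (ENNReal.ofReal_le_ofReal_iff K.coe_nonneg).1 h

section Solution

variable {μ β γ ρbar T : ℝ} {ρ : ℝ → Plane → ℝ} {u : ℝ → Plane → Plane}

theorem isOpen_slab (T : ℝ) : IsOpen (Ioo 0 T ×ˢ (univ : Set Plane)) := isOpen_Ioo.prod isOpen_univ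

theorem continuous_slice {F : Type*} [TopologicalSpace F] {s : Set ℝ} {f : ℝ → Plane → F}
    (hf : ContinuousOn (fun p : ℝ × Plane => f p.1 p.2) (s ×ˢ univ)) {t : ℝ} (ht : t ∈ s) :
    Continuous (f t) :=
  hf.comp_continuous (f := fun x : Plane => ((t, x) : ℝ × Plane)) (by fun_prop)
    fun _ => ⟨ht, mem_univ _⟩

section Slab

variable {F : Type*} [NormedAddCommGroup F] [NormedSpace ℝ F] {f : ℝ → Plane → F}

theorem hasDerivAt_time (hf : ContDiffOn ℝ 1 (fun p : ℝ × Plane => f p.1 p.2) (Ioo 0 T ×ˢ univ))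
    {t : ℝ} (ht : t ∈ Ioo 0 T) (x : Plane) :
    HasDerivAt (fun s => f s x)
      (fderiv ℝ (fun p : ℝ × Plane => f p.1 p.2) (t, x) ((1 : ℝ), (0 : Plane))) t := by
  have h1 := ((hf.contDiffAt ((isOpen_slab T).mem_nhds
    (⟨ht, mem_univ _⟩ : (t, x) ∈ Ioo 0 T ×ˢ (univ : Set Plane)))).differentiableAt
    one_ne_zero).hasFDerivAt
  exact h1.comp_hasDerivAt t ((hasDerivAt_id t).prodMk (hasDerivAt_const t x))

theorem hasFDerivAt_space
    (hf : ContDiffOn ℝ 1 (fun p : ℝ × Plane => f p.1 p.2) (Ioo 0 T ×ˢ univ))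
    {t : ℝ} (ht : t ∈ Ioo 0 T) (x : Plane) :
    HasFDerivAt (f t)
      ((fderiv ℝ (fun p : ℝ × Plane => f p.1 p.2) (t, x)).comp
        (ContinuousLinearMap.inr ℝ ℝ Plane)) x := by
  have h1 := ((hf.contDiffAt ((isOpen_slab T).mem_nhds
    (⟨ht, mem_univ _⟩ : (t, x) ∈ Ioo 0 T ×ˢ (univ : Set Plane)))).differentiableAt
    one_ne_zero).hasFDerivAt
  exact h1.comp x (hasFDerivAt_prodMk_right t x)

theorem contDiff_space
    (hf : ContDiffOn ℝ 1 (fun p : ℝ × Plane => f p.1 p.2) (Ioo 0 T ×ˢ univ))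
    {t : ℝ} (ht : t ∈ Ioo 0 T) : ContDiff ℝ 1 (f t) := by
  rw [← contDiffOn_univ]
  exact hf.comp (f := fun x : Plane => ((t, x) : ℝ × Plane))
    (contDiff_const.prodMk contDiff_id).contDiffOn fun x _ => ⟨ht, mem_univ _⟩

theorem continuousOn_deriv_time
    (hf : ContDiffOn ℝ 1 (fun p : ℝ × Plane => f p.1 p.2) (Ioo 0 T ×ˢ univ)) :
    ContinuousOn (fun p : ℝ × Plane => deriv (fun s => f s p.2) p.1) (Ioo 0 T ×ˢ univ) :=
  ((hf.continuousOn_fderiv_of_isOpen (isOpen_slab T) le_rfl).clm_apply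
    (continuousOn_const (c := ((1 : ℝ), (0 : Plane))))).congr
      fun p hp => (hasDerivAt_time hf hp.1 p.2).deriv

theorem continuousOn_pderiv_space
    (hf : ContDiffOn ℝ 1 (fun p : ℝ × Plane => f p.1 p.2) (Ioo 0 T ×ˢ univ)) (j : Fin 2) :
    ContinuousOn (fun p : ℝ × Plane => pderiv j (f p.1) p.2) (Ioo 0 T ×ˢ univ) :=
  ((hf.continuousOn_fderiv_of_isOpen (isOpen_slab T) le_rfl).clm_apply
    (continuousOn_const (c := ((0 : ℝ), EuclideanSpace.single j (1 : ℝ))))).congr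
      fun p hp => by
        unfold pderiv
        rw [(hasFDerivAt_space hf hp.1 p.2).fderiv]
        rfl

end Slab

theorem continuousOn_component {f : ℝ × Plane → Plane} {s : Set (ℝ × Plane)}
    (hf : ContinuousOn f s) (i : Fin 2) : ContinuousOn (fun p => f p i) s :=
  (EuclideanSpace.proj i : Plane →L[ℝ] ℝ).continuous.comp_continuousOn hf

theorem continuousOn_gradSq (hs : IsSmoothSolution μ β γ ρbar T ρ u) :
    ContinuousOn (fun p : ℝ × Plane => gradSq (u p.1) p.2) (Ioo 0 T ×ˢ univ) :=
  continuousOn_finsetSum _ fun i _ => continuousOn_finsetSum _ fun j _ =>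
    (continuousOn_component (continuousOn_pderiv_space hs.velocity_contDiff j) i).pow 2

theorem continuousOn_divergence (hs : IsSmoothSolution μ β γ ρbar T ρ u) :
    ContinuousOn (fun p : ℝ × Plane => divergence (u p.1) p.2) (Ioo 0 T ×ˢ univ) :=
  continuousOn_finsetSum _ fun i _ =>
    continuousOn_component (continuousOn_pderiv_space hs.velocity_contDiff i) i

theorem continuousOn_dissipationDensity (hβ : 0 < β) (hs : IsSmoothSolution μ β γ ρbar T ρ u) :
    ContinuousOn (fun p : ℝ × Plane => dissipationDensity μ β (ρ p.1) (u p.1) p.2)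
      (Ioo 0 T ×ˢ univ) := by
  have h1 : ContinuousOn (fun p : ℝ × Plane => bulkViscosity β (ρ p.1 p.2)) (Ioo 0 T ×ˢ univ) :=
    (Real.continuous_rpow_const hβ.le).comp_continuousOn hs.density_contDiff.continuousOn
  exact (continuousOn_const.mul (continuousOn_gradSq hs)).add
    ((continuousOn_const.add h1).mul ((continuousOn_divergence hs).pow 2))

theorem continuousOn_energyDensity (hγ : 1 < γ) (hs : IsSmoothSolution μ β γ ρbar T ρ u) :
    ContinuousOn (fun p : ℝ × Plane => energyDensity γ ρbar (ρ p.1) (u p.1) p.2)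
      (Icc 0 T ×ˢ univ) :=
  (continuousOn_const.mul (hs.density_continuous.mul (hs.velocity_continuous.norm.pow 2))).add
    ((continuous_potentialEnergy hγ).comp_continuousOn hs.density_continuous)

theorem continuousOn_energyRate (hγ : 1 < γ) (hs : IsSmoothSolution μ β γ ρbar T ρ u) :
    ContinuousOn (fun p : ℝ × Plane => energyRate γ ρbar ρ u p.1 p.2) (Ioo 0 T ×ˢ univ) := by
  have hr := hs.density_contDiff.continuousOn
  have hrt := continuousOn_deriv_time hs.density_contDiff
  have hu := fun i => continuousOn_component hs.velocity_contDiff.continuousOn i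
  have hut := fun i => continuousOn_component (continuousOn_deriv_time hs.velocity_contDiff) i
  have hp := (continuous_potentialDeriv hγ ρbar).comp_continuousOn hr
  unfold energyRate
  exact ((continuousOn_const.mul (hrt.mul (((hu 0).pow 2).add ((hu 1).pow 2)))).add
    (hr.mul (((hu 0).mul (hut 0)).add ((hu 1).mul (hut 1))))).add (hp.mul hrt)

theorem hasDerivAt_energyDensity (hγ : 1 < γ) (hs : IsSmoothSolution μ β γ ρbar T ρ u) {t : ℝ}
    (ht : t ∈ Ioo 0 T) (x : Plane) :
    HasDerivAt (fun s => energyDensity γ ρbar (ρ s) (u s) x) (energyRate γ ρbar ρ u t x) t := by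
  have hr := (hasDerivAt_time hs.density_contDiff ht x).differentiableAt.hasDerivAt
  have hu := (hasDerivAt_time hs.velocity_contDiff ht x).differentiableAt.hasDerivAt
  have hui : ∀ i, HasDerivAt (fun s => u s x i) (deriv (fun s => u s x) t i) t := fun i =>
    (EuclideanSpace.proj i : Plane →L[ℝ] ℝ).hasFDerivAt.comp_hasDerivAt t hu
  have hP := (hasDerivAt_potentialEnergy hγ ρbar (ρ t x)).comp t hr
  have h := ((hr.fun_mul (((hui 0).fun_pow 2).fun_add ((hui 1).fun_pow 2))).const_mul
    (1 / 2)).fun_add hP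
  have e : (fun s => energyDensity γ ρbar (ρ s) (u s) x) = fun s =>
      1 / 2 * (ρ s x * (u s x 0 ^ 2 + u s x 1 ^ 2)) + potentialEnergy γ ρbar (ρ s x) := by
    ext s; rw [energyDensity, norm_sq_eq]
  rw [e]
  refine h.congr_deriv ?_
  unfold energyRate
  ring

/-- Only interior times are available, because the H¹ bound is assumed for 0 < t < T. The endpoints
are reached later through continuity of the truncated energies on the closed interval. -/
theorem finiteEnergyState (hγ : 1 < γ) (hρ : 0 < ρbar) (hs : IsSmoothSolution μ β γ ρbar T ρ u)
    {t : ℝ} (ht : t ∈ Ioo 0 T) : FiniteEnergyState γ ρbar (ρ t) (u t) := by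
  have ht' := Ioo_subset_Icc_self ht
  have hU : ContDiff ℝ 1 (u t) := (hs.velocity_contDiff_two t ht).of_le (by norm_num)
  have hr0 := hs.density_nonneg t ht'
  have hrc : Continuous (ρ t) := continuous_slice hs.density_continuous ht'
  obtain ⟨K, hK⟩ := hs.velocity_bounded
  obtain ⟨K', hK'⟩ := hs.potential_bounded
  have hU2 : Continuous fun x => ‖u t x‖ ^ 2 := hU.continuous.norm.pow 2
  have hsum : Integrable fun x => ‖u t x‖ ^ 2 + gradSq (u t) x := by
    refine ⟨(hU2.add (continuous_gradSq hU)).aestronglyMeasurable, ?_⟩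
    rw [hasFiniteIntegral_iff_ofReal (Eventually.of_forall fun x =>
      add_nonneg (sq_nonneg _) (gradSq_nonneg _ _))]
    exact (hK t ht).trans_lt ENNReal.coe_lt_top
  refine ⟨hrc, hr0, hs.density_bounded.imp fun R hR => hR t ht', hU, ?_, ?_, ?_⟩
  · exact hsum.mono' hU2.aestronglyMeasurable (Eventually.of_forall fun x => by
      rw [Real.norm_of_nonneg (sq_nonneg _)]
      exact le_add_of_nonneg_right (gradSq_nonneg _ _))
  · exact hsum.mono' (continuous_gradSq hU).aestronglyMeasurable (Eventually.of_forall fun x => by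
      rw [Real.norm_of_nonneg (gradSq_nonneg _ _)]
      exact le_add_of_nonneg_left (sq_nonneg _))
  · refine ⟨((continuous_potentialEnergy hγ).comp hrc).aestronglyMeasurable, ?_⟩
    rw [hasFiniteIntegral_iff_ofReal (Eventually.of_forall fun x =>
      potentialEnergy_nonneg hγ hρ (hr0 x))]
    exact (hK' t ht').trans_lt ENNReal.coe_lt_top

theorem exists_uniform_bounds (hγ : 1 < γ) (hρ : 0 < ρbar)
    (hs : IsSmoothSolution μ β γ ρbar T ρ u) : ∃ K : ℝ, ∀ t ∈ Ioo 0 T,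
      (∫ x, ‖u t x‖ ^ 2) + ∫ x, gradSq (u t) x ≤ K ∧
      ∫ x, potentialEnergy γ ρbar (ρ t x) ≤ K := by
  obtain ⟨K, hK⟩ := hs.velocity_bounded
  obtain ⟨K', hK'⟩ := hs.potential_bounded
  refine ⟨(K : ℝ) + K', fun t ht => ?_⟩
  have h := finiteEnergyState hγ hρ hs ht
  have ht' := Ioo_subset_Icc_self ht
  have h1 : (∫ x, ‖u t x‖ ^ 2) + ∫ x, gradSq (u t) x ≤ K := by
    rw [← integral_add h.integrable_sq h.integrable_gradSq]
    exact integral_le_of_lintegral_le (h.integrable_sq.add h.integrable_gradSq)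
      (fun x => add_nonneg (sq_nonneg _) (gradSq_nonneg _ _)) (hK t ht)
  have h3 : ∫ x, potentialEnergy γ ρbar (ρ t x) ≤ K' :=
    integral_le_of_lintegral_le h.integrable_potential
      (fun x => potentialEnergy_nonneg hγ hρ (h.nonneg x)) (hK' t ht')
  exact ⟨h1.trans (by linarith [K'.coe_nonneg]), h3.trans (by linarith [K.coe_nonneg])⟩

/-- The weighted energy identity. -/
theorem hasDerivAt_weighted_energy (hβ : 0 < β) (hγ : 1 < γ) (hρ : 0 < ρbar)
    (hs : IsSmoothSolution μ β γ ρbar T ρ u) {η : Plane → ℝ} (hη : ContDiff ℝ 1 η)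
    (hηs : HasCompactSupport η) {t : ℝ} (ht : t ∈ Ioo 0 T) :
    HasDerivAt (fun s => ∫ x, η x ^ 2 * energyDensity γ ρbar (ρ s) (u s) x)
      ((∫ x, weightError μ β γ ρbar η (ρ t) (u t) x)
        - ∫ x, η x ^ 2 * dissipationDensity μ β (ρ t) (u t) x) t := by
  have hη2 : Continuous fun x => η x ^ 2 := hη.continuous.pow 2
  have hs2 : HasCompactSupport fun x => η x ^ 2 :=
    hηs.comp_left (g := fun y : ℝ => y ^ 2) (by simp)
  have hderiv := hasDerivAt_integral_weight_mul ht hη2 hs2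
    (fun s hst x => hasDerivAt_energyDensity hγ hs hst x)
    (fun s hst => continuous_slice
      (f := fun s x => energyDensity γ ρbar (ρ s) (u s) x) (continuousOn_energyDensity hγ hs)
      (Ioo_subset_Icc_self hst)) (continuousOn_energyRate hγ hs)
  refine hderiv.congr_deriv ?_
  have hr : ContDiff ℝ 1 (ρ t) := contDiff_space hs.density_contDiff ht
  have hU2 := hs.velocity_contDiff_two t ht
  have hU1 : ContDiff ℝ 1 (u t) := hU2.of_le (by norm_num)
  have hF := hs.viscousFlux_contDiff t ht
  have hW := contDiff_energyFlux (μ := μ) (ρbar := ρbar) hγ hr hU2 hF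
  have hrate : ∀ x, η x ^ 2 * energyRate γ ρbar ρ u t x =
      -(η x ^ 2 * pderiv 0 (energyFlux μ γ ρbar (ρ t) (u t)
          (fun x => (μ + bulkViscosity β (ρ t x)) * divergence (u t) x) 0) x
        + η x ^ 2 * pderiv 1 (energyFlux μ γ ρbar (ρ t) (u t)
          (fun x => (μ + bulkViscosity β (ρ t x)) * divergence (u t) x) 1) x)
        - η x ^ 2 * dissipationDensity μ β (ρ t) (u t) x := fun x => by
    rw [energyRate_eq (μ := μ) (β := β) hγ hρ (hs.density_nonneg t (Ioo_subset_Icc_self ht) x)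
      (hasDerivAt_time hs.density_contDiff ht x).differentiableAt
      (hasDerivAt_time hs.velocity_contDiff ht x).differentiableAt
      (hr.differentiable one_ne_zero x) hU2 hF (hs.continuity_eq t ht x) (hs.momentum_eq t ht x),
      Fin.sum_univ_two]
    ring
  have iη : ∀ g : Plane → ℝ, Continuous g → Integrable fun x => η x ^ 2 * g x := fun g hg =>
    (hη2.mul hg).integrable_of_hasCompactSupport hs2.mul_right
  have i0 := iη _ (continuous_pderiv (hW 0) 0)
  have i1 := iη _ (continuous_pderiv (hW 1) 1)
  have iD := iη _ (continuous_dissipationDensity (μ := μ) hβ hr.continuous hU1)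
  have iF : ∀ j, Integrable fun x => 2 * η x * pderiv j η x *
      energyFlux μ γ ρbar (ρ t) (u t)
        (fun x => (μ + bulkViscosity β (ρ t x)) * divergence (u t) x) j x := fun j => by
    have hc : Continuous fun x => 2 * η x * pderiv j η x *
        energyFlux μ γ ρbar (ρ t) (u t)
          (fun x => (μ + bulkViscosity β (ρ t x)) * divergence (u t) x) j x :=
      ((continuous_const.mul hη.continuous).mul (continuous_pderiv hη j)).mul (hW j).continuous
    exact hc.integrable_of_hasCompactSupport (hηs.mul_left.mul_right.mul_right)
  simp only [hrate, weightError_eq_sum, Fin.sum_univ_two]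
  have isum := i0.add i1
  rw [integral_sub (f := fun x => -(_ + _)) isum.neg iD, integral_neg, integral_add i0 i1,
    integral_weight_mul_pderiv hη hηs (hW 0), integral_weight_mul_pderiv hη hηs (hW 1),
    integral_add (iF 0) (iF 1)]
  ring

theorem continuousOn_weighted_energy (hγ : 1 < γ) (hs : IsSmoothSolution μ β γ ρbar T ρ u)
    {η : Plane → ℝ} (hη : ContDiff ℝ 1 η) (hηs : HasCompactSupport η) :
    ContinuousOn (fun s => ∫ x, η x ^ 2 * energyDensity γ ρbar (ρ s) (u s) x) (Icc 0 T) := by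
  refine continuousOn_integral_of_compact_support (k := tsupport η) hηs.isCompact ?_ ?_
  · have h1 : ContinuousOn (fun p : ℝ × Plane => η p.2 ^ 2) (Icc 0 T ×ˢ univ) :=
      ((hη.continuous.comp continuous_snd).pow 2).continuousOn
    exact h1.mul (continuousOn_energyDensity hγ hs)
  · intro p x _ hx
    simp [image_eq_zero_of_notMem_tsupport hx]

end Solution

/-! ### Grönwall's inequality and measurability in time -/

/-- A Grönwall estimate with dissipation. -/
theorem gronwall_dissipation {Y Y' D h : ℝ → ℝ} {K T t : ℝ} (hK : 0 ≤ K) (ht : 0 ≤ t) (htT : t ≤ T)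
    (hY : ContinuousOn Y (Icc 0 t)) (hY0 : ∀ s ∈ Icc 0 t, 0 ≤ Y s)
    (hd : ∀ s ∈ Ioo 0 t, HasDerivAt Y (Y' s) s) (hD0 : ∀ s ∈ Ioo 0 t, 0 ≤ D s)
    (hh0 : ∀ s ∈ Ioo 0 t, 0 ≤ h s)
    (hle : ∀ s ∈ Ioo 0 t, Y' s ≤ -(1 / 2 * D s) + K * (Y s + h s))
    (hD : IntegrableOn D (Ioo 0 t)) (hh : IntegrableOn h (Ioo 0 t)) :
    Y t + 1 / 2 * (∫ s in Ioo 0 t, D s) ≤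
      Real.exp (K * T) * (Y 0 + K * ∫ s in Ioo 0 t, h s) := by
  -- A lower bound of the integrating factor exp(-Ks) on [0,t], so that the dissipation and Y(t)
  -- keep a fixed positive coefficient.
  set c := Real.exp (-(K * T))
  have hc : 0 < c := Real.exp_pos _
  have hcE : Real.exp (K * T) * c = 1 := by
    rw [← Real.exp_add]; simp
  have hφ : IntegrableOn (fun s => -(c / 2) * D s + K * h s) (Ioo 0 t) :=
    (hD.const_mul _).add (hh.const_mul _)
  have hexp : ∀ s, HasDerivAt (fun s => Real.exp (-(K * s))) (Real.exp (-(K * s)) * -K) s :=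
    fun s => by
      have h1 : HasDerivAt (fun s : ℝ => -(K * s)) (-K) s :=
        ((hasDerivAt_id s).const_mul K).fun_neg.congr_deriv (by simp)
      exact h1.exp
  -- This one-sided form of the fundamental theorem asks only that an upper bound of the derivative
  -- be integrable; integrability of Y' itself up to the endpoints is not known.
  have hmain := intervalIntegral.sub_le_integral_of_hasDeriv_right_of_le
    (g := fun s => Real.exp (-(K * s)) * Y s)
    (g' := fun s => Real.exp (-(K * s)) * -K * Y s + Real.exp (-(K * s)) * Y' s)
    (φ := fun s => -(c / 2) * D s + K * h s) ht
    (((by fun_prop : Continuous fun s : ℝ => Real.exp (-(K * s))).continuousOn).mul hY)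
    (fun s hs => ((hexp s).mul (hd s hs)).hasDerivWithinAt)
    (by rwa [integrableOn_Icc_iff_integrableOn_Ioo]) (fun s hs => by
      have e1 : Real.exp (-(K * s)) ≤ 1 := Real.exp_le_one_iff.2 (by nlinarith [hs.1])
      have e2 : c ≤ Real.exp (-(K * s)) := Real.exp_le_exp.2 (by nlinarith [hs.2])
      have e3 := Real.exp_pos (-(K * s))
      have h1 := mul_le_mul_of_nonneg_left (hle s hs) e3.le
      have h2 := mul_le_mul_of_nonneg_right e2 (hD0 s hs)
      have h3 := mul_le_mul_of_nonneg_right e1 (mul_nonneg hK (hh0 s hs))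
      linarith)
  rw [intervalIntegral.integral_of_le ht, integral_Ioc_eq_integral_Ioo,
    integral_add (hD.const_mul _) (hh.const_mul _), integral_const_mul, integral_const_mul] at hmain
  simp only [mul_zero, neg_zero, Real.exp_zero, one_mul] at hmain
  have h4 : c * Y t ≤ Real.exp (-(K * t)) * Y t :=
    mul_le_mul_of_nonneg_right (Real.exp_le_exp.2 (by nlinarith)) (hY0 t ⟨ht, le_rfl⟩)
  have h5 : c * (Y t + 1 / 2 * ∫ s in Ioo 0 t, D s) ≤ Y 0 + K * ∫ s in Ioo 0 t, h s := by linarith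
  calc Y t + 1 / 2 * (∫ s in Ioo 0 t, D s)
      = Real.exp (K * T) * (c * (Y t + 1 / 2 * ∫ s in Ioo 0 t, D s)) := by
        rw [← mul_assoc, hcE, one_mul]
    _ ≤ _ := mul_le_mul_of_nonneg_left h5 (Real.exp_pos _).le

/-- Extending f by zero outside the open slab gives a Borel function on the product, to which
Tonelli's measurability applies. -/
theorem aemeasurable_lintegral_slice {T : ℝ} {f : ℝ → Plane → ℝ}
    (hf : ContinuousOn (fun p : ℝ × Plane => f p.1 p.2) (Ioo 0 T ×ˢ univ)) :
    AEMeasurable (fun s => ∫⁻ x, ENNReal.ofReal (f s x)) (volume.restrict (Ioo 0 T)) := by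
  classical
  have hm : Measurable ((Ioo 0 T ×ˢ (univ : Set Plane)).piecewise
      (fun p : ℝ × Plane => f p.1 p.2) fun _ => 0) :=
    hf.measurable_piecewise continuousOn_const (measurableSet_Ioo.prod MeasurableSet.univ)
  refine ⟨_, Measurable.lintegral_prod_right' (ν := (volume : Measure Plane)) hm.ennreal_ofReal, ?_⟩
  filter_upwards [ae_restrict_mem measurableSet_Ioo] with s hs
  refine lintegral_congr fun x => ?_
  have hmem : ((s, x) : ℝ × Plane) ∈ (Ioo 0 T ×ˢ univ : Set (ℝ × Plane)) := ⟨hs, mem_univ _⟩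
  rw [piecewise_eq_of_mem _ _ _ hmem]

theorem aestronglyMeasurable_integral_slice {T : ℝ} {f : ℝ → Plane → ℝ}
    (hf : ContinuousOn (fun p : ℝ × Plane => f p.1 p.2) (Ioo 0 T ×ˢ univ))
    (hf0 : ∀ s ∈ Ioo 0 T, ∀ x, 0 ≤ f s x) :
    AEStronglyMeasurable (fun s => ∫ x, f s x) (volume.restrict (Ioo 0 T)) := by
  refine AEMeasurable.aestronglyMeasurable
    ((aemeasurable_lintegral_slice hf).ennreal_toReal.congr ?_)
  filter_upwards [ae_restrict_mem measurableSet_Ioo] with s hs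
  rw [integral_eq_lintegral_of_nonneg_ae (Eventually.of_forall (hf0 s hs))
    (continuous_slice hf hs).aestronglyMeasurable]

theorem lintegral_le_liminf_of_exhaustion {X : Type*} [MeasurableSpace X] {ν : Measure X}
    {g : ℕ → X → ℝ≥0∞} {G : X → ℝ≥0∞} (hg : ∀ n, AEMeasurable (g n) ν)
    (hlim : ∀ x, ∀ᶠ n in atTop, G x ≤ g n x) :
    ∫⁻ x, G x ∂ν ≤ liminf (fun n => ∫⁻ x, g n x ∂ν) atTop :=
  (lintegral_mono fun x => le_liminf_of_le (by isBoundedDefault) (hlim x)).trans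
    (lintegral_liminf_le' hg)

/-! ### The weight and its truncations -/

section Weight

/-- The smoothed weight `(1 + |x|²)^{α/4}`, whose square is comparable to `1 + |x|^α`. -/
noncomputable def bracketWeight (α : ℝ) (x : Plane) : ℝ := (1 + ‖x‖ ^ 2) ^ (α / 4)

theorem contDiff_bracketWeight (α : ℝ) : ContDiff ℝ 1 (bracketWeight α) := by
  have h : ContDiff ℝ 1 fun x : Plane => 1 + ‖x‖ ^ 2 := contDiff_const.add (contDiff_norm_sq ℝ)
  exact h.rpow_const_of_ne fun x => by positivity

theorem bracketWeight_sq (α : ℝ) (x : Plane) :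
    bracketWeight α x ^ 2 = (1 + ‖x‖ ^ 2) ^ (α / 2) := by
  rw [bracketWeight, ← Real.rpow_natCast, ← Real.rpow_mul (by positivity)]
  congr 1; push_cast; ring

theorem norm_rpow_eq (α : ℝ) (x : Plane) : ‖x‖ ^ α = (‖x‖ ^ 2) ^ (α / 2) := by
  rw [← Real.rpow_natCast, ← Real.rpow_mul (norm_nonneg _)]
  congr 1; push_cast; ring

theorem norm_rpow_le_bracketWeight_sq {α : ℝ} (hα : 0 < α) (x : Plane) :
    ‖x‖ ^ α ≤ bracketWeight α x ^ 2 := by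
  rw [bracketWeight_sq, norm_rpow_eq]
  exact Real.rpow_le_rpow (sq_nonneg _) (by linarith) (by linarith)

theorem bracketWeight_sq_le {α : ℝ} (hα : 0 < α) (hα2 : α < 2) (x : Plane) :
    bracketWeight α x ^ 2 ≤ 1 + ‖x‖ ^ α := by
  rw [bracketWeight_sq, norm_rpow_eq]
  have := Real.rpow_add_le_add_rpow zero_le_one (sq_nonneg ‖x‖) (by linarith : 0 ≤ α / 2)
    (by linarith : α / 2 ≤ 1)
  simpa using this

theorem bracketWeight_le {α : ℝ} (hα2 : α < 2) (x : Plane) :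
    bracketWeight α x ≤ 1 + ‖x‖ := by
  have h1 : (1 : ℝ) ≤ 1 + ‖x‖ ^ 2 := by nlinarith [sq_nonneg ‖x‖]
  calc bracketWeight α x ≤ (1 + ‖x‖ ^ 2) ^ (1 / 2 : ℝ) :=
        Real.rpow_le_rpow_of_exponent_le h1 (by linarith)
    _ = √(1 + ‖x‖ ^ 2) := (Real.sqrt_eq_rpow _).symm
    _ ≤ 1 + ‖x‖ := Real.sqrt_le_iff.2 ⟨by positivity, by nlinarith [norm_nonneg x]⟩

/-- The gradient is (α/2)(1+|x|²)^{α/4-1} x, and α < 2 makes the exponent smaller than -1/2, which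
compensates the growth of |x|. -/
theorem norm_fderiv_bracketWeight_le {α : ℝ} (hα : 0 < α) (hα2 : α < 2) (x : Plane) :
    ‖fderiv ℝ (bracketWeight α) x‖ ≤ 1 := by
  have h1 : (1 : ℝ) ≤ 1 + ‖x‖ ^ 2 := by nlinarith [sq_nonneg ‖x‖]
  have hd : HasFDerivAt (bracketWeight α)
      ((α / 4 * (1 + ‖x‖ ^ 2) ^ (α / 4 - 1)) • (2 • innerSL ℝ x)) x := by
    have h2 := ((hasStrictFDerivAt_norm_sq x).hasFDerivAt.const_add 1).rpow_const (p := α / 4)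
      (Or.inl (by positivity))
    exact h2
  have h3 : (1 + ‖x‖ ^ 2) ^ (α / 4 - 1) * ‖x‖ ≤ 1 := by
    have h4 : (1 + ‖x‖ ^ 2) ^ (α / 4 - 1) ≤ (1 + ‖x‖ ^ 2) ^ (-(1 / 2) : ℝ) :=
      Real.rpow_le_rpow_of_exponent_le h1 (by linarith)
    rw [Real.rpow_neg (by positivity), ← Real.sqrt_eq_rpow] at h4
    have h5 : ‖x‖ ≤ √(1 + ‖x‖ ^ 2) := Real.le_sqrt_of_sq_le (by linarith)
    calc _ ≤ (√(1 + ‖x‖ ^ 2))⁻¹ * √(1 + ‖x‖ ^ 2) := by gcongr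
      _ = 1 := inv_mul_cancel₀ (by positivity)
  have h6 : 0 ≤ (1 + ‖x‖ ^ 2) ^ (α / 4 - 1) := by positivity
  have h7 : ‖(2 • innerSL ℝ x : Plane →L[ℝ] ℝ)‖ ≤ 2 * ‖x‖ := by
    refine (norm_nsmul_le).trans ?_
    simp [innerSL_apply_norm]
  rw [hd.fderiv, norm_smul, Real.norm_of_nonneg (by positivity)]
  calc _ ≤ α / 4 * (1 + ‖x‖ ^ 2) ^ (α / 4 - 1) * (2 * ‖x‖) := by gcongr
    _ = α / 2 * ((1 + ‖x‖ ^ 2) ^ (α / 4 - 1) * ‖x‖) := by ring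
    _ ≤ 1 * 1 := mul_le_mul (by linarith) h3 (by positivity) zero_le_one
    _ = 1 := one_mul 1

/-- Compactly supported weights with uniformly bounded gradients exhausting `bracketWeight α`. -/
theorem exists_truncated_weight {α : ℝ} (hα : 0 < α) (hα2 : α < 2) :
    ∃ L : ℝ, 0 < L ∧ ∃ η : ℕ → Plane → ℝ, ∀ n, ContDiff ℝ 1 (η n) ∧ HasCompactSupport (η n) ∧
      (∀ x, 0 ≤ η n x) ∧ (∀ x, η n x ^ 2 ≤ 1 + ‖x‖ ^ α) ∧
      (∀ x, ‖x‖ ≤ n + 1 → ‖x‖ ^ α ≤ η n x ^ 2) ∧ ∀ x, ‖fderiv ℝ (η n) x‖ ≤ L := by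
  obtain ⟨M, hM, χ, hχ⟩ := exists_cutoff
  refine ⟨1 + 3 * M, by positivity, fun n x => bracketWeight α x * χ n x, fun n => ?_⟩
  obtain ⟨c1, c2, c3, c4, c5, c6, c7, c8⟩ := hχ n
  have hb0 : ∀ x, 0 ≤ bracketWeight α x := fun x => Real.rpow_nonneg (by positivity) _
  have hb := contDiff_bracketWeight α
  refine ⟨hb.mul c1, c2.mul_left, fun x => mul_nonneg (hb0 x) (c3 x), fun x => ?_, fun x hx => ?_,
    fun x => ?_⟩
  · rw [mul_pow]
    exact (mul_le_of_le_one_right (sq_nonneg _) (pow_le_one₀ (c3 x) (c4 x))).trans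
      (bracketWeight_sq_le hα hα2 x)
  · change ‖x‖ ^ α ≤ (bracketWeight α x * χ n x) ^ 2
    rw [c5 x hx, mul_one]
    exact norm_rpow_le_bracketWeight_sq hα x
  · have hn : (0 : ℝ) < (n : ℝ) + 1 := by positivity
    have hd : fderiv ℝ (fun x => bracketWeight α x * χ n x) x
        = bracketWeight α x • fderiv ℝ (χ n) x + χ n x • fderiv ℝ (bracketWeight α) x :=
      fderiv_fun_mul (hb.differentiable one_ne_zero x) (c1.differentiable one_ne_zero x)
    rw [hd]
    refine (norm_add_le _ _).trans ?_
    rw [norm_smul, norm_smul, Real.norm_of_nonneg (hb0 x), Real.norm_of_nonneg (c3 x), add_comm]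
    refine add_le_add ?_ ?_
    · calc _ ≤ (1 : ℝ) * 1 := mul_le_mul (c4 x) (norm_fderiv_bracketWeight_le hα hα2 x)
            (norm_nonneg _) zero_le_one
        _ = 1 := one_mul 1
    -- Where the cutoff gradient can be nonzero, |x| ≤ 2(n+1), so the weight, which grows at most
    -- linearly, is at most 3(n+1). This cancels the decay M/(n+1) and leaves the 3M in L.
    · by_cases hx : 2 * ((n : ℝ) + 1) < ‖x‖
      · rw [c8 x hx, norm_zero, mul_zero]; positivity
      · have h1 : bracketWeight α x ≤ 3 * ((n : ℝ) + 1) := by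
          have := bracketWeight_le hα2 x
          have : (0 : ℝ) ≤ n := n.cast_nonneg
          linarith
        calc _ ≤ 3 * ((n : ℝ) + 1) * (M / (n + 1)) :=
              mul_le_mul h1 (c7 x) (norm_nonneg _) (by positivity)
          _ = 3 * M := by field_simp

end Weight

/-! ### The basic energy inequality -/

section Solution

variable {μ β γ ρbar T : ℝ} {ρ : ℝ → Plane → ℝ} {u : ℝ → Plane → Plane}

theorem eLpNorm_eq_lpDist {r : Plane → ℝ} {U : Plane → Plane} (hγ : 1 < γ) (hρ : 0 < ρbar)
    (h : FiniteEnergyState γ ρbar r U) {p : ℝ} (hp : 2 ≤ p) :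
    eLpNorm (fun x => r x - ρbar) (ENNReal.ofReal p) volume
      = ENNReal.ofReal (lpDist ρbar p r) := by
  have hp0 : 0 < p := by linarith
  rw [eLpNorm_eq_lintegral_rpow_enorm_toReal (by simpa using hp0) ENNReal.ofReal_ne_top,
    ENNReal.toReal_ofReal hp0.le, lpDist,
    ← ENNReal.ofReal_rpow_of_nonneg (integral_nonneg fun x => by positivity) (by positivity),
    ofReal_integral_eq_lintegral_ofReal (h.integrable_rpow hγ hρ hp)
      (Eventually.of_forall fun x => by positivity)]
  congr 1
  refine lintegral_congr fun x => ?_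
  rw [← ENNReal.ofReal_rpow_of_nonneg (abs_nonneg _) hp0.le, ← Real.norm_eq_abs, ofReal_norm]

theorem integral_weight_energy_nonneg (hγ : 1 < γ) (hρ : 0 < ρbar)
    (hs : IsSmoothSolution μ β γ ρbar T ρ u) (η : Plane → ℝ) {t : ℝ} (ht : t ∈ Icc 0 T) :
    0 ≤ ∫ x, η x ^ 2 * energyDensity γ ρbar (ρ t) (u t) x :=
  integral_nonneg fun x => mul_nonneg (sq_nonneg _)
    (energyDensity_nonneg hγ hρ _ (hs.density_nonneg t ht x))

theorem integrable_weight_energy (hγ : 1 < γ) (hs : IsSmoothSolution μ β γ ρbar T ρ u)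
    {η : Plane → ℝ} (hη : Continuous η) (hηs : HasCompactSupport η) {t : ℝ} (ht : t ∈ Icc 0 T) :
    Integrable fun x => η x ^ 2 * energyDensity γ ρbar (ρ t) (u t) x := by
  have h1 : Continuous fun x => η x ^ 2 * energyDensity γ ρbar (ρ t) (u t) x :=
    (hη.pow 2).mul (continuous_energyDensity hγ (continuous_slice hs.density_continuous ht)
      (continuous_slice hs.velocity_continuous ht))
  refine h1.integrable_of_hasCompactSupport (hηs.mono fun x hx => ?_)
  contrapose! hx
  simp only [Function.mem_support, not_not] at hx ⊢
  simp [hx]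

/-- The energy inequality. -/
theorem integral_energyDensity_le (hμ : 0 < μ) (hβ : 0 < β) (hγ : 1 < γ) (hρ : 0 < ρbar)
    (hs : IsSmoothSolution μ β γ ρbar T ρ u) {E₀ : ℝ≥0}
    (hE : plainEnergy γ ρbar (ρ 0) (u 0) ≤ E₀) {t : ℝ} (ht : t ∈ Ioo 0 T) :
    ∫ x, energyDensity γ ρbar (ρ t) (u t) x ≤ E₀ := by
  obtain ⟨M, hM, χ, hχ⟩ := exists_cutoff
  obtain ⟨R, hR⟩ := hs.density_bounded
  obtain ⟨K, hK⟩ := exists_uniform_bounds hγ hρ hs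
  have ht' := Ioo_subset_Icc_self ht
  have h0T : (0 : ℝ) ∈ Icc 0 T := ⟨le_rfl, (ht.1.trans ht.2).le⟩
  obtain ⟨Q, hQ⟩ := exists_integral_weightError_le_qualitative (γ := γ) (ρbar := ρbar) hμ hβ hγ hρ
    R K K ((hs.density_nonneg t ht' 0).trans (hR t ht' 0))
  have hbound : ∀ n, ∫ x, χ n x ^ 2 * energyDensity γ ρbar (ρ t) (u t) x
      ≤ E₀ + t * (M / ((n : ℝ) + 1) * Q) := by
    intro n
    obtain ⟨c1, c2, c3, c4, c5, c6, c7, c8⟩ := hχ n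
    -- With the nonnegative dissipation dropped, the cut-off energy grows at rate at most QM/(n+1).
    -- Here Q depends on the solution but not on n, so its size is irrelevant in the limit.
    have hmain := intervalIntegral.sub_le_integral_of_hasDeriv_right_of_le
      (φ := fun _ => M / ((n : ℝ) + 1) * Q) ht.1.le
      ((continuousOn_weighted_energy hγ hs c1 c2).mono (Icc_subset_Icc_right ht.2.le))
      (fun s hst => (hasDerivAt_weighted_energy hβ hγ hρ hs c1 c2
        ⟨hst.1, hst.2.trans ht.2⟩).hasDerivWithinAt)
      (integrableOn_const (by simp)) (fun s hst => by
        have hsT : s ∈ Ioo 0 T := ⟨hst.1, hst.2.trans ht.2⟩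
        have hsT' := Ioo_subset_Icc_self hsT
        have h1 := hQ _ _ (finiteEnergyState hγ hρ hs hsT) (hR s hsT') (hK s hsT).1 (hK s hsT).2
          (χ n) c1 c2 c3 c4 _ c7
        have h2 : 0 ≤ ∫ x, χ n x ^ 2 * dissipationDensity μ β (ρ s) (u s) x :=
          integral_nonneg fun x => mul_nonneg (sq_nonneg _)
            (dissipationDensity_nonneg hμ _ (hs.density_nonneg s hsT' x))
        linarith)
    have h0 : ∫ x, χ n x ^ 2 * energyDensity γ ρbar (ρ 0) (u 0) x ≤ E₀ := by
      refine integral_le_of_lintegral_le (integrable_weight_energy hγ hs c1.continuous c2 h0T)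
        (fun x => mul_nonneg (sq_nonneg _)
          (energyDensity_nonneg hγ hρ _ (hs.density_nonneg 0 h0T x)))
        ((lintegral_mono fun x => ENNReal.ofReal_le_ofReal ?_).trans hE)
      have hr := hs.density_nonneg 0 h0T x
      refine (mul_le_of_le_one_left (energyDensity_nonneg hγ hρ _ hr)
        (pow_le_one₀ (c3 x) (c4 x))).trans ?_
      have := mul_nonneg hr (sq_nonneg ‖u 0 x‖)
      unfold energyDensity; linarith
    simp only [intervalIntegral.integral_const, sub_zero, smul_eq_mul] at hmain
    linarith
  have hc := continuous_energyDensity (ρbar := ρbar) hγ (continuous_slice hs.density_continuous ht')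
    (continuous_slice hs.velocity_continuous ht')
  refine (integrable_of_exhaustion
    (fun n => integrable_weight_energy hγ hs (hχ n).1.continuous (hχ n).2.1 ht')
    hc.aestronglyMeasurable
    (fun n x => mul_nonneg (sq_nonneg _)
      (energyDensity_nonneg hγ hρ _ (hs.density_nonneg t ht' x)))
    (fun x => energyDensity_nonneg hγ hρ _ (hs.density_nonneg t ht' x)) (fun x => ?_)
    hbound ?_).2
  · obtain ⟨N, hN⟩ := exists_nat_ge ‖x‖
    filter_upwards [eventually_ge_atTop N] with n hn
    have : (N : ℝ) ≤ n := by exact_mod_cast hn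
    rw [(hχ n).2.2.2.2.1 x (by linarith), one_pow, one_mul]
  · simpa using (((tendsto_const_div_succ M).mul_const Q).const_mul t).const_add (E₀ : ℝ)

theorem kinetic_and_potential_le (hμ : 0 < μ) (hβ : 0 < β) (hγ : 1 < γ) (hρ : 0 < ρbar)
    (hs : IsSmoothSolution μ β γ ρbar T ρ u) {E₀ : ℝ≥0}
    (hE : plainEnergy γ ρbar (ρ 0) (u 0) ≤ E₀) {t : ℝ} (ht : t ∈ Ioo 0 T) :
    ∫ x, ρ t x * ‖u t x‖ ^ 2 ≤ 2 * E₀ ∧ ∫ x, potentialEnergy γ ρbar (ρ t x) ≤ 2 * E₀ := by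
  have h := integral_energyDensity_le hμ hβ hγ hρ hs hE ht
  have hst := finiteEnergyState hγ hρ hs ht
  have i1 := hst.integrable_density_mul hst.integrable_sq
  have h1 : 0 ≤ ∫ x, ρ t x * ‖u t x‖ ^ 2 :=
    integral_nonneg fun x => mul_nonneg (hst.nonneg x) (sq_nonneg _)
  have h2 : 0 ≤ ∫ x, potentialEnergy γ ρbar (ρ t x) :=
    integral_nonneg fun x => potentialEnergy_nonneg hγ hρ (hst.nonneg x)
  unfold energyDensity at h
  rw [integral_add (i1.const_mul _) hst.integrable_potential, integral_const_mul] at h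
  constructor <;> linarith

/-- The qualitative bounds make this function of time bounded. Its integral is thereby known to be
finite before it is estimated. -/
theorem integrableOn_weighted_dissipation (hμ : 0 < μ) (hβ : 0 < β) (hγ : 1 < γ) (hρ : 0 < ρbar)
    (hs : IsSmoothSolution μ β γ ρbar T ρ u) {η : Plane → ℝ} (hη : Continuous η)
    (hηs : HasCompactSupport η) :
    IntegrableOn (fun s => ∫ x, η x ^ 2 * dissipationDensity μ β (ρ s) (u s) x) (Ioo 0 T) := by
  obtain ⟨R, hR⟩ := hs.density_bounded
  obtain ⟨K, hK⟩ := exists_uniform_bounds hγ hρ hs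
  obtain ⟨B, hB⟩ := hη.bounded_above_of_compact_support hηs
  have hcont : ContinuousOn (fun p : ℝ × Plane =>
      η p.2 ^ 2 * dissipationDensity μ β (ρ p.1) (u p.1) p.2) (Ioo 0 T ×ˢ univ) :=
    (((hη.comp continuous_snd).pow 2).continuousOn).mul (continuousOn_dissipationDensity hβ hs)
  have hnn : ∀ s ∈ Ioo 0 T, ∀ x, 0 ≤ η x ^ 2 * dissipationDensity μ β (ρ s) (u s) x :=
    fun s hsT x => mul_nonneg (sq_nonneg _)
      (dissipationDensity_nonneg hμ _ (hs.density_nonneg s (Ioo_subset_Icc_self hsT) x))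
  refine ⟨aestronglyMeasurable_integral_slice (f := fun s x =>
      η x ^ 2 * dissipationDensity μ β (ρ s) (u s) x) hcont hnn,
    HasFiniteIntegral.of_bounded (C := B ^ 2 * (μ + (μ + R ^ β) * 2) * K) ?_⟩
  filter_upwards [ae_restrict_mem measurableSet_Ioo] with s hsT
  have hst := finiteEnergyState hγ hρ hs hsT
  have hsT' := Ioo_subset_Icc_self hsT
  rw [Real.norm_of_nonneg (integral_nonneg (hnn s hsT))]
  have hR0 : 0 ≤ R := (hst.nonneg 0).trans (hR s hsT' 0)
  have hRβ : 0 ≤ R ^ β := by positivity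
  have hU0 : 0 ≤ ∫ x, ‖u s x‖ ^ 2 := integral_nonneg fun x => sq_nonneg _
  calc ∫ x, η x ^ 2 * dissipationDensity μ β (ρ s) (u s) x
      ≤ ∫ x, B ^ 2 * (μ + (μ + R ^ β) * 2) * gradSq (u s) x := by
        refine integral_mono_of_nonneg (Eventually.of_forall (hnn s hsT))
          (hst.integrable_gradSq.const_mul _) (Eventually.of_forall fun x => ?_)
        have h1 : η x ^ 2 ≤ B ^ 2 := by
          rw [← sq_abs]; exact pow_le_pow_left₀ (abs_nonneg _) (hB x) 2
        have hl0 : 0 ≤ bulkViscosity β (ρ s x) := Real.rpow_nonneg (hst.nonneg x) _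
        have hl : bulkViscosity β (ρ s x) ≤ R ^ β :=
          Real.rpow_le_rpow (hst.nonneg x) (hR s hsT' x) hβ.le
        have hg := gradSq_nonneg (u s) x
        have h2 : dissipationDensity μ β (ρ s) (u s) x
            ≤ (μ + (μ + R ^ β) * 2) * gradSq (u s) x := by
          have h3 : (μ + bulkViscosity β (ρ s x)) * divergence (u s) x ^ 2
              ≤ (μ + R ^ β) * (2 * gradSq (u s) x) :=
            mul_le_mul (by linarith) (divergence_sq_le _ _) (sq_nonneg _) (by positivity)
          unfold dissipationDensity
          linarith
        change η x ^ 2 * dissipationDensity μ β (ρ s) (u s) x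
          ≤ B ^ 2 * (μ + (μ + R ^ β) * 2) * gradSq (u s) x
        rw [mul_assoc]
        exact mul_le_mul h1 h2 (dissipationDensity_nonneg hμ _ (hst.nonneg x)) (sq_nonneg _)
    _ = B ^ 2 * (μ + (μ + R ^ β) * 2) * ∫ x, gradSq (u s) x := integral_const_mul _ _
    _ ≤ _ := by
        have := (hK s hsT).1
        gcongr
        linarith

end Solution

/-- Since √(2+x) ≤ 2+x, the right-hand side of the smallness condition never exceeds 4. -/
theorem lt_two_of_sq_lt {α x : ℝ} (hx : 0 ≤ x) (hα : α ^ 2 < 4 * (√(2 + x) - 1) / (1 + x)) :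
    α < 2 := by
  have h1 : (4 : ℝ) * (√(2 + x) - 1) / (1 + x) ≤ 4 := by
    rw [div_le_iff₀ (by linarith)]
    have : √(2 + x) ≤ 2 + x := by
      rw [Real.sqrt_le_left (by linarith)]; nlinarith
    linarith
  nlinarith

/-! ### The weighted estimate and removal of the truncation -/

section Solution

variable {μ β γ ρbar T α : ℝ} {ρ : ℝ → Plane → ℝ} {u : ℝ → Plane → Plane}

/-- The growth rate on the right-hand side of the weighted energy estimate. -/
noncomputable def growthRate (β ρbar p : ℝ) (ρ : ℝ → Plane → ℝ) (u : ℝ → Plane → Plane) (s : ℝ) :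
    ℝ :=
  (1 + lpDist ρbar p (ρ s) ^ β) * (1 + ∫ x, gradSq (u s) x)

theorem growthRate_nonneg (β ρbar p : ℝ) (ρ : ℝ → Plane → ℝ) (u : ℝ → Plane → Plane) (s : ℝ) :
    0 ≤ growthRate β ρbar p ρ u s := by
  have h1 := Real.rpow_nonneg (lpDist_nonneg ρbar p (ρ s)) β
  have h2 : 0 ≤ ∫ x, gradSq (u s) x := integral_nonneg (gradSq_nonneg _)
  unfold growthRate
  positivity

theorem ofReal_growthRate (hβ : 0 < β) (hγ : 1 < γ) (hρ : 0 < ρbar)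
    (hs : IsSmoothSolution μ β γ ρbar T ρ u) {p : ℝ} (hp : 2 ≤ p) {s : ℝ} (hsT : s ∈ Ioo 0 T) :
    (eLpNorm (fun x => ρ s x - ρbar) (ENNReal.ofReal p) volume ^ β + 1)
        * ((∫⁻ x, ENNReal.ofReal (gradSq (u s) x)) + 1)
      = ENNReal.ofReal (growthRate β ρbar p ρ u s) := by
  have h := finiteEnergyState hγ hρ hs hsT
  have h1 := lpDist_nonneg ρbar p (ρ s)
  have h2 : 0 ≤ ∫ x, gradSq (u s) x := integral_nonneg (gradSq_nonneg _)
  have h3 := Real.rpow_nonneg h1 β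
  rw [eLpNorm_eq_lpDist hγ hρ h hp, ENNReal.ofReal_rpow_of_nonneg h1 hβ.le,
    ← ofReal_integral_eq_lintegral_ofReal h.integrable_gradSq
      (Eventually.of_forall (gradSq_nonneg _)), ← ENNReal.ofReal_one,
    ← ENNReal.ofReal_add h3 zero_le_one, ← ENNReal.ofReal_add h2 zero_le_one,
    ← ENNReal.ofReal_mul (by positivity), growthRate, add_comm 1, add_comm 1]

theorem aestronglyMeasurable_growthRate (hβ : 0 < β)
    (hs : IsSmoothSolution μ β γ ρbar T ρ u) {p : ℝ} (hp : 2 ≤ p) :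
    AEStronglyMeasurable (growthRate β ρbar p ρ u) (volume.restrict (Ioo 0 T)) := by
  have hc : ContinuousOn (fun q : ℝ × Plane => |ρ q.1 q.2 - ρbar| ^ p) (Ioo 0 T ×ˢ univ) :=
    (Real.continuous_rpow_const (by linarith)).comp_continuousOn
      (hs.density_contDiff.continuousOn.sub continuousOn_const).abs
  have h1 := aestronglyMeasurable_integral_slice (f := fun s x => |ρ s x - ρbar| ^ p) hc
    fun s _ x => by positivity
  have h2 := aestronglyMeasurable_integral_slice (f := fun s x => gradSq (u s) x)
    (continuousOn_gradSq hs) fun s _ x => gradSq_nonneg _ _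
  have h3 : AEStronglyMeasurable (fun s => lpDist ρbar p (ρ s) ^ β)
      (volume.restrict (Ioo 0 T)) :=
    (Real.continuous_rpow_const hβ.le).comp_aestronglyMeasurable
      ((Real.continuous_rpow_const (by positivity : 0 ≤ 1 / p)).comp_aestronglyMeasurable h1)
  exact (aestronglyMeasurable_const.add h3).mul (aestronglyMeasurable_const.add h2)

/-- The truncated weighted energy estimate, with a constant independent of the truncation. -/
theorem exists_truncated_estimate (hμ : 0 < μ) (hγ : 1 < γ) (hρ : 0 < ρbar)
    (hγβ : γ ≤ 2 * β) (E₀ : ℝ≥0) {L : ℝ} (hL : 0 < L) (T : ℝ) :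
    ∃ C : ℝ, 0 < C ∧ ∀ ρ u, IsSmoothSolution μ β γ ρbar T ρ u →
      plainEnergy γ ρbar (ρ 0) (u 0) ≤ E₀ → weightedEnergy α γ ρbar (ρ 0) (u 0) ≤ E₀ →
      ∀ p, 4 * β + 1 ≤ p → ∀ t ∈ Icc 0 T,
      IntegrableOn (growthRate β ρbar p ρ u) (Ioo 0 t) →
      ∀ η : Plane → ℝ, ContDiff ℝ 1 η → HasCompactSupport η → (∀ x, 0 ≤ η x) →
      (∀ x, ‖fderiv ℝ η x‖ ≤ L) → (∀ x, η x ^ 2 ≤ 1 + ‖x‖ ^ α) →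
      (∫ x, η x ^ 2 * energyDensity γ ρbar (ρ t) (u t) x)
          + 1 / 2 * (∫ s in Ioo 0 t, ∫ x, η x ^ 2 * dissipationDensity μ β (ρ s) (u s) x)
        ≤ C * (1 + ∫ s in Ioo 0 t, growthRate β ρbar p ρ u s) := by
  have hβ : 0 < β := by linarith
  -- The energy inequality bounds kinetic and potential energy separately by 2E₀. Hence K depends on
  -- E₀ and L, but on neither p, the solution nor the truncation.
  obtain ⟨K, hK, herr⟩ := exists_integral_weightError_le hμ hγ hρ hγβ
    (E := 2 * E₀) (by positivity) hL
  refine ⟨Real.exp (K * T) * (2 * E₀ + K), by positivity,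
    fun ρ u hs hE hW p hp t ht hint η hη hηs hη0 hηL hηα => ?_⟩
  have h0T : (0 : ℝ) ∈ Icc 0 T := ⟨le_rfl, ht.1.trans ht.2⟩
  have hsub : Ioo 0 t ⊆ Ioo 0 T := Ioo_subset_Ioo_right ht.2
  have hr0 := hs.density_nonneg 0 h0T
  -- Since η² ≤ 1 + |x|^α, the initial truncated energy is at most the plain plus the weighted
  -- initial energy, E₀ + E₀.
  have hY0 : ∫ x, η x ^ 2 * energyDensity γ ρbar (ρ 0) (u 0) x ≤ 2 * E₀ := by
    have hrc := continuous_slice hs.density_continuous h0T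
    have huc := continuous_slice hs.velocity_continuous h0T
    have hP : Continuous fun x => potentialEnergy γ ρbar (ρ 0 x) :=
      (continuous_potentialEnergy hγ).comp hrc
    have hc : Continuous fun x => ρ 0 x * ‖u 0 x‖ ^ 2 + potentialEnergy γ ρbar (ρ 0 x) :=
      (hrc.mul (huc.norm.pow 2)).add hP
    refine (integral_le_of_lintegral_le (K := 2 * E₀)
      (integrable_weight_energy hγ hs hη.continuous hηs h0T)
      (fun x => mul_nonneg (sq_nonneg _) (energyDensity_nonneg hγ hρ _ (hr0 x))) ?_).trans_eq
      (by push_cast; ring)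
    calc ∫⁻ x, ENNReal.ofReal (η x ^ 2 * energyDensity γ ρbar (ρ 0) (u 0) x)
        ≤ ∫⁻ x, (ENNReal.ofReal (ρ 0 x * ‖u 0 x‖ ^ 2 + potentialEnergy γ ρbar (ρ 0 x))
          + ENNReal.ofReal (‖x‖ ^ α *
            (ρ 0 x * ‖u 0 x‖ ^ 2 + potentialEnergy γ ρbar (ρ 0 x)))) := by
          refine lintegral_mono fun x => ?_
          have h1 := mul_nonneg (hr0 x) (sq_nonneg ‖u 0 x‖)
          have h2 := potentialEnergy_nonneg hγ hρ (hr0 x)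
          have h3 : 0 ≤ ρ 0 x * ‖u 0 x‖ ^ 2 + potentialEnergy γ ρbar (ρ 0 x) := by positivity
          rw [← ENNReal.ofReal_add h3 (by positivity)]
          refine ENNReal.ofReal_le_ofReal ?_
          have h4 : energyDensity γ ρbar (ρ 0) (u 0) x
              ≤ ρ 0 x * ‖u 0 x‖ ^ 2 + potentialEnergy γ ρbar (ρ 0 x) := by
            unfold energyDensity; linarith
          calc _ ≤ (1 + ‖x‖ ^ α) * (ρ 0 x * ‖u 0 x‖ ^ 2 + potentialEnergy γ ρbar (ρ 0 x)) :=
                mul_le_mul (hηα x) h4 (energyDensity_nonneg hγ hρ _ (hr0 x)) (by positivity)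
            _ = _ := by ring
      _ = plainEnergy γ ρbar (ρ 0) (u 0) + weightedEnergy α γ ρbar (ρ 0) (u 0) :=
          lintegral_add_left hc.measurable.ennreal_ofReal _
      _ ≤ E₀ + E₀ := add_le_add hE hW
      _ = _ := by push_cast; ring
  have hg := gronwall_dissipation (T := T)
    (Y := fun s => ∫ x, η x ^ 2 * energyDensity γ ρbar (ρ s) (u s) x)
    (Y' := fun s => (∫ x, weightError μ β γ ρbar η (ρ s) (u s) x)
        - ∫ x, η x ^ 2 * dissipationDensity μ β (ρ s) (u s) x)
    (D := fun s => ∫ x, η x ^ 2 * dissipationDensity μ β (ρ s) (u s) x)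
    (h := growthRate β ρbar p ρ u) hK.le ht.1 ht.2
    ((continuousOn_weighted_energy hγ hs hη hηs).mono (Icc_subset_Icc_right ht.2))
    (fun s hst => integral_weight_energy_nonneg hγ hρ hs η ⟨hst.1, hst.2.trans ht.2⟩)
    (fun s hst => hasDerivAt_weighted_energy hβ hγ hρ hs hη hηs (hsub hst))
    (fun s hst => integral_nonneg fun x => mul_nonneg (sq_nonneg _) (dissipationDensity_nonneg hμ _
      (hs.density_nonneg s (Ioo_subset_Icc_self (hsub hst)) x)))
    (fun s _ => growthRate_nonneg _ _ _ _ _ s)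
    (fun s hst => by
      obtain ⟨k1, k2⟩ := kinetic_and_potential_le hμ hβ hγ hρ hs hE (hsub hst)
      have := herr _ _ (finiteEnergyState hγ hρ hs (hsub hst)) k1 k2 p hp η hη hηs hη0 hηL
      change _ - _ ≤ _
      unfold growthRate
      linarith)
    ((integrableOn_weighted_dissipation hμ hβ hγ hρ hs hη.continuous hηs).mono_set hsub) hint
  refine hg.trans ?_
  rw [mul_assoc]
  refine mul_le_mul_of_nonneg_left ?_ (Real.exp_pos _).le
  have hI : 0 ≤ ∫ s in Ioo 0 t, growthRate β ρbar p ρ u s :=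
    integral_nonneg fun s => growthRate_nonneg _ _ _ _ _ s
  have hE0 : (0 : ℝ) ≤ 2 * E₀ := by positivity
  nlinarith

theorem weightedEnergy_le_of_truncated (hγ : 1 < γ) (hρ : 0 < ρbar)
    (hs : IsSmoothSolution μ β γ ρbar T ρ u) {η : ℕ → Plane → ℝ}
    (hη : ∀ n, Continuous (η n)) (hηs : ∀ n, HasCompactSupport (η n))
    (hηα : ∀ (n : ℕ) x, ‖x‖ ≤ n + 1 → ‖x‖ ^ α ≤ η n x ^ 2) {t : ℝ} (ht : t ∈ Icc 0 T) {B : ℝ}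
    (hB : ∀ n, ∫ x, η n x ^ 2 * energyDensity γ ρbar (ρ t) (u t) x ≤ B) :
    weightedEnergy α γ ρbar (ρ t) (u t) ≤ ENNReal.ofReal (2 * B) := by
  have hr0 := hs.density_nonneg t ht
  have hI := fun n => integrable_weight_energy (ρbar := ρbar) hγ hs (hη n) (hηs n) ht
  refine lintegral_le_of_exhaustion
    (g := fun n x => ENNReal.ofReal (2 * (η n x ^ 2 * energyDensity γ ρbar (ρ t) (u t) x)))
    (b := fun _ => ENNReal.ofReal (2 * B))
    (fun n => ((hI n).aestronglyMeasurable.aemeasurable.const_mul 2).ennreal_ofReal)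
    (Eventually.of_forall fun x => ?_) (fun n => ?_) tendsto_const_nhds
  · obtain ⟨N, hN⟩ := exists_nat_ge ‖x‖
    filter_upwards [eventually_ge_atTop N] with n hn
    have hnN : (N : ℝ) ≤ n := by exact_mod_cast hn
    refine ENNReal.ofReal_le_ofReal ?_
    have h1 := mul_nonneg (hr0 x) (sq_nonneg ‖u t x‖)
    have h2 := potentialEnergy_nonneg hγ hρ (hr0 x)
    have h3 := hηα n x (by linarith)
    have h4 : ρ t x * ‖u t x‖ ^ 2 + potentialEnergy γ ρbar (ρ t x)
        ≤ 2 * energyDensity γ ρbar (ρ t) (u t) x := by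
      unfold energyDensity; linarith
    calc _ ≤ η n x ^ 2 * (2 * energyDensity γ ρbar (ρ t) (u t) x) :=
          mul_le_mul h3 h4 (by positivity) (sq_nonneg _)
      _ = _ := by ring
  · rw [← ofReal_integral_eq_lintegral_ofReal ((hI n).const_mul 2)
      (Eventually.of_forall fun x => mul_nonneg zero_le_two
        (mul_nonneg (sq_nonneg _) (energyDensity_nonneg hγ hρ _ (hr0 x)))), integral_const_mul]
    exact ENNReal.ofReal_le_ofReal (by linarith [hB n])

theorem weightedDissipation_le (hμ : 0 < μ) {r : Plane → ℝ} {U : Plane → Plane}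
    (hr : ∀ x, 0 ≤ r x) :
    weightedDissipation α β r U ≤ ENNReal.ofReal (2 / μ + 1) *
      ∫⁻ x, ENNReal.ofReal (‖x‖ ^ α * dissipationDensity μ β r U x) := by
  have hl : ∀ x, 0 ≤ bulkViscosity β (r x) := fun x => Real.rpow_nonneg (hr x) _
  have key : ∀ (c : ℝ), 0 ≤ c → ∀ g : Plane → ℝ, (∀ x, g x ≤ c * dissipationDensity μ β r U x) →
      ∫⁻ x, ENNReal.ofReal (‖x‖ ^ α * g x) ≤ ENNReal.ofReal c *
        ∫⁻ x, ENNReal.ofReal (‖x‖ ^ α * dissipationDensity μ β r U x) := by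
    intro c hc g hg
    rw [← lintegral_const_mul' _ _ ENNReal.ofReal_ne_top]
    refine lintegral_mono fun x => ?_
    rw [← ENNReal.ofReal_mul hc]
    refine ENNReal.ofReal_le_ofReal ?_
    have := mul_le_mul_of_nonneg_left (hg x) (by positivity : 0 ≤ ‖x‖ ^ α)
    linarith
  have hle : ∀ x, gradSq U x ≤ 1 / μ * dissipationDensity μ β r U x ∧
      divergence U x ^ 2 ≤ 1 / μ * dissipationDensity μ β r U x ∧
      bulkViscosity β (r x) * divergence U x ^ 2 ≤ 1 * dissipationDensity μ β r U x := by
    intro x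
    have h1 : 0 ≤ μ * gradSq U x := mul_nonneg hμ.le (gradSq_nonneg U x)
    have h2 : 0 ≤ μ * divergence U x ^ 2 := by positivity
    have h3 : 0 ≤ bulkViscosity β (r x) * divergence U x ^ 2 := mul_nonneg (hl x) (sq_nonneg _)
    rw [one_div_mul_eq_div, le_div_iff₀ hμ, le_div_iff₀ hμ, one_mul]
    unfold dissipationDensity
    refine ⟨?_, ?_, ?_⟩ <;> linarith
  have hμ' : 0 ≤ 1 / μ := by positivity
  calc weightedDissipation α β r U ≤ _ + _ + _ :=
        add_le_add (add_le_add (key _ hμ' _ fun x => (hle x).1) (key _ hμ' _ fun x => (hle x).2.1))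
          (key _ zero_le_one _ fun x => (hle x).2.2)
    _ = _ := by
        rw [← add_mul, ← add_mul, ← ENNReal.ofReal_add hμ' hμ',
          ← ENNReal.ofReal_add (by positivity) zero_le_one]
        congr 2
        ring

/-- Fatou's lemma is used twice, in x at each time and then in t. At every point the truncated
weights eventually dominate |x|^α, and no monotonicity in n is needed. -/
theorem lintegral_weightedDissipation_le_of_truncated (hμ : 0 < μ) (hβ : 0 < β) (hγ : 1 < γ)
    (hρ : 0 < ρbar) (hs : IsSmoothSolution μ β γ ρbar T ρ u) {η : ℕ → Plane → ℝ}
    (hη : ∀ n, Continuous (η n)) (hηs : ∀ n, HasCompactSupport (η n))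
    (hηα : ∀ (n : ℕ) x, ‖x‖ ≤ n + 1 → ‖x‖ ^ α ≤ η n x ^ 2) {t : ℝ} (ht : t ∈ Icc 0 T) {B : ℝ}
    (hB : ∀ n, ∫ s in Ioo 0 t, ∫ x, η n x ^ 2 * dissipationDensity μ β (ρ s) (u s) x ≤ B) :
    ∫⁻ s in Ioo 0 t, weightedDissipation α β (ρ s) (u s)
      ≤ ENNReal.ofReal (2 / μ + 1) * ENNReal.ofReal B := by
  have hsub : Ioo 0 t ⊆ Ioo 0 T := Ioo_subset_Ioo_right ht.2
  have hcont : ∀ n, ContinuousOn (fun p : ℝ × Plane =>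
      η n p.2 ^ 2 * dissipationDensity μ β (ρ p.1) (u p.1) p.2) (Ioo 0 T ×ˢ univ) := fun n =>
    ((((hη n).comp continuous_snd).pow 2).continuousOn).mul (continuousOn_dissipationDensity hβ hs)
  have hnn : ∀ s ∈ Ioo 0 T, ∀ x, 0 ≤ dissipationDensity μ β (ρ s) (u s) x := fun s hsT x =>
    dissipationDensity_nonneg hμ _ (hs.density_nonneg s (Ioo_subset_Icc_self hsT) x)
  have hinner : ∀ s ∈ Ioo 0 t,
      ∫⁻ x, ENNReal.ofReal (‖x‖ ^ α * dissipationDensity μ β (ρ s) (u s) x) ≤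
        liminf (fun n => ∫⁻ x, ENNReal.ofReal
          (η n x ^ 2 * dissipationDensity μ β (ρ s) (u s) x)) atTop := by
    intro s hst
    refine lintegral_le_liminf_of_exhaustion (fun n => ?_) fun x => ?_
    · exact (continuous_slice (f := fun s x => η n x ^ 2 * dissipationDensity μ β (ρ s) (u s) x)
        (hcont n) (hsub hst)).measurable.ennreal_ofReal.aemeasurable
    · obtain ⟨N, hN⟩ := exists_nat_ge ‖x‖
      filter_upwards [eventually_ge_atTop N] with n hn
      have hnN : (N : ℝ) ≤ n := by exact_mod_cast hn
      exact ENNReal.ofReal_le_ofReal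
        (mul_le_mul_of_nonneg_right (hηα n x (by linarith)) (hnn s (hsub hst) x))
  have hbound : ∀ n, ∫⁻ s in Ioo 0 t, ∫⁻ x, ENNReal.ofReal
      (η n x ^ 2 * dissipationDensity μ β (ρ s) (u s) x) ≤ ENNReal.ofReal B := by
    intro n
    have hI := (integrableOn_weighted_dissipation hμ hβ hγ hρ hs (hη n) (hηs n)).mono_set hsub
    have e : ∀ s ∈ Ioo 0 t, ∫⁻ x, ENNReal.ofReal
        (η n x ^ 2 * dissipationDensity μ β (ρ s) (u s) x)
        = ENNReal.ofReal (∫ x, η n x ^ 2 * dissipationDensity μ β (ρ s) (u s) x) := by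
      intro s hst
      have hc := continuous_slice
        (f := fun s x => η n x ^ 2 * dissipationDensity μ β (ρ s) (u s) x) (hcont n) (hsub hst)
      refine (ofReal_integral_eq_lintegral_ofReal (hc.integrable_of_hasCompactSupport
        ((hηs n).mono fun x hx => ?_)) (Eventually.of_forall fun x =>
          mul_nonneg (sq_nonneg _) (hnn s (hsub hst) x))).symm
      contrapose! hx
      simp only [Function.mem_support, not_not] at hx ⊢
      simp [hx]
    rw [setLIntegral_congr_fun measurableSet_Ioo e, ← ofReal_integral_eq_lintegral_ofReal hI]
    · exact ENNReal.ofReal_le_ofReal (hB n)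
    · filter_upwards [ae_restrict_mem measurableSet_Ioo] with s hst
      exact integral_nonneg fun x => mul_nonneg (sq_nonneg _) (hnn s (hsub hst) x)
  calc ∫⁻ s in Ioo 0 t, weightedDissipation α β (ρ s) (u s)
      ≤ ∫⁻ s in Ioo 0 t, ENNReal.ofReal (2 / μ + 1) * liminf (fun n => ∫⁻ x, ENNReal.ofReal
          (η n x ^ 2 * dissipationDensity μ β (ρ s) (u s) x)) atTop := by
        refine setLIntegral_mono' measurableSet_Ioo fun s hst => ?_
        refine (weightedDissipation_le hμ
          (hs.density_nonneg s (Ioo_subset_Icc_self (hsub hst)))).trans ?_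
        gcongr
        exact hinner s hst
    _ = ENNReal.ofReal (2 / μ + 1) * ∫⁻ s in Ioo 0 t, liminf (fun n => ∫⁻ x, ENNReal.ofReal
          (η n x ^ 2 * dissipationDensity μ β (ρ s) (u s) x)) atTop :=
        lintegral_const_mul' _ _ ENNReal.ofReal_ne_top
    _ ≤ ENNReal.ofReal (2 / μ + 1) * liminf (fun n => ∫⁻ s in Ioo 0 t, ∫⁻ x, ENNReal.ofReal
          (η n x ^ 2 * dissipationDensity μ β (ρ s) (u s) x)) atTop := by
        gcongr
        refine lintegral_liminf_le' fun n => ?_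
        exact (aemeasurable_lintegral_slice
          (f := fun s x => η n x ^ 2 * dissipationDensity μ β (ρ s) (u s) x)
          (hcont n)).mono_measure (Measure.restrict_mono hsub le_rfl)
    _ ≤ ENNReal.ofReal (2 / μ + 1) * ENNReal.ofReal B := by
        gcongr
        exact (liminf_le_liminf (Eventually.of_forall hbound)).trans_eq (liminf_const _)

end Solution

end WeightedEnergy

theorem lemma3p2 (μ β γ ρbar α : ℝ) (hμ : 0 < μ) (hβ : 0 < β) (hγ : 1 < γ) (hρbar : 0 < ρbar)
    (hγβ : γ ≤ 2 * β) (hα : 0 < α)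
    (hα' : α ^ 2 < 4 * (√(2 + bulkViscosity β ρbar / μ) - 1) / (1 + bulkViscosity β ρbar / μ)) :
    ∃ m₀ : ℝ, 1 < m₀ ∧ ∀ (T : ℝ) (E₀ : ℝ≥0), 0 < T → ∃ C : ℝ≥0, 0 < C ∧
      ∀ (ρ : ℝ → Plane → ℝ) (u : ℝ → Plane → Plane), IsSmoothSolution μ β γ ρbar T ρ u →
        plainEnergy γ ρbar (ρ 0) (u 0) ≤ E₀ → weightedEnergy α γ ρbar (ρ 0) (u 0) ≤ E₀ →
        ∀ m : ℝ, m₀ ≤ m → ∀ t ∈ Icc 0 T,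
          weightedEnergy α γ ρbar (ρ t) (u t)
              + ∫⁻ s in Ioo 0 t, weightedDissipation α β (ρ s) (u s)
            ≤ C * (1 + ∫⁻ s in Ioo 0 t,
                (eLpNorm (fun x => ρ s x - ρbar) (ENNReal.ofReal (2 * m * β + 1)) volume ^ β + 1)
                  * ((∫⁻ x, ENNReal.ofReal (gradSq (u s) x)) + 1)) := by
  have hα2 : α < 2 := WeightedEnergy.lt_two_of_sq_lt
    (div_nonneg (Real.rpow_nonneg hρbar.le β) hμ.le) hα'
  obtain ⟨L, hL, η, hη⟩ := WeightedEnergy.exists_truncated_weight hα hα2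
  -- With m ≥ 2 the exponent 2mβ+1 is at least 4β+1, which is ample for every use of Hölder's
  -- inequality (growths γ ≤ 2β, β and 1 must be at most p/2).
  refine ⟨2, one_lt_two, fun T E₀ hT => ?_⟩
  obtain ⟨C, hC, hest⟩ :=
    WeightedEnergy.exists_truncated_estimate (α := α) (μ := μ) hμ hγ hρbar hγβ E₀ hL T
  have hc : 0 < 2 / μ + 1 := by positivity
  refine ⟨Real.toNNReal (2 * C * (1 + (2 / μ + 1))), Real.toNNReal_pos.2 (by positivity),
    fun ρ u hs hE hW m hm t ht => ?_⟩
  change _ ≤ ENNReal.ofReal (2 * C * (1 + (2 / μ + 1))) * _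
  set p := 2 * m * β + 1 with hp
  have hp4 : 4 * β + 1 ≤ p := by rw [hp]; nlinarith
  have hp2 : 2 ≤ p := by linarith
  have hsub : Ioo 0 t ⊆ Ioo 0 T := Ioo_subset_Ioo_right ht.2
  rw [setLIntegral_congr_fun measurableSet_Ioo fun s hst =>
    WeightedEnergy.ofReal_growthRate hβ hγ hρbar hs hp2 (hsub hst)]
  have hg0 := WeightedEnergy.growthRate_nonneg β ρbar p ρ u
  -- If the right-hand side is infinite there is nothing to prove; otherwise the growth rate is
  -- integrable in time and the real-valued estimate applies.
  by_cases htop : ∫⁻ s in Ioo 0 t, ENNReal.ofReal (WeightedEnergy.growthRate β ρbar p ρ u s) = ⊤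
  · rw [htop, add_top, ENNReal.mul_top]
    · exact le_top
    · exact (ENNReal.ofReal_pos.2 (by positivity)).ne'
  have hint : IntegrableOn (WeightedEnergy.growthRate β ρbar p ρ u) (Ioo 0 t) := by
    refine ⟨(WeightedEnergy.aestronglyMeasurable_growthRate hβ hs hp2).mono_measure
      (Measure.restrict_mono hsub le_rfl), ?_⟩
    rw [hasFiniteIntegral_iff_ofReal (Filter.Eventually.of_forall hg0)]
    exact lt_top_iff_ne_top.2 htop
  rw [← ofReal_integral_eq_lintegral_ofReal hint (Filter.Eventually.of_forall hg0)]
  have hI : 0 ≤ ∫ s in Ioo 0 t, WeightedEnergy.growthRate β ρbar p ρ u s := integral_nonneg hg0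
  set I := ∫ s in Ioo 0 t, WeightedEnergy.growthRate β ρbar p ρ u s
  have htrunc := fun n => hest ρ u hs hE hW p hp4 t ht hint (η n) (hη n).1 (hη n).2.1 (hη n).2.2.1
    (hη n).2.2.2.2.2 (hη n).2.2.2.1
  have hD0 : ∀ n, 0 ≤ ∫ s in Ioo 0 t,
      ∫ x, η n x ^ 2 * WeightedEnergy.dissipationDensity μ β (ρ s) (u s) x := fun n =>
    setIntegral_nonneg measurableSet_Ioo fun s hst => integral_nonneg fun x =>
      mul_nonneg (sq_nonneg _) (WeightedEnergy.dissipationDensity_nonneg hμ _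
        (hs.density_nonneg s (Ioo_subset_Icc_self (hsub hst)) x))
  have h1 := WeightedEnergy.weightedEnergy_le_of_truncated (B := C * (1 + I)) hγ hρbar hs
    (fun n => (hη n).1.continuous) (fun n => (hη n).2.1) (fun n => (hη n).2.2.2.2.1) ht
    fun n => by linarith [htrunc n, hD0 n]
  have h2 := WeightedEnergy.lintegral_weightedDissipation_le_of_truncated (B := 2 * (C * (1 + I)))
    hμ hβ hγ hρbar hs
    (fun n => (hη n).1.continuous) (fun n => (hη n).2.1) (fun n => (hη n).2.2.2.2.1) ht
    fun n => by
      linarith [htrunc n, WeightedEnergy.integral_weight_energy_nonneg hγ hρbar hs (η n) ht]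
  -- The energy contributes 2C(1+I). The dissipation contributes (2/μ+1)·2C(1+I), the factor 2
  -- undoing the coefficient 1/2 kept in Grönwall's inequality.
  refine (add_le_add h1 h2).trans_eq ?_
  rw [← ENNReal.ofReal_mul hc.le, ← ENNReal.ofReal_add (by positivity) (by positivity),
    ← ENNReal.ofReal_one, ← ENNReal.ofReal_add zero_le_one hI, ← ENNReal.ofReal_mul (by positivity)]
  congr 1
  ring
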